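/- **Graphs.** Index the hexagons of the honeycomb lattice by $\mathbb Z^3/\mathbb Z(1,1,1)$, projected along $(1,1,1)$ so that $(0,0,1)$ points upwards and $(1,0,0)$, $(0,1,0)$ point to the lower left and lower right; edges are then horizontal, northwest/southeast or northeast/southwest. For $x,y,z\in\mathbb Z_{\ge 0}$ let $H_{x,y,z}$ be the honeycomb graph whose vertices are the lattice triangles in the projection of $[0,x]\times[0,y]\times[0,z]$. Let $D(G)$ be the set of dimer configurations (perfect matchings) of $G$, and $DD(G)$ the set of double dimer configurations (multisets of edges in which every vertex has degree $2$; they consist of doubled edges and disjoint closed loops). Call a hexagon of $H_{2x,2y,2z}$ even if it has even coordinates. The edges not bordering an even hexagon form disjoint propellers ($K_{1,3}$'s); contracting every propeller to a point maps $H_{2x,2y,2z}$ to $H_{x,y,z}$, the even hexagon $(2i,2j,2k)$ becoming the hexagon $(i,j,k)$. Over each edge $E$ of $H_{x,y,z}$ lie two edges of $H_{2x,2y,2z}$, one bordering each of the two even hexagons that $E$ separates. The squish map $Sq$ deletes from $m\in D(H_{2x,2y,2z})$ the propeller edges and sends the other edges to their images, counted with multiplicity. **Weights.** Let $p,q,r,s,t,a,b,c\in\mathbb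 C^*$ with $p^3=q$, $a^2=r$, $b^2=s$, $c^2=t$. The *2-periodic weights* $w$ on $H_{2x,2y,2z}$ are: propeller edges have weight $1$; the two edges over the horizontal edge of $H_{x,y,z}$ at level $h\in\mathbb Z$ of a vertical strip of hexagons (levels increase upwards by one per hexagon) have weights $k_3t^hp^h$ (lower) and $k_3t^{h+1}p^h$ (upper); over a northwest/southeast edge at level $h$ of its strip (levels increasing to the lower left) they are $k_2s^hp^h$ and $k_2s^{h+1}p^h$ (the latter on the lower left side); over a northeast/southwest edge at level $h$ of its strip (levels increasing to the lower right) they are $k_1r^hp^h$ and $k_1r^{h+1}p^h$ (the latter on the lower right side). Here $k_1,k_2,k_3\in\mathbb C^*$ may be chosen independently for each strip. The *squished scalar weight* $\bar w(E)$ of an edge $E$ of $H_{x,y,z}$ is the geometric mean of the weights of the two edges over it, i.e. $k_3t^{h}c\,p^h$, $k_2s^{h}b\,p^h$, $k_1r^{h}a\,p^h$ respectively. The *monochromatic weight* $w_Q$ on $H_{x,y,z}$, where $Q=qrst$, is $1$ on non-horizontal edges and $\dots,Q^{-1},1,Q,Q^2,\dots$ (upwards) on the horizontal edges of each vertical strip,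 with the weight $1$ placed at an arbitrary level of each strip. **Connection.** Put $$\alpha=\begin{pmatrix} ia&0\\0&\frac1{ia}\end{pmatrix},\quad \beta=\begin{pmatrix} ib&-ib-\frac ib\\0&\frac1{ib}\end{pmatrix},\quad \gamma=\begin{pmatrix}\frac1{ic}&0\\-ic-\frac ic&ic\end{pmatrix}\in SL_2(\mathbb C).$$ Place $\alpha$ on each edge of $H_{x,y,z}$ crossed towards the northeast, $\beta$ on each edge crossed towards the northwest, $\gamma$ on each edge crossed towards the west, and the inverse matrices for the opposite directions. Let $\Gamma$ be this connection, or the one obtained by replacing $(a,b,c)$ by $(a^{-1},b^{-1},c^{-1})$ in $\alpha,\beta,\gamma$. For a scalar weight $\omega$ the contribution of $N\in DD(H_{x,y,z})$ is $$\nu_{\omega,\Gamma}(N)=\prod_{e\in N}\omega(e)\ \prod_{\text{closed loops }L\text{ of }N}\operatorname{Tr}\Big(\prod_{e\in L}\Gamma(e)\Big),$$ edges being counted with multiplicity, and the product over $L$ being taken in cyclic order with later steps on the left. **Theorem.** The squish map $Sq:D(H_{2x,2y,2z})\to DD(H_{x,y,z})$ is well defined and measure-preserving: for every $S\subseteq DD(H_{x,y,z})$,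 $$\sum_{m:\ Sq(m)\in S}\ \prod_{e\in m}w(e)=\sum_{N\in S}\nu_{\bar w,\Gamma}(N).$$ The same holds with the scalar weight $\bar w$ replaced by any monochromatic weight $w_Q$, up to an overall constant: there is $\kappa\in\mathbb C^*$, not depending on $S$, such that for every $S\subseteq DD(H_{x,y,z})$ one has $\sum_{m:\,Sq(m)\in S}\prod_{e\in m}w(e)=\kappa\sum_{N\in S}\nu_{w_Q,\Gamma}(N)$. -/

import Mathlib

open scoped Classical

noncomputable section

/-! ## Dimers, double dimers and `SL₂` connections on a finite graph -/

/-- A dimer configuration (perfect matching) of `G`, as a set of edges. -/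
def IsDimerConfig {V : Type*} (G : SimpleGraph V) (m : Finset (Sym2 V)) : Prop :=
  (∀ e ∈ m, e ∈ G.edgeSet) ∧ ∀ v : V, ∃! e : Sym2 V, e ∈ m ∧ v ∈ e

/-- The finite set of all dimer configurations of a finite graph. -/
def dimerConfigs {V : Type*} [Fintype V] (G : SimpleGraph V) : Finset (Finset (Sym2 V)) :=
  Finset.univ.filter (IsDimerConfig G)

/-- The weight of a dimer configuration: the product of its edge weights. -/
def dimerWeight {V : Type*} (w : Sym2 V → ℂ) (m : Finset (Sym2 V)) : ℂ :=
  ∏ e ∈ m, w e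

/-- A double dimer configuration: a multiset of edges (`N e` is the multiplicity of `e`) such that
every vertex has total degree two. So `N e = 2` is a doubled edge, and the edges with `N e = 1` form
disjoint closed loops. -/
def IsDoubleDimerConfig {V : Type*} [Fintype V] (G : SimpleGraph V) (N : Sym2 V → ℕ) : Prop :=
  (∀ e, e ∉ G.edgeSet → N e = 0) ∧ ∀ v : V, ∑ e : Sym2 V with v ∈ e, N e = 2

/-- An `SL₂(ℂ)` connection: `Γ u v` is the matrix met when the edge `uv` is crossed from `u` to `v`;
crossing the edge backwards gives the inverse matrix. -/
structure SL2Connection {V : Type*} (G : SimpleGraph V) where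
  toFun : V → V → Matrix.SpecialLinearGroup (Fin 2) ℂ
  inv_of_adj : ∀ u v, G.Adj u v → toFun v u = (toFun u v)⁻¹

/-- The product of the connection along a walk, later steps being multiplied on the left. -/
def SL2Connection.holonomy {V : Type*} {G : SimpleGraph V} (Γ : SL2Connection G) :
    {u v : V} → G.Walk u v → Matrix.SpecialLinearGroup (Fin 2) ℂ
  | _, _, .nil => 1
  | u, _, .cons (v := v) _ p => Γ.holonomy p * Γ.toFun u v

/-- `L` is (the edge set of) a closed loop of the double dimer configuration `N`: a cycle of `G`
all of whose edges have multiplicity one. -/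
def IsClosedLoop {V : Type*} (G : SimpleGraph V) (N : Sym2 V → ℕ) (L : Finset (Sym2 V)) : Prop :=
  ∃ (v : V) (p : G.Walk v v), p.IsCycle ∧ (∀ e ∈ p.edges, N e = 1) ∧ p.edges.toFinset = L

/-- The trace of the monodromy around the cycle with edge set `L`. A base point and a direction are
chosen; the trace depends on neither, as traces of `SL₂` matrices are invariant under conjugation
and inversion. -/
def SL2Connection.loopTrace {V : Type*} {G : SimpleGraph V} (Γ : SL2Connection G)
    (L : Finset (Sym2 V)) : ℂ :=
  if h : ∃ (v : V) (p : G.Walk v v), p.IsCycle ∧ p.edges.toFinset = L then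
    (Γ.holonomy h.choose_spec.choose : Matrix (Fin 2) (Fin 2) ℂ).trace
  else 0

/-- The contribution of a double dimer configuration in the `SL₂` double dimer model: the product of
the scalar weights of its edges (with multiplicity) times the product over its closed loops of the
trace of the monodromy. -/
def doubleDimerContribution {V : Type*} [Fintype V] {G : SimpleGraph V} (w : Sym2 V → ℂ)
    (Γ : SL2Connection G) (N : Sym2 V → ℕ) : ℂ :=
  (∏ e : Sym2 V, w e ^ N e) *
    ∏ L : Finset (Sym2 V) with IsClosedLoop G N L, Γ.loopTrace L

/-- `f` maps `X` into `Y` and preserves measure: `μ (f⁻¹ S) = ν S` for every finite `S ⊆ Y`, where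
`μ` and `ν` are the (complex) measures with the given point masses. -/
def IsMeasurePreservingMap {A B : Type*} (X : Finset A) (Y : Set B) (f : A → B)
    (μ : A → ℂ) (ν : B → ℂ) : Prop :=
  (∀ m ∈ X, f m ∈ Y) ∧
    ∀ S : Finset B, (∀ N ∈ S, N ∈ Y) → ∑ m ∈ X with f m ∈ S, μ m = ∑ N ∈ S, ν N

/-! ## The honeycomb graph

Hexagons are indexed by `ℤ³` modulo `(1,1,1)`, i.e. by `(u, v) = (i - k, j - k) ∈ ℤ²`; stepping by
`(1,0)`, `(0,1)`, `(-1,-1)` moves to the lower left, lower right, and upper neighbouring hexagon.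
A vertex is a triple of hexagons that meet in a point. -/

/-- `black u v` is the lower left corner, `white u v` the lower right corner, of hexagon `(u, v)`
(the two ends of its bottom edge). -/
inductive HexVertex : Type
  | black (u v : ℤ) : HexVertex
  | white (u v : ℤ) : HexVertex

/-- The three hexagons around a vertex. -/
def HexVertex.faces : HexVertex → Finset (ℤ × ℤ)
  | .black u v => {(u, v), (u + 1, v), (u + 1, v + 1)}
  | .white u v => {(u, v), (u, v + 1), (u + 1, v + 1)}

/-- The three directions of edges: horizontal, northwest/southeast, northeast/southwest. -/
inductive EdgeDir : Type
  | horizontal : EdgeDir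
  | nwse : EdgeDir
  | nesw : EdgeDir

/-- The other end of the edge at a vertex with given direction. The edges at a black vertex go to
the east, northwest and southwest, those at a white vertex to the west, southeast and northeast. -/
def HexVertex.nbr : HexVertex → EdgeDir → HexVertex
  | .black u v, .horizontal => .white u v
  | .black u v, .nwse => .white u (v - 1)
  | .black u v, .nesw => .white (u + 1) v
  | .white u v, .horizontal => .black u v
  | .white u v, .nwse => .black u (v + 1)
  | .white u v, .nesw => .black (u - 1) v

theorem HexVertex.nbr_nbr (P : HexVertex) (d : EdgeDir) : (P.nbr d).nbr d = P := by
  cases P <;> cases d <;> simp [HexVertex.nbr]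

theorem HexVertex.nbr_ne (P : HexVertex) (d : EdgeDir) : P.nbr d ≠ P := by
  cases P <;> cases d <;> simp [HexVertex.nbr]

/-- The honeycomb graph. -/
def honeycomb : SimpleGraph HexVertex where
  Adj P Q := ∃ d : EdgeDir, Q = P.nbr d
  symm := ⟨by rintro P Q ⟨d, rfl⟩; exact ⟨d, (P.nbr_nbr d).symm⟩⟩
  loopless := ⟨by rintro P ⟨d, h⟩; exact P.nbr_ne d h.symm⟩

/-- The direction of the edge between `black u v` and a neighbour `white u' v'`. -/
def edgeDir (u v u' v' : ℤ) : EdgeDir :=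
  if u' = u ∧ v' = v then .horizontal else if u' = u ∧ v' = v - 1 then .nwse else .nesw

/-- The projection of the box `[0,x] × [0,y] × [0,z]` is the hexagon `-z ≤ u ≤ x`, `-z ≤ v ≤ y`,
`-y ≤ u - v ≤ x`; the vertices of `H_{x,y,z}` are the triangles of the triangular lattice that lie
in it. -/
def boxRegion (x y z : ℕ) : Set HexVertex :=
  {P | ∀ f ∈ P.faces, -(z : ℤ) ≤ f.1 ∧ f.1 ≤ x ∧ -(z : ℤ) ≤ f.2 ∧ f.2 ≤ y ∧
    -(y : ℤ) ≤ f.1 - f.2 ∧ f.1 - f.2 ≤ x}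

theorem boxRegion_finite (x y z : ℕ) : (boxRegion x y z).Finite := by
  have hI : (Set.Icc (-(z : ℤ)) x ×ˢ Set.Icc (-(z : ℤ)) y).Finite :=
    (Set.finite_Icc _ _).prod (Set.finite_Icc _ _)
  refine ((hI.image fun f => HexVertex.black f.1 f.2).union
    (hI.image fun f => HexVertex.white f.1 f.2)).subset ?_
  rintro (⟨u, v⟩ | ⟨u, v⟩) h
  · have h1 := h (u, v) (by simp [HexVertex.faces])
    exact Or.inl ⟨(u, v), ⟨⟨h1.1, h1.2.1⟩, ⟨h1.2.2.1, h1.2.2.2.1⟩⟩, rfl⟩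
  · have h1 := h (u, v) (by simp [HexVertex.faces])
    exact Or.inr ⟨(u, v), ⟨⟨h1.1, h1.2.1⟩, ⟨h1.2.2.1, h1.2.2.2.1⟩⟩, rfl⟩

instance boxRegionFintype (x y z : ℕ) : Fintype (boxRegion x y z) :=
  (boxRegion_finite x y z).fintype

/-- The `x × y × z` honeycomb graph `H_{x,y,z}`; `H_{1,1,1}` is a single hexagon. -/
def boxGraph (x y z : ℕ) : SimpleGraph (boxRegion x y z) :=
  honeycomb.induce (boxRegion x y z)

/-! ## The squish map -/

/-- An edge of the fine honeycomb graph that borders an even hexagon (one whose coordinates are all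
even). The other edges form the propellers. -/
def IsEvenEdge (e : Sym2 HexVertex) : Prop :=
  ∃ f : ℤ × ℤ, Even f.1 ∧ Even f.2 ∧ ∀ P ∈ e, f ∈ P.faces

/-- The vertex of the coarse honeycomb graph to which the propeller through a given vertex of the
fine honeycomb graph is contracted. Hexagon `(U, V)` of the coarse graph is the even hexagon
`(2U, 2V)` of the fine one. The propeller contracted to `black U V` has centre `white (2U+1) (2V)`
and leaves `black (2U) (2V)`, `black (2U+1) (2V)`, `black (2U+1) (2V+1)`; the one contracted to
`white U V` has centre `black (2U) (2V+1)` and leaves `white (2U) (2V)`, `white (2U) (2V+1)`,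
`white (2U+1) (2V+1)`. -/
def HexVertex.propeller : HexVertex → HexVertex
  | .black u v => if Even u ∧ Odd v then .white (u / 2) (v / 2) else .black (u / 2) (v / 2)
  | .white u v => if Odd u ∧ Even v then .black (u / 2) (v / 2) else .white (u / 2) (v / 2)

theorem HexVertex.propeller_mem {x y z : ℕ} {P : HexVertex}
    (hP : P ∈ boxRegion (2 * x) (2 * y) (2 * z)) : P.propeller ∈ boxRegion x y z := by
  rcases P with ⟨u, v⟩ | ⟨u, v⟩ <;>
  · simp only [boxRegion, HexVertex.faces, Finset.mem_insert, Finset.mem_singleton,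
      forall_eq_or_imp, forall_eq, Set.mem_ofPred_eq, Nat.cast_mul, Nat.cast_ofNat] at hP
    simp only [HexVertex.propeller]
    split_ifs with h <;> rw [Int.even_iff, Int.odd_iff] at h <;>
    · simp only [boxRegion, HexVertex.faces, Finset.mem_insert, Finset.mem_singleton,
        forall_eq_or_imp, forall_eq, Set.mem_ofPred_eq]
      omega

/-- The contraction of propellers, from the vertices of `H_{2x,2y,2z}` to those of `H_{x,y,z}`. -/
def boxPropeller {x y z : ℕ} (P : boxRegion (2 * x) (2 * y) (2 * z)) : boxRegion x y z :=
  ⟨P.1.propeller, HexVertex.propeller_mem P.2⟩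

/-- The squish map: keep the edges of a dimer configuration that border even hexagons, and send each
to its image under the contraction of the propellers; the value is the multiplicity of each edge of
`H_{x,y,z}` in the image. -/
def squish {x y z : ℕ} (m : Finset (Sym2 (boxRegion (2 * x) (2 * y) (2 * z)))) :
    Sym2 (boxRegion x y z) → ℕ := fun E =>
  (m.filter fun e => IsEvenEdge (e.map Subtype.val) ∧ e.map boxPropeller = E).card

/-! ## Edge weights

Weights on the edges are given by functions `f d u v`, the weight of the edge of direction `d` at
the vertex `black u v`. -/

/-- The weight of the edge between two vertices (the value on pairs that are not edges is
irrelevant). -/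
def pairWeight (f : EdgeDir → ℤ → ℤ → ℂˣ) : HexVertex → HexVertex → ℂ
  | .black u v, .white u' v' => f (edgeDir u v u' v') u v
  | .white u' v', .black u v => f (edgeDir u v u' v') u v
  | _, _ => 1

theorem pairWeight_comm (f : EdgeDir → ℤ → ℤ → ℂˣ) (P Q : HexVertex) :
    pairWeight f P Q = pairWeight f Q P := by
  cases P <;> cases Q <;> rfl

/-- The weight function on the edges of `H_{x,y,z}`. -/
def boxWeight {x y z : ℕ} (f : EdgeDir → ℤ → ℤ → ℂˣ) (e : Sym2 (boxRegion x y z)) : ℂ :=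
  Sym2.lift ⟨pairWeight f, pairWeight_comm f⟩ (e.map Subtype.val)

/-- The 2-periodic weights on the fine honeycomb graph. The edges not bordering an even hexagon have
weight one. A coarse edge, which separates two neighbouring coarse hexagons, comes from two fine
edges, one bordering either of the two even hexagons; going along a strip of even hexagons upwards, the weights of
the horizontal edges are
`…, k₃, k₃ t | k₃ t p, k₃ t² p | k₃ t² p², …`
where two weights between bars belong to the same coarse edge; in the same way, with `s`, `k₂` in
place of `t`, `k₃` for the northwest/southeast edges met when going to the lower left, and with `r`,
`k₁` for the northeast/southwest edges met when going to the lower right. The constants `k₁`, `k₂`,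
`k₃` may be chosen for each strip separately. Around an even hexagon the alternating product of the
weights is `p³ = q`; around the other hexagons it is `r`, `s` or `t`. -/
def periodicWeight (p r s t : ℂˣ) (k₁ k₂ k₃ : ℤ → ℂˣ) : EdgeDir → ℤ → ℤ → ℂˣ
  | .horizontal, u, v =>
    if Even u ∧ Even v then k₃ (u / 2 - v / 2) * t ^ (-(v / 2) + 1) * p ^ (-(v / 2))
    else if Odd u ∧ Odd v then k₃ (u / 2 - v / 2) * t ^ (-(v / 2)) * p ^ (-(v / 2))
    else 1
  | .nwse, u, v =>
    if Even u ∧ Even v then k₂ (v / 2) * s ^ (u / 2) * p ^ (u / 2)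
    else if Odd u ∧ Even v then k₂ (v / 2) * s ^ (u / 2 + 1) * p ^ (u / 2)
    else 1
  | .nesw, u, v =>
    if Odd u ∧ Even v then k₁ (u / 2) * r ^ (v / 2) * p ^ (v / 2)
    else if Odd u ∧ Odd v then k₁ (u / 2) * r ^ (v / 2 + 1) * p ^ (v / 2)
    else 1

/-- The scalar weights obtained from the 2-periodic weights by the squish map: the weight of a
coarse edge is the geometric mean of the weights of the two fine edges over it. Here `a`, `b`, `c`
are square roots of `r`, `s`, `t`. -/
def squishedWeight (p a b c : ℂˣ) (k₁ k₂ k₃ : ℤ → ℂˣ) : EdgeDir → ℤ → ℤ → ℂˣ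
  | .horizontal, u, v => k₃ (u - v) * c ^ (2 * (-v) + 1) * p ^ (-v)
  | .nwse, u, v => k₂ v * b ^ (2 * u + 1) * p ^ u
  | .nesw, u, v => k₁ u * a ^ (2 * v + 1) * p ^ v

/-- The monochromatic weights: the horizontal edges in a column of hexagons have weights
`…, Q⁻², Q⁻¹, 1, Q, Q², …` upwards, with the weight one at an arbitrary place (given by `o`) of each
column; the other edges have weight one. -/
def monochromaticWeight (Q : ℂˣ) (o : ℤ → ℤ) : EdgeDir → ℤ → ℤ → ℂˣ
  | .horizontal, u, v => Q ^ (-v + o (u - v))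
  | .nwse, _, _ => 1
  | .nesw, _, _ => 1

/-! ## The connection -/

/-- Transfer matrix of a left turn. -/
def turnL : Matrix (Fin 2) (Fin 2) ℂ := !![0, 1; 1, 1]

/-- Transfer matrix of a right turn. -/
def turnR : Matrix (Fin 2) (Fin 2) ℂ := !![1, 1; 1, 0]

def matJ : Matrix (Fin 2) (Fin 2) ℂ := !![1, 0; 0, -1]

def matA (a : ℂˣ) : Matrix (Fin 2) (Fin 2) ℂ := !![(a : ℂ), 0; 0, (a : ℂ)⁻¹]

def matB (b : ℂˣ) : Matrix (Fin 2) (Fin 2) ℂ := !![(b : ℂ)⁻¹, 0; 0, (b : ℂ)]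

def matC (c : ℂˣ) : Matrix (Fin 2) (Fin 2) ℂ := !![(c : ℂ), 0; 0, (c : ℂ)⁻¹]

/-- `α = i A J`. -/
def matAlpha (a : ℂˣ) : Matrix.SpecialLinearGroup (Fin 2) ℂ :=
  ⟨Complex.I • (matA a * matJ), by
    have ha : (a : ℂ) ≠ 0 := a.ne_zero
    simp [matA, matJ, Matrix.det_fin_two]
    field_simp
    simp⟩

/-- `β = i R B L J`. -/
def matBeta (b : ℂˣ) : Matrix.SpecialLinearGroup (Fin 2) ℂ :=
  ⟨Complex.I • (turnR * matB b * turnL * matJ), by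
    have hb : (b : ℂ) ≠ 0 := b.ne_zero
    simp [matB, matJ, turnL, turnR, Matrix.det_fin_two]
    field_simp
    simp⟩

/-- `γ = -i L C R J`. -/
def matGamma (c : ℂˣ) : Matrix.SpecialLinearGroup (Fin 2) ℂ :=
  ⟨(-Complex.I) • (turnL * matC c * turnR * matJ), by
    have hc : (c : ℂ) ≠ 0 := c.ne_zero
    simp [matC, matJ, turnL, turnR, Matrix.det_fin_two]
    field_simp
    simp⟩

/-- `α` on a step to the northeast, `β` on a step to the northwest, `γ` on a step to the west, and
the inverse matrices on the opposite steps. (From a black to a white vertex the steps go to the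
southwest, the northwest and the east.) -/
def stepMatrix (a b c : ℂˣ) : HexVertex → HexVertex → Matrix.SpecialLinearGroup (Fin 2) ℂ
  | .black u v, .white u' v' =>
    match edgeDir u v u' v' with
    | .horizontal => (matGamma c)⁻¹
    | .nwse => matBeta b
    | .nesw => (matAlpha a)⁻¹
  | .white u' v', .black u v =>
    match edgeDir u v u' v' with
    | .horizontal => matGamma c
    | .nwse => (matBeta b)⁻¹
    | .nesw => matAlpha a
  | _, _ => 1

theorem stepMatrix_inv (a b c : ℂˣ) (P Q : HexVertex) :
    stepMatrix a b c Q P = (stepMatrix a b c P Q)⁻¹ := by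
  rcases P with ⟨u, v⟩ | ⟨u, v⟩ <;> rcases Q with ⟨u', v'⟩ | ⟨u', v'⟩ <;>
    simp only [stepMatrix, inv_one] <;> split <;> simp

/-- The connection on `H_{x,y,z}` with `α`, `β`, `γ` on the northeast/southwest,
northwest/southeast and horizontal edges. -/
def abcConnection (x y z : ℕ) (a b c : ℂˣ) : SL2Connection (boxGraph x y z) where
  toFun P Q := stepMatrix a b c P.1 Q.1
  inv_of_adj P Q _ := stepMatrix_inv a b c P.1 Q.1

end

/-! ## Darts of the honeycomb graph and the fine vertices over a coarse vertex -/

/-! The two fine edges over a coarse edge correspond to the two darts (orientations) of that edge: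
each fine edge lies on the left of its dart (`HexDart.fineEdge`). The propeller over a coarse vertex
`v` has a centre and three leaves, one in each corner of `v`. A leaf meets only its spoke and the
two even edges that run along its corner. In a perfect matching the centre takes one leaf, so
exactly two leaves at `v` are covered by even edges, and the image has degree two at `v`.
Conversely, given `N`, a choice of even edges with image `N` extends to a perfect matching,
uniquely, as soon as no leaf is covered twice, that is, no chosen dart is followed after a left turn
by a chosen dart. So the fibre over `N` is the set `admissible` (`sum_fiber`).

This constraint is local at the vertices, so the weighted sum over a fibre factors over the doubled
edges and the loops of `N` (`stateSum_add`, `stateSum_eq_contribution`). A doubled edge uses both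
fine edges, whose weights multiply to the square of the geometric mean. Along a loop each step
chooses its left or its right fine edge; a left turn forbids left-left and a right turn forbids
right-right. The sum over these choices is the trace of a product of the matrices `turnL`, `turnR`
and diagonal weight matrices (`IsHexCycle.stateSum_eq`, `trace_orderedProd`).

A gauge transformation depending on the current dart (`dirGauge_mul`) turns these transfer matrices
into the connection with inverted parameters, up to a sign for each horizontal step and for each
right turn from a northwest/southeast to a northeast/southwest step. Horizontal steps are even in
number (`IsHexCycle.prod_horizontal`). That the special right turns are even in number
(`IsHexCycle.sum_right_turn`) is the one global point. Call a hexagon enclosed if its crossing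
number is odd. The parity of the turns is that of the number of loop vertices without horizontal
loop edge whose hexagon `base` is enclosed. In the whole box such vertices are paired by the
horizontal edges. Off the loop, the rest of `N` is a bipartite multigraph of degree two along whose
edges enclosure is constant, so it has as many enclosed black as white vertices.

Inverting `a`, `b`, `c` conjugates the connection for generic parameters, and continuity gives
equality of traces for all (`trace_holonomy_inv`). Finally, the alternating product of the squished
weights around every hexagon is `p³rst = Q`, as for the monochromatic weights. Hence the two differ
by factors attached to the vertices (`exists_gauge`), and degree two makes these contribute the same
constant to every configuration (`prod_gauge_pow`). -/

noncomputable instance : Fintype EdgeDir :=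
  ⟨{.horizontal, .nwse, .nesw}, by intro d; cases d <;> simp⟩

theorem EdgeDir.sum_eq {M : Type*} [AddCommMonoid M] (f : EdgeDir → M) :
    ∑ d, f d = f .horizontal + f .nwse + f .nesw := by
  have : (Finset.univ : Finset EdgeDir) = {.horizontal, .nwse, .nesw} := by
    ext d; cases d <;> simp
  rw [this, Finset.sum_insert (by simp), Finset.sum_insert (by simp), Finset.sum_singleton,
    add_assoc]

/-- The direction of the step obtained from a step of direction `d` by a left turn. -/
def EdgeDir.rot : EdgeDir → EdgeDir
  | .horizontal => .nesw
  | .nesw => .nwse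
  | .nwse => .horizontal

@[simp] theorem EdgeDir.rot_rot_rot (d : EdgeDir) : d.rot.rot.rot = d := by cases d <;> rfl

theorem EdgeDir.rot_ne (d : EdgeDir) : d.rot ≠ d := by cases d <;> simp [EdgeDir.rot]

theorem EdgeDir.rot_rot_ne (d : EdgeDir) : d.rot.rot ≠ d := by cases d <;> simp [EdgeDir.rot]

theorem EdgeDir.rot_injective : Function.Injective EdgeDir.rot := by
  intro d d' h
  rw [← d.rot_rot_rot, ← d'.rot_rot_rot, h]

/-- An edge of the honeycomb graph with an orientation: its source and its direction. -/
abbrev HexDart := HexVertex × EdgeDir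

namespace HexDart

def rev (δ : HexDart) : HexDart := (δ.1.nbr δ.2, δ.2)

/-- The dart following `δ` after a left turn. -/
def left (δ : HexDart) : HexDart := (δ.1.nbr δ.2, δ.2.rot)

@[simp] theorem rev_rev (δ : HexDart) : δ.rev.rev = δ := by
  simp [rev, HexVertex.nbr_nbr]

theorem rev_ne (δ : HexDart) : δ.rev ≠ δ := fun h => δ.1.nbr_ne δ.2 (congrArg Prod.fst h)

@[simp] theorem rev_fst (δ : HexDart) : δ.rev.1 = δ.1.nbr δ.2 := rfl
@[simp] theorem rev_snd (δ : HexDart) : δ.rev.2 = δ.2 := rfl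
@[simp] theorem left_fst (δ : HexDart) : δ.left.1 = δ.1.nbr δ.2 := rfl
@[simp] theorem left_snd (δ : HexDart) : δ.left.2 = δ.2.rot := rfl

/-- The dart preceding a dart before a left turn. -/
theorem left_rev (v : HexVertex) (d : EdgeDir) : left (rev (v, d)) = (v, d.rot) := by
  simp [left, rev, HexVertex.nbr_nbr]

theorem left_eq_iff (δ' : HexDart) (v : HexVertex) (d : EdgeDir) :
    left δ' = (v, d) ↔ δ' = rev (v, d.rot.rot) := by
  constructor
  · intro h
    have h1 : left δ' = left (rev (v, d.rot.rot)) := by rw [h, left_rev]; simp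
    rcases δ' with ⟨w, e⟩
    simp only [left, rev, Prod.mk.injEq] at h h1 ⊢
    obtain ⟨h1, h2⟩ := h1
    have h2 := EdgeDir.rot_injective h2
    subst h2
    refine ⟨?_, rfl⟩
    rw [← h.1, HexVertex.nbr_nbr]
  · rintro rfl
    rw [left_rev]; simp

end HexDart

namespace HexVertex

/-- The vertices of the propeller contracted to a coarse vertex: `none` is its centre, and
`some d` the leaf at the corner on the left of the dart that leaves in direction `d`. -/
def fine : HexVertex → Option EdgeDir → HexVertex
  | .black U V, none => .white (2 * U + 1) (2 * V)
  | .black U V, some .horizontal => .black (2 * U) (2 * V)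
  | .black U V, some .nwse => .black (2 * U + 1) (2 * V)
  | .black U V, some .nesw => .black (2 * U + 1) (2 * V + 1)
  | .white U V, none => .black (2 * U) (2 * V + 1)
  | .white U V, some .horizontal => .white (2 * U + 1) (2 * V + 1)
  | .white U V, some .nwse => .white (2 * U) (2 * V + 1)
  | .white U V, some .nesw => .white (2 * U) (2 * V)

@[simp] theorem propeller_fine (v : HexVertex) (o : Option EdgeDir) : (v.fine o).propeller = v := by
  rcases v with ⟨U, V⟩ | ⟨U, V⟩ <;> rcases o with _ | _ | _ | _ <;>
    simp only [fine, propeller, Int.even_iff, Int.odd_iff] <;>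
    (split_ifs <;> first | (exfalso; omega) | (congr 1 <;> omega))

theorem fine_injective {v w : HexVertex} {o o' : Option EdgeDir} (h : v.fine o = w.fine o') :
    v = w ∧ o = o' := by
  have hv : v = w := by rw [← propeller_fine v o, h, propeller_fine]
  subst hv
  refine ⟨rfl, ?_⟩
  rcases v with ⟨U, V⟩ | ⟨U, V⟩ <;> rcases o with _ | _ | _ | _ <;>
    rcases o' with _ | _ | _ | _ <;> simp [fine] at h ⊢

@[simp] theorem fine_inj {v w : HexVertex} {o o' : Option EdgeDir} :
    v.fine o = w.fine o' ↔ v = w ∧ o = o' :=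
  ⟨fine_injective, by rintro ⟨rfl, rfl⟩; rfl⟩

theorem fine_surjective (P : HexVertex) : ∃ v o, P = fine v o := by
  rcases P with ⟨u, v⟩ | ⟨u, v⟩ <;> obtain ⟨U, rfl | rfl⟩ := u.even_or_odd' <;>
    obtain ⟨V, rfl | rfl⟩ := v.even_or_odd'
  · exact ⟨.black U V, some .horizontal, rfl⟩
  · exact ⟨.white U V, none, rfl⟩
  · exact ⟨.black U V, some .nwse, rfl⟩
  · exact ⟨.black U V, some .nesw, rfl⟩
  · exact ⟨.white U V, some .nesw, rfl⟩
  · exact ⟨.white U V, some .nwse, rfl⟩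
  · exact ⟨.black U V, none, rfl⟩
  · exact ⟨.white U V, some .horizontal, rfl⟩

/-- Doubling the sides of the box produces whole propellers only: none is cut by the boundary. The
local analysis at a propeller therefore needs no boundary cases. -/
theorem fine_mem_boxRegion {x y z : ℕ} (v : HexVertex) (o : Option EdgeDir) :
    v.fine o ∈ boxRegion (2 * x) (2 * y) (2 * z) ↔ v ∈ boxRegion x y z := by
  rcases v with ⟨U, V⟩ | ⟨U, V⟩ <;> rcases o with _ | _ | _ | _ <;>
    simp only [fine, boxRegion, faces, Finset.mem_insert, Finset.mem_singleton,
        forall_eq_or_imp, forall_eq, Set.mem_ofPred_eq, Nat.cast_mul, Nat.cast_ofNat] <;>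
    omega

end HexVertex

/-! ### Even edges and spokes of the fine graph -/

namespace HexDart

/-- The leaf at the corner on the left of a dart. -/
def leaf (δ : HexDart) : HexVertex := δ.1.fine (some δ.2)

/-- The edge over a dart that borders the even hexagon on the left. -/
def fineEdge (δ : HexDart) : Sym2 HexVertex := s(δ.leaf, δ.left.leaf)

/-- The edge joining a leaf to the centre of its propeller. -/
def spoke (δ : HexDart) : Sym2 HexVertex := s(δ.1.fine none, δ.leaf)

theorem leaf_injective {δ δ' : HexDart} (h : δ.leaf = δ'.leaf) : δ = δ' := by
  simpa [leaf, Prod.ext_iff] using h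

@[simp] theorem leaf_inj {δ δ' : HexDart} : δ.leaf = δ'.leaf ↔ δ = δ' :=
  ⟨leaf_injective, by rintro rfl; rfl⟩

@[simp] theorem fine_none_ne_leaf (v : HexVertex) (δ : HexDart) : v.fine none ≠ δ.leaf := by
  simp [leaf]

@[simp] theorem leaf_ne_fine_none (v : HexVertex) (δ : HexDart) : δ.leaf ≠ v.fine none := by
  simp [leaf]

theorem left_left_ne (δ : HexDart) : δ.left.left ≠ δ := by
  intro h
  exact δ.2.rot_rot_ne (congrArg Prod.snd h)

theorem left_ne (δ : HexDart) : δ.left ≠ δ := by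
  intro h
  exact δ.2.rot_ne (congrArg Prod.snd h)

theorem fineEdge_injective : Function.Injective fineEdge := by
  intro δ δ' h
  simp only [fineEdge, Sym2.eq_iff, leaf_inj] at h
  rcases h with h | ⟨h, h'⟩
  · exact h.1
  · rw [h] at h'
    exact absurd h' (left_left_ne δ')

theorem leaf_mem_fineEdge (δ δ' : HexDart) : δ.leaf ∈ δ'.fineEdge ↔ δ' = δ ∨ δ'.left = δ := by
  simp [fineEdge, eq_comm]

theorem leaf_mem_spoke (δ δ' : HexDart) : δ.leaf ∈ δ'.spoke ↔ δ' = δ := by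
  simp [spoke, eq_comm]

theorem centre_mem_spoke (v : HexVertex) (δ : HexDart) : v.fine none ∈ δ.spoke ↔ δ.1 = v := by
  simp [spoke, eq_comm]

theorem centre_mem_fineEdge (v : HexVertex) (δ : HexDart) : v.fine none ∉ δ.fineEdge := by
  simp [fineEdge]

theorem spoke_injective : Function.Injective spoke := by
  intro δ δ' h
  exact (by simpa [spoke] using h : δ.1 = δ'.1 ∧ δ = δ').2

theorem spoke_ne_fineEdge (δ δ' : HexDart) : δ.spoke ≠ δ'.fineEdge := by
  intro h
  exact centre_mem_fineEdge δ.1 δ' (h ▸ (centre_mem_spoke δ.1 δ).2 rfl)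

theorem fineEdge_mem_edgeSet (δ : HexDart) : δ.fineEdge ∈ honeycomb.edgeSet := by
  rcases δ with ⟨⟨U, V⟩ | ⟨U, V⟩, _ | _ | _⟩
  · exact ⟨.horizontal, by simp [left, leaf, HexVertex.fine, HexVertex.nbr, EdgeDir.rot]⟩
  · exact ⟨.nwse, by simp [left, leaf, HexVertex.fine, HexVertex.nbr, EdgeDir.rot]; ring⟩
  · exact ⟨.nesw, by simp [left, leaf, HexVertex.fine, HexVertex.nbr, EdgeDir.rot]; ring⟩
  · exact ⟨.horizontal, by simp [left, leaf, HexVertex.fine, HexVertex.nbr, EdgeDir.rot]⟩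
  · exact ⟨.nwse, by simp [left, leaf, HexVertex.fine, HexVertex.nbr, EdgeDir.rot]; ring⟩
  · exact ⟨.nesw, by simp [left, leaf, HexVertex.fine, HexVertex.nbr, EdgeDir.rot]; ring⟩

theorem spoke_mem_edgeSet (δ : HexDart) : δ.spoke ∈ honeycomb.edgeSet := by
  rcases δ with ⟨⟨U, V⟩ | ⟨U, V⟩, _ | _ | _⟩
  · exact ⟨.nesw, by simp [leaf, HexVertex.fine, HexVertex.nbr]⟩
  · exact ⟨.horizontal, by simp [leaf, HexVertex.fine, HexVertex.nbr]⟩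
  · exact ⟨.nwse, by simp [leaf, HexVertex.fine, HexVertex.nbr]⟩
  · exact ⟨.nesw, by simp [leaf, HexVertex.fine, HexVertex.nbr]⟩
  · exact ⟨.horizontal, by simp [leaf, HexVertex.fine, HexVertex.nbr]⟩
  · exact ⟨.nwse, by simp [leaf, HexVertex.fine, HexVertex.nbr]⟩

/-- Every fine vertex is a centre or a leaf, so following its three directions is a finite check.
All later case distinctions on fine edges rest on this dichotomy. -/
theorem mem_edgeSet_iff (e : Sym2 HexVertex) :
    e ∈ honeycomb.edgeSet ↔ ∃ δ : HexDart, e = δ.fineEdge ∨ e = δ.spoke := by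
  constructor
  · induction e using Sym2.ind with
    | h P Q =>
    rintro ⟨d, hd⟩
    obtain rfl : Q = P.nbr d := hd
    obtain ⟨v, o, rfl⟩ := P.fine_surjective
    rcases v with ⟨U, V⟩ | ⟨U, V⟩ <;> rcases o with _ | _ | _ | _ <;> rcases d with _ | _ | _
    · exact ⟨(.black U V, .nwse), Or.inr rfl⟩
    · exact ⟨(.black U V, .nesw), Or.inr rfl⟩
    · exact ⟨(.black U V, .horizontal), Or.inr (by simp [spoke, leaf, HexVertex.fine, HexVertex.nbr])⟩
    · exact ⟨(.black U V, .horizontal), Or.inl rfl⟩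
    · exact ⟨rev (.black U V, .nwse), Or.inl (by
        rw [Sym2.eq_swap]
        simp [fineEdge, rev, left, leaf, HexVertex.fine, HexVertex.nbr, EdgeDir.rot]; ring)⟩
    · exact ⟨(.black U V, .horizontal), Or.inr (by
        rw [Sym2.eq_swap]; simp [spoke, leaf, HexVertex.fine, HexVertex.nbr])⟩
    · exact ⟨(.black U V, .nwse), Or.inr (by
        rw [Sym2.eq_swap]; simp [spoke, leaf, HexVertex.fine, HexVertex.nbr])⟩
    · exact ⟨(.black U V, .nwse), Or.inl (by
        simp [fineEdge, left, leaf, HexVertex.fine, HexVertex.nbr, EdgeDir.rot]; ring)⟩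
    · exact ⟨rev (.black U V, .nesw), Or.inl (by
        rw [Sym2.eq_swap]
        simp [fineEdge, rev, left, leaf, HexVertex.fine, HexVertex.nbr, EdgeDir.rot]; ring)⟩
    · exact ⟨rev (.black U V, .horizontal), Or.inl (by
        rw [Sym2.eq_swap]
        simp [fineEdge, rev, left, leaf, HexVertex.fine, HexVertex.nbr, EdgeDir.rot])⟩
    · exact ⟨(.black U V, .nesw), Or.inr (by
        rw [Sym2.eq_swap]; simp [spoke, leaf, HexVertex.fine, HexVertex.nbr])⟩
    · exact ⟨(.black U V, .nesw), Or.inl (by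
        simp [fineEdge, left, leaf, HexVertex.fine, HexVertex.nbr, EdgeDir.rot]; ring)⟩
    · exact ⟨(.white U V, .nwse), Or.inr rfl⟩
    · exact ⟨(.white U V, .nesw), Or.inr (by simp [spoke, leaf, HexVertex.fine, HexVertex.nbr])⟩
    · exact ⟨(.white U V, .horizontal), Or.inr rfl⟩
    · exact ⟨(.white U V, .horizontal), Or.inl rfl⟩
    · exact ⟨rev (.white U V, .nwse), Or.inl (by
        rw [Sym2.eq_swap]
        simp [fineEdge, rev, left, leaf, HexVertex.fine, HexVertex.nbr, EdgeDir.rot]; ring)⟩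
    · exact ⟨(.white U V, .horizontal), Or.inr (by
        rw [Sym2.eq_swap]; simp [spoke, leaf, HexVertex.fine, HexVertex.nbr])⟩
    · exact ⟨(.white U V, .nwse), Or.inr (by
        rw [Sym2.eq_swap]; simp [spoke, leaf, HexVertex.fine, HexVertex.nbr])⟩
    · exact ⟨(.white U V, .nwse), Or.inl (by
        simp [fineEdge, left, leaf, HexVertex.fine, HexVertex.nbr, EdgeDir.rot]; ring)⟩
    · exact ⟨rev (.white U V, .nesw), Or.inl (by
        rw [Sym2.eq_swap]
        simp [fineEdge, rev, left, leaf, HexVertex.fine, HexVertex.nbr, EdgeDir.rot]; ring)⟩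
    · exact ⟨rev (.white U V, .horizontal), Or.inl (by
        rw [Sym2.eq_swap]
        simp [fineEdge, rev, left, leaf, HexVertex.fine, HexVertex.nbr, EdgeDir.rot])⟩
    · exact ⟨(.white U V, .nesw), Or.inr (by
        rw [Sym2.eq_swap]; simp [spoke, leaf, HexVertex.fine, HexVertex.nbr])⟩
    · exact ⟨(.white U V, .nesw), Or.inl (by
        simp [fineEdge, left, leaf, HexVertex.fine, HexVertex.nbr, EdgeDir.rot]; ring)⟩
  · rintro ⟨δ, rfl | rfl⟩
    · exact fineEdge_mem_edgeSet δ
    · exact spoke_mem_edgeSet δ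

theorem isEvenEdge_fineEdge (δ : HexDart) : IsEvenEdge δ.fineEdge := by
  rcases δ with ⟨⟨U, V⟩ | ⟨U, V⟩, _ | _ | _⟩
  · exact ⟨(2 * U, 2 * V), by simp, by simp, by
      simp [fineEdge, left, leaf, HexVertex.fine, HexVertex.nbr, EdgeDir.rot, HexVertex.faces]⟩
  · exact ⟨(2 * U + 2, 2 * V), by simp [parity_simps], by simp [parity_simps], by
      simp [fineEdge, left, leaf, HexVertex.fine, HexVertex.nbr, EdgeDir.rot, HexVertex.faces]; omega⟩
  · exact ⟨(2 * U + 2, 2 * V + 2), by simp [parity_simps], by simp [parity_simps], by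
      simp [fineEdge, left, leaf, HexVertex.fine, HexVertex.nbr, EdgeDir.rot, HexVertex.faces]; omega⟩
  · exact ⟨(2 * U + 2, 2 * V + 2), by simp [parity_simps], by simp [parity_simps], by
      simp [fineEdge, left, leaf, HexVertex.fine, HexVertex.nbr, EdgeDir.rot, HexVertex.faces]; omega⟩
  · exact ⟨(2 * U, 2 * V + 2), by simp [parity_simps], by simp [parity_simps], by
      simp [fineEdge, left, leaf, HexVertex.fine, HexVertex.nbr, EdgeDir.rot, HexVertex.faces]; omega⟩
  · exact ⟨(2 * U, 2 * V), by simp, by simp, by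
      simp [fineEdge, left, leaf, HexVertex.fine, HexVertex.nbr, EdgeDir.rot, HexVertex.faces]; omega⟩

theorem not_isEvenEdge_spoke (δ : HexDart) : ¬ IsEvenEdge δ.spoke := by
  rintro ⟨⟨f, g⟩, h1, h2, h⟩
  rw [Int.even_iff] at h1 h2
  have h3 := h _ ((centre_mem_spoke δ.1 δ).2 rfl)
  have h4 := h _ ((leaf_mem_spoke δ δ).2 rfl)
  rcases δ with ⟨⟨U, V⟩ | ⟨U, V⟩, _ | _ | _⟩ <;>
    simp [leaf, HexVertex.fine, HexVertex.faces] at h1 h2 h3 h4 <;> omega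

theorem map_propeller_fineEdge (δ : HexDart) :
    δ.fineEdge.map HexVertex.propeller = s(δ.1, δ.1.nbr δ.2) := by
  simp [fineEdge, leaf]

end HexDart

/-! ## Dimer configurations over a double dimer configuration -/

namespace HexDart

/-- The dart preceding `δ` before a left turn. -/
def pred (δ : HexDart) : HexDart := rev (δ.1, δ.2.rot.rot)

@[simp] theorem left_pred (δ : HexDart) : δ.pred.left = δ := by
  rw [pred, left_rev]; simp

theorem left_eq_iff_eq_pred (δ' δ : HexDart) : δ'.left = δ ↔ δ' = δ.pred :=
  left_eq_iff δ' δ.1 δ.2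

@[simp] theorem pred_left (δ : HexDart) : δ.left.pred = δ :=
  ((left_eq_iff_eq_pred δ δ.left).1 rfl).symm

theorem pred_ne (δ : HexDart) : δ.pred ≠ δ := by
  intro h
  exact left_ne δ ((left_eq_iff_eq_pred δ δ).2 h.symm)

end HexDart

/-! ### Passage between boxes and the infinite lattice -/

/-- The embedding of edges of a box into the edges of the honeycomb graph. -/
def boxEdgeEmb (x y z : ℕ) : Sym2 (boxRegion x y z) ↪ Sym2 HexVertex :=
  ⟨Sym2.map Subtype.val, Sym2.map.injective Subtype.val_injective⟩

/-- Perfect matchings of the part of the honeycomb graph induced on a region. -/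
def HexMatching (R : Set HexVertex) (M : Finset (Sym2 HexVertex)) : Prop :=
  (∀ e ∈ M, e ∈ honeycomb.edgeSet ∧ ∀ v ∈ e, v ∈ R) ∧ ∀ v ∈ R, ∃! e, e ∈ M ∧ v ∈ e

theorem map_val_mem_edgeSet {x y z : ℕ} (e : Sym2 (boxRegion x y z)) :
    e.map Subtype.val ∈ honeycomb.edgeSet ↔ e ∈ (boxGraph x y z).edgeSet := by
  induction e using Sym2.ind with
  | h P Q => simp [boxGraph]

theorem val_mem_map_val {x y z : ℕ} (e : Sym2 (boxRegion x y z)) (v : boxRegion x y z) :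
    v.1 ∈ e.map Subtype.val ↔ v ∈ e := by
  rw [Sym2.mem_map]
  exact ⟨by rintro ⟨w, hw, h⟩; rwa [← Subtype.ext h], fun h => ⟨v, h, rfl⟩⟩

/-- Moves matchings to the infinite lattice, where edges can be handled without membership proofs
attached to their ends. -/
theorem isDimerConfig_iff {x y z : ℕ} (m : Finset (Sym2 (boxRegion x y z))) :
    IsDimerConfig (boxGraph x y z) m ↔
      HexMatching (boxRegion x y z) (m.map (boxEdgeEmb x y z)) := by
  constructor
  · rintro ⟨h1, h2⟩
    refine ⟨?_, ?_⟩
    · intro e he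
      obtain ⟨e, hem, rfl⟩ := Finset.mem_map.1 he
      refine ⟨(map_val_mem_edgeSet e).2 (h1 e hem), ?_⟩
      intro v hv
      obtain ⟨w, -, rfl⟩ := Sym2.mem_map.1 hv
      exact w.2
    · intro v hv
      obtain ⟨e, ⟨he, hve⟩, hu⟩ := h2 ⟨v, hv⟩
      refine ⟨e.map Subtype.val, ⟨Finset.mem_map.2 ⟨e, he, rfl⟩,
        (val_mem_map_val e ⟨v, hv⟩).2 hve⟩, ?_⟩
      rintro e' ⟨he', hve'⟩
      obtain ⟨e', hem', rfl⟩ := Finset.mem_map.1 he'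
      rw [hu e' ⟨hem', (val_mem_map_val e' ⟨v, hv⟩).1 hve'⟩]
      rfl
  · rintro ⟨h1, h2⟩
    refine ⟨fun e he => (map_val_mem_edgeSet e).1 (h1 _ (Finset.mem_map.2 ⟨e, he, rfl⟩)).1, ?_⟩
    intro v
    obtain ⟨e, ⟨he, hve⟩, hu⟩ := h2 v.1 v.2
    obtain ⟨e, hem, rfl⟩ := Finset.mem_map.1 he
    refine ⟨e, ⟨hem, (val_mem_map_val e v).1 hve⟩, ?_⟩
    rintro e' ⟨he', hve'⟩
    exact (boxEdgeEmb x y z).injective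
      (hu _ ⟨Finset.mem_map.2 ⟨e', he', rfl⟩, (val_mem_map_val e' v).2 hve'⟩)

theorem HexMatching.exists_map_eq {x y z : ℕ} {M : Finset (Sym2 HexVertex)}
    (hM : HexMatching (boxRegion x y z) M) : ∃ m : Finset (Sym2 (boxRegion x y z)), m.map (boxEdgeEmb x y z) = M := by
  refine ⟨Finset.univ.filter fun e => e.map Subtype.val ∈ M, ?_⟩
  ext e
  simp only [Finset.mem_map, Finset.mem_filter, Finset.mem_univ, true_and]
  constructor
  · rintro ⟨e, he, rfl⟩
    exact he
  · intro he
    have h := (hM.1 e he).2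
    induction e using Sym2.ind with
    | h P Q =>
      exact ⟨s(⟨P, h P (by simp)⟩, ⟨Q, h Q (by simp)⟩), by simpa using he, rfl⟩

theorem finite_boxDarts (x y z : ℕ) :
    {δ : HexDart | δ.1 ∈ boxRegion x y z}.Finite :=
  ((boxRegion_finite x y z).prod (Set.finite_univ (α := EdgeDir))).subset fun _ h => ⟨h, trivial⟩

/-- The darts of `H_{x,y,z}`. -/
noncomputable def boxDarts (x y z : ℕ) : Finset HexDart :=
  (finite_boxDarts x y z).toFinset.filter fun δ => δ.1.nbr δ.2 ∈ boxRegion x y z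

theorem mem_boxDarts {x y z : ℕ} {δ : HexDart} :
    δ ∈ boxDarts x y z ↔ δ.1 ∈ boxRegion x y z ∧ δ.1.nbr δ.2 ∈ boxRegion x y z := by
  simp [boxDarts]

theorem rev_mem_boxDarts {x y z : ℕ} {δ : HexDart} :
    δ.rev ∈ boxDarts x y z ↔ δ ∈ boxDarts x y z := by
  simp [mem_boxDarts, HexVertex.nbr_nbr, and_comm]

/-- The indicator function of a proposition, with values in `ℕ`. -/
noncomputable def ind (P : Prop) : ℕ := if P then 1 else 0

@[simp] theorem ind_of {P : Prop} (h : P) : ind P = 1 := if_pos h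
@[simp] theorem ind_of_not {P : Prop} (h : ¬ P) : ind P = 0 := if_neg h

theorem ind_le (P : Prop) : ind P ≤ 1 := by by_cases h : P <;> simp [h]

theorem ind_eq_one {P : Prop} : ind P = 1 ↔ P := by by_cases h : P <;> simp [h]

theorem ind_eq_zero {P : Prop} : ind P = 0 ↔ ¬ P := by by_cases h : P <;> simp [h]

/-- The multiplicity of the edge under a dart in a double dimer configuration. -/
noncomputable def dartMult {x y z : ℕ} (N : Sym2 (boxRegion x y z) → ℕ) (δ : HexDart) : ℕ :=
  if h : δ.1 ∈ boxRegion x y z ∧ δ.1.nbr δ.2 ∈ boxRegion x y z then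
    N s(⟨δ.1, h.1⟩, ⟨δ.1.nbr δ.2, h.2⟩) else 0

/-- Sets of darts in a finite set `D` such that there are `N δ` of them over the edge under `δ`,
and none of them is followed by another one after a left turn. These are the sets of even edges of
dimer configurations, each even edge being given by the dart that has it on its left. -/
noncomputable def admissible (D : Finset HexDart) (N : HexDart → ℕ) : Finset (Finset HexDart) :=
  D.powerset.filter fun S => (∀ δ ∈ D, ind (δ ∈ S) + ind (δ.rev ∈ S) = N δ) ∧
    ∀ δ ∈ S, δ.left ∉ S

theorem mem_admissible {D : Finset HexDart} {N : HexDart → ℕ} {S : Finset HexDart} :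
    S ∈ admissible D N ↔ S ⊆ D ∧ (∀ δ ∈ D, ind (δ ∈ S) + ind (δ.rev ∈ S) = N δ) ∧
      ∀ δ ∈ S, δ.left ∉ S := by
  simp [admissible]

/-- The darts that have an edge of `M` on their left. -/
noncomputable def fineDarts (x y z : ℕ) (M : Finset (Sym2 HexVertex)) : Finset HexDart :=
  (boxDarts x y z).filter fun δ => δ.fineEdge ∈ M

/-- The spokes and even edges of the dimer configuration given by a set of darts. -/
noncomputable def fineMatching (x y z : ℕ) (S : Finset HexDart) : Finset (Sym2 HexVertex) :=
  S.image HexDart.fineEdge ∪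
    ((finite_boxDarts x y z).toFinset.filter fun δ => δ ∉ S ∧ δ.pred ∉ S).image HexDart.spoke

theorem fineEdge_mem_fineMatching {x y z : ℕ} {S : Finset HexDart} {δ : HexDart} :
    δ.fineEdge ∈ fineMatching x y z S ↔ δ ∈ S := by
  simp only [fineMatching, Finset.mem_union, Finset.mem_image]
  constructor
  · rintro (⟨δ', h, h'⟩ | ⟨δ', h, h'⟩)
    · exact HexDart.fineEdge_injective h' ▸ h
    · exact absurd h' (HexDart.spoke_ne_fineEdge _ _)
  · exact fun h => Or.inl ⟨δ, h, rfl⟩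

theorem spoke_mem_fineMatching {x y z : ℕ} {S : Finset HexDart} {δ : HexDart} :
    δ.spoke ∈ fineMatching x y z S ↔ δ.1 ∈ boxRegion x y z ∧ δ ∉ S ∧ δ.pred ∉ S := by
  simp only [fineMatching, Finset.mem_union, Finset.mem_image]
  constructor
  · rintro (⟨δ', h, h'⟩ | ⟨δ', h, h'⟩)
    · exact absurd h'.symm (HexDart.spoke_ne_fineEdge _ _)
    · rw [HexDart.spoke_injective h'] at h
      simpa using h
  · exact fun h => Or.inr ⟨δ, by simpa using h, rfl⟩

theorem fineEdge_subset_iff {x y z : ℕ} (δ : HexDart) :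
    (∀ v ∈ δ.fineEdge, v ∈ boxRegion (2 * x) (2 * y) (2 * z)) ↔ δ ∈ boxDarts x y z := by
  simp [HexDart.fineEdge, HexDart.leaf, HexVertex.fine_mem_boxRegion, mem_boxDarts]

theorem spoke_subset_iff {x y z : ℕ} (δ : HexDart) :
    (∀ v ∈ δ.spoke, v ∈ boxRegion (2 * x) (2 * y) (2 * z)) ↔ δ.1 ∈ boxRegion x y z := by
  simp [HexDart.spoke, HexDart.leaf, HexVertex.fine_mem_boxRegion]

/-! ### Perfect matchings of the fine graph and their sets of darts -/

section Matching

variable {x y z : ℕ} {M : Finset (Sym2 HexVertex)}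

theorem mem_fineDarts (hM : HexMatching (boxRegion (2 * x) (2 * y) (2 * z)) M) {δ : HexDart} :
    δ ∈ fineDarts x y z M ↔ δ.fineEdge ∈ M := by
  simp only [fineDarts, Finset.mem_filter, and_iff_right_iff_imp]
  exact fun h => (fineEdge_subset_iff δ).1 (hM.1 _ h).2

/-- The centre of a propeller meets spokes only, so the edge that covers it is a spoke. -/
theorem existsUnique_spoke (hM : HexMatching (boxRegion (2 * x) (2 * y) (2 * z)) M)
    {v : HexVertex} (hv : v ∈ boxRegion x y z) : ∃! d, HexDart.spoke (v, d) ∈ M := by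
  obtain ⟨e, ⟨he, hve⟩, hu⟩ := hM.2 (v.fine none) ((HexVertex.fine_mem_boxRegion v none).2 hv)
  obtain ⟨⟨w, d⟩, rfl | rfl⟩ := (HexDart.mem_edgeSet_iff e).1 (hM.1 e he).1
  · exact absurd hve (HexDart.centre_mem_fineEdge _ _)
  · obtain rfl : w = v := (HexDart.centre_mem_spoke _ _).1 hve
    refine ⟨d, he, fun d' hd' => ?_⟩
    have := hu _ ⟨hd', (HexDart.centre_mem_spoke w (w, d')).2 rfl⟩
    exact congrArg Prod.snd (HexDart.spoke_injective this)

/-- The leaf of `δ` meets three edges: its spoke, the even edge on the left of `δ`, and the one on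
the left of `δ.pred`. Exactly one of them covers it. -/
theorem ind_spoke_add (hM : HexMatching (boxRegion (2 * x) (2 * y) (2 * z)) M)
    {δ : HexDart} (hv : δ.1 ∈ boxRegion x y z) :
    ind (δ.spoke ∈ M) + (ind (δ ∈ fineDarts x y z M) + ind (δ.pred ∈ fineDarts x y z M)) = 1 := by
  rw [mem_fineDarts hM, mem_fineDarts hM]
  obtain ⟨e, ⟨he, hve⟩, hu⟩ := hM.2 δ.leaf ((HexVertex.fine_mem_boxRegion δ.1 _).2 hv)
  have h1 : δ.spoke ∈ M → e = δ.spoke := fun h =>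
    (hu _ ⟨h, (HexDart.leaf_mem_spoke _ _).2 rfl⟩).symm
  have h2 : δ.fineEdge ∈ M → e = δ.fineEdge := fun h =>
    (hu _ ⟨h, (HexDart.leaf_mem_fineEdge _ _).2 (Or.inl rfl)⟩).symm
  have h3 : δ.pred.fineEdge ∈ M → e = δ.pred.fineEdge := fun h =>
    (hu _ ⟨h, (HexDart.leaf_mem_fineEdge _ _).2 (Or.inr δ.left_pred)⟩).symm
  have h12 : δ.spoke ≠ δ.fineEdge := HexDart.spoke_ne_fineEdge _ _
  have h13 : δ.spoke ≠ δ.pred.fineEdge := HexDart.spoke_ne_fineEdge _ _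
  have h23 : δ.fineEdge ≠ δ.pred.fineEdge := fun h =>
    δ.pred_ne (HexDart.fineEdge_injective h).symm
  obtain ⟨δ', rfl | rfl⟩ := (HexDart.mem_edgeSet_iff e).1 (hM.1 e he).1
  · rcases (HexDart.leaf_mem_fineEdge _ _).1 hve with rfl | h
    · have a1 : δ'.spoke ∉ M := fun h => h12 (h1 h).symm
      have a3 : δ'.pred.fineEdge ∉ M := fun h => h23 (h3 h)
      simp [a1, a3, he]
    · rw [HexDart.left_eq_iff_eq_pred] at h
      subst h
      have a1 : δ.spoke ∉ M := fun h => h13 (h1 h).symm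
      have a3 : δ.fineEdge ∉ M := fun h => h23 (h2 h).symm
      simp [a1, a3, he]
  · obtain rfl := (HexDart.leaf_mem_spoke _ _).1 hve
    have a1 : δ'.fineEdge ∉ M := fun h => h12 (h2 h)
    have a3 : δ'.pred.fineEdge ∉ M := fun h => h13 (h3 h)
    simp [a1, a3, he]

theorem fineDarts_left_notMem (hM : HexMatching (boxRegion (2 * x) (2 * y) (2 * z)) M)
    {δ : HexDart} (hδ : δ ∈ fineDarts x y z M) : δ.left ∉ fineDarts x y z M := by
  intro h
  have hv : δ.left.1 ∈ boxRegion x y z := (mem_boxDarts.1 (Finset.mem_filter.1 h).1).1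
  have := ind_spoke_add hM hv
  rw [HexDart.pred_left, ind_of h, ind_of hδ] at this
  omega

/-- Three leaves, one of them taken by the centre, leave two for the even edges. The darts `pred (v,
d)` are the reverses of the darts at `v` in another order, so the sum over leaves is the sum over
edges. -/
theorem sum_ind_fineDarts (hM : HexMatching (boxRegion (2 * x) (2 * y) (2 * z)) M)
    {v : HexVertex} (hv : v ∈ boxRegion x y z) :
    ∑ d, (ind ((v, d) ∈ fineDarts x y z M) +
      ind (HexDart.rev (v, d) ∈ fineDarts x y z M)) = 2 := by
  have h1 := ind_spoke_add hM (δ := (v, .horizontal)) hv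
  have h2 := ind_spoke_add hM (δ := (v, .nwse)) hv
  have h3 := ind_spoke_add hM (δ := (v, .nesw)) hv
  simp only [HexDart.pred, EdgeDir.rot] at h1 h2 h3
  have h4 : ∑ d, ind (HexDart.spoke (v, d) ∈ M) = 1 := by
    obtain ⟨d, hd, hu⟩ := existsUnique_spoke hM hv
    rw [Finset.sum_eq_single d, ind_of hd]
    · intro d' _ h
      exact ind_of_not fun h' => h (hu d' h')
    · simp
  rw [EdgeDir.sum_eq] at h4 ⊢
  omega

theorem fineMatching_fineDarts (hM : HexMatching (boxRegion (2 * x) (2 * y) (2 * z)) M) :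
    fineMatching x y z (fineDarts x y z M) = M := by
  ext e
  by_cases he : e ∈ honeycomb.edgeSet
  · obtain ⟨δ, rfl | rfl⟩ := (HexDart.mem_edgeSet_iff e).1 he
    · rw [fineEdge_mem_fineMatching, mem_fineDarts hM]
    · rw [spoke_mem_fineMatching]
      constructor
      · rintro ⟨hv, h1, h2⟩
        have := ind_spoke_add hM hv
        rw [ind_of_not h1, ind_of_not h2] at this
        exact ind_eq_one.1 this
      · intro h
        have hv := (spoke_subset_iff δ).1 (hM.1 _ h).2
        have := ind_spoke_add hM hv
        rw [ind_of h] at this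
        exact ⟨hv, ind_eq_zero.1 (by omega), ind_eq_zero.1 (by omega)⟩
  · refine iff_of_false ?_ fun h => he (hM.1 e h).1
    simp only [fineMatching, Finset.mem_union, Finset.mem_image, not_or, not_exists, not_and]
    exact ⟨fun δ _ h => he (h ▸ δ.fineEdge_mem_edgeSet),
      fun δ _ h => he (h ▸ δ.spoke_mem_edgeSet)⟩

theorem fineDarts_fineMatching {S : Finset HexDart} (hS : S ⊆ boxDarts x y z) :
    fineDarts x y z (fineMatching x y z S) = S := by
  ext δ
  simp only [fineDarts, Finset.mem_filter, fineEdge_mem_fineMatching]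
  exact ⟨fun h => h.2, fun h => ⟨hS h, h⟩⟩

/-- The left-turn condition says that no leaf is covered twice, and degree two then leaves exactly
one leaf at each vertex for the centre. The spokes in `fineMatching` are these. -/
theorem hexMatching_fineMatching {N : HexDart → ℕ} {S : Finset HexDart}
    (hS : S ∈ admissible (boxDarts x y z) N) (h0 : ∀ δ ∉ boxDarts x y z, N δ = 0)
    (hN : ∀ v ∈ boxRegion x y z, ∑ d, N (v, d) = 2) :
    HexMatching (boxRegion (2 * x) (2 * y) (2 * z)) (fineMatching x y z S) := by
  obtain ⟨hSD, hSN, hSl⟩ := mem_admissible.1 hS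
  have hSN' : ∀ δ, ind (δ ∈ S) + ind (δ.rev ∈ S) = N δ := by
    intro δ
    by_cases hδ : δ ∈ boxDarts x y z
    · exact hSN δ hδ
    · rw [h0 δ hδ, ind_of_not fun h => hδ (hSD h),
        ind_of_not fun h => hδ (rev_mem_boxDarts.1 (hSD h))]
  have hpair : ∀ δ : HexDart, ind (δ ∈ S) + ind (δ.pred ∈ S) ≤ 1 := by
    intro δ
    by_cases h : δ.pred ∈ S
    · have := hSl _ h
      rw [HexDart.left_pred] at this
      simp [h, this]
    · have := ind_le (δ ∈ S)
      simp [h, this]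
  refine ⟨?_, ?_⟩
  · intro e he
    simp only [fineMatching, Finset.mem_union, Finset.mem_image, Finset.mem_filter,
      Set.Finite.mem_toFinset, Set.mem_ofPred_eq] at he
    rcases he with ⟨δ, h, rfl⟩ | ⟨δ, h, rfl⟩
    · exact ⟨δ.fineEdge_mem_edgeSet, (fineEdge_subset_iff δ).2 (hSD h)⟩
    · exact ⟨δ.spoke_mem_edgeSet, (spoke_subset_iff δ).2 h.1⟩
  · intro P hP
    obtain ⟨v, o, rfl⟩ := P.fine_surjective
    rw [HexVertex.fine_mem_boxRegion] at hP
    have key : ∀ e ∈ fineMatching x y z S, ∃ δ : HexDart, (e = δ.fineEdge ∧ δ ∈ S) ∨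
        (e = δ.spoke ∧ δ ∉ S ∧ δ.pred ∉ S) := by
      intro e he
      simp only [fineMatching, Finset.mem_union, Finset.mem_image, Finset.mem_filter] at he
      rcases he with ⟨δ, h, rfl⟩ | ⟨δ, h, rfl⟩
      · exact ⟨δ, Or.inl ⟨rfl, h⟩⟩
      · exact ⟨δ, Or.inr ⟨rfl, h.2⟩⟩
    rcases o with _ | d
    · have hex : ∃! d, (v, d) ∉ S ∧ HexDart.pred (v, d) ∉ S := by
        have h1 := hpair (v, .horizontal)
        have h2 := hpair (v, .nwse)
        have h3 := hpair (v, .nesw)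
        have h4 : ∑ d, (ind ((v, d) ∈ S) + ind (HexDart.pred (v, d) ∈ S)) = 2 := by
          -- As `d` varies, `pred (v, d)` runs over the three darts ending at `v`, so the sum is the
          -- degree of `v`.
          rw [← hN v hP, EdgeDir.sum_eq, EdgeDir.sum_eq, ← hSN', ← hSN', ← hSN']
          simp only [HexDart.pred, EdgeDir.rot]
          omega
        have hiff : ∀ d, ((v, d) ∉ S ∧ HexDart.pred (v, d) ∉ S) ↔
            ind ((v, d) ∈ S) + ind (HexDart.pred (v, d) ∈ S) = 0 := by
          intro d
          rw [Nat.add_eq_zero_iff, ind_eq_zero, ind_eq_zero]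
        simp only [hiff]
        rw [EdgeDir.sum_eq] at h4
        generalize hf : (fun d => ind ((v, d) ∈ S) + ind (HexDart.pred (v, d) ∈ S)) = f at h1 h2 h3 h4
        have hf' : ∀ d, ind ((v, d) ∈ S) + ind (HexDart.pred (v, d) ∈ S) = f d := fun d => by
          rw [← hf]
        simp only [hf'] at h1 h2 h3 h4 ⊢
        -- Three numbers that are at most one and sum to two: exactly one leaf is free.
        have : f .horizontal = 0 ∧ f .nwse = 1 ∧ f .nesw = 1 ∨
            f .horizontal = 1 ∧ f .nwse = 0 ∧ f .nesw = 1 ∨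
            f .horizontal = 1 ∧ f .nwse = 1 ∧ f .nesw = 0 := by omega
        rcases this with h | h | h
        · exact ⟨.horizontal, h.1, by rintro (_ | _ | _) h' <;> simp_all⟩
        · exact ⟨.nwse, h.2.1, by rintro (_ | _ | _) h' <;> simp_all⟩
        · exact ⟨.nesw, h.2.2, by rintro (_ | _ | _) h' <;> simp_all⟩
      obtain ⟨d, hd, hu⟩ := hex
      refine ⟨HexDart.spoke (v, d), ⟨spoke_mem_fineMatching.2 ⟨hP, hd⟩,
        (HexDart.centre_mem_spoke _ _).2 rfl⟩, ?_⟩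
      rintro e ⟨he, hve⟩
      obtain ⟨⟨w, d'⟩, ⟨rfl, -⟩ | ⟨rfl, h⟩⟩ := key e he
      · exact absurd hve (HexDart.centre_mem_fineEdge _ _)
      · obtain rfl : w = v := (HexDart.centre_mem_spoke _ _).1 hve
        rw [hu d' h]
    · change ∃! e, e ∈ fineMatching x y z S ∧ HexDart.leaf (v, d) ∈ e
      obtain ⟨δ, hδ⟩ : ∃ δ : HexDart, (v, d) = δ := ⟨_, rfl⟩
      rw [hδ]
      have hv : δ.1 ∈ boxRegion x y z := hδ ▸ hP
      have hp := hpair δ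
      by_cases h1 : δ ∈ S
      · have h2 : δ.pred ∉ S := by
          rw [ind_of h1] at hp
          exact ind_eq_zero.1 (by omega)
        refine ⟨δ.fineEdge, ⟨fineEdge_mem_fineMatching.2 h1,
          (HexDart.leaf_mem_fineEdge _ _).2 (Or.inl rfl)⟩, ?_⟩
        rintro e ⟨he, hve⟩
        obtain ⟨δ', ⟨rfl, h⟩ | ⟨rfl, h⟩⟩ := key e he
        · rcases (HexDart.leaf_mem_fineEdge _ _).1 hve with rfl | h'
          · rfl
          · rw [HexDart.left_eq_iff_eq_pred] at h'
            exact absurd (h' ▸ h) h2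
        · rw [(HexDart.leaf_mem_spoke _ _).1 hve] at h
          exact absurd h1 h.1
      · by_cases h2 : δ.pred ∈ S
        · refine ⟨δ.pred.fineEdge, ⟨fineEdge_mem_fineMatching.2 h2,
            (HexDart.leaf_mem_fineEdge _ _).2 (Or.inr δ.left_pred)⟩, ?_⟩
          rintro e ⟨he, hve⟩
          obtain ⟨δ', ⟨rfl, h⟩ | ⟨rfl, h⟩⟩ := key e he
          · rcases (HexDart.leaf_mem_fineEdge _ _).1 hve with rfl | h'
            · exact absurd h h1
            · rw [HexDart.left_eq_iff_eq_pred] at h'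
              rw [h']
          · rw [(HexDart.leaf_mem_spoke _ _).1 hve] at h
            exact absurd h2 h.2
        · refine ⟨δ.spoke, ⟨spoke_mem_fineMatching.2 ⟨hv, h1, h2⟩,
            (HexDart.leaf_mem_spoke _ _).2 rfl⟩, ?_⟩
          rintro e ⟨he, hve⟩
          obtain ⟨δ', ⟨rfl, h⟩ | ⟨rfl, h⟩⟩ := key e he
          · rcases (HexDart.leaf_mem_fineEdge _ _).1 hve with rfl | h'
            · exact absurd h h1
            · rw [HexDart.left_eq_iff_eq_pred] at h'
              exact absurd (h' ▸ h) h2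
          · rw [(HexDart.leaf_mem_spoke _ _).1 hve]

end Matching

/-! ## The fibres of the squish map -/

theorem HexVertex.nbr_injective (v : HexVertex) : Function.Injective v.nbr := by
  intro d d' h
  rcases v with ⟨u, v⟩ | ⟨u, v⟩ <;> cases d <;> cases d' <;>
    simp [HexVertex.nbr] at h ⊢ <;> omega

namespace HexDart

/-- The edge under a dart. -/
def edge (δ : HexDart) : Sym2 HexVertex := s(δ.1, δ.1.nbr δ.2)

theorem edge_eq_iff (δ δ' : HexDart) : δ'.edge = δ.edge ↔ δ' = δ ∨ δ' = δ.rev := by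
  rcases δ with ⟨v, d⟩
  rcases δ' with ⟨w, d'⟩
  simp only [edge, Sym2.eq_iff, Prod.mk.injEq, rev]
  constructor
  · rintro (⟨rfl, h⟩ | ⟨rfl, h⟩)
    · exact Or.inl ⟨rfl, w.nbr_injective h⟩
    · exact Or.inr ⟨rfl, (v.nbr d).nbr_injective (h.trans (v.nbr_nbr d).symm)⟩
  · rintro (⟨rfl, rfl⟩ | ⟨rfl, rfl⟩)
    · exact Or.inl ⟨rfl, rfl⟩
    · exact Or.inr ⟨rfl, v.nbr_nbr _⟩

@[simp] theorem edge_rev (δ : HexDart) : δ.rev.edge = δ.edge := (edge_eq_iff _ _).2 (Or.inr rfl)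

end HexDart

/-- The weight of an edge of the honeycomb graph. -/
noncomputable def hexWeight (f : EdgeDir → ℤ → ℤ → ℂˣ) (e : Sym2 HexVertex) : ℂ :=
  Sym2.lift ⟨pairWeight f, pairWeight_comm f⟩ e

/-- Frees the definition from the particular finiteness and decidability instances chosen in it;
`doubleDimerContribution_eq` does the same for the contribution. -/
theorem isDoubleDimerConfig_iff {V : Type*} [Fintype V] {G : SimpleGraph V} {N : Sym2 V → ℕ}
    [Fintype (Sym2 V)] [∀ v : V, DecidablePred fun e : Sym2 V => v ∈ e] :
    IsDoubleDimerConfig G N ↔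
      (∀ e, e ∉ G.edgeSet → N e = 0) ∧ ∀ v : V, ∑ e : Sym2 V with v ∈ e, N e = 2 := by
  rw [IsDoubleDimerConfig]
  congr! 5
  exact Finset.ext fun e => by simp

section

variable {x y z : ℕ}

/-- The edge of `H_{x,y,z}` under a dart. -/
def boxDartEdge (δ : HexDart) (hδ : δ ∈ boxDarts x y z) : Sym2 (boxRegion x y z) :=
  s(⟨δ.1, (mem_boxDarts.1 hδ).1⟩, ⟨δ.1.nbr δ.2, (mem_boxDarts.1 hδ).2⟩)

theorem map_val_boxDartEdge (δ : HexDart) (hδ : δ ∈ boxDarts x y z) :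
    (boxDartEdge δ hδ).map Subtype.val = δ.edge := rfl

theorem exists_eq_boxDartEdge {e : Sym2 (boxRegion x y z)} (he : e ∈ (boxGraph x y z).edgeSet)
    {v : boxRegion x y z} (hv : v ∈ e) :
    ∃ d, ∃ h : (v.1, d) ∈ boxDarts x y z, e = boxDartEdge (v.1, d) h := by
  obtain ⟨w, rfl⟩ := hv
  obtain ⟨d, hd⟩ := (map_val_mem_edgeSet _).2 he
  refine ⟨d, mem_boxDarts.2 ⟨v.2, ?_⟩, ?_⟩
  · have hd : w.1 = v.1.nbr d := hd
    change v.1.nbr d ∈ _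
    rw [← hd]
    exact w.2
  · obtain ⟨w, hw⟩ := w
    obtain rfl : w = v.1.nbr d := hd
    rfl

theorem boxDartEdge_eq_iff {δ δ' : HexDart} (hδ : δ ∈ boxDarts x y z) (hδ' : δ' ∈ boxDarts x y z) :
    boxDartEdge δ' hδ' = boxDartEdge δ hδ ↔ δ' = δ ∨ δ' = δ.rev := by
  rw [← HexDart.edge_eq_iff, ← map_val_boxDartEdge δ hδ, ← map_val_boxDartEdge δ' hδ']
  exact ((boxEdgeEmb x y z).injective.eq_iff).symm

theorem dartMult_of_mem (N : Sym2 (boxRegion x y z) → ℕ) {δ : HexDart}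
    (hδ : δ ∈ boxDarts x y z) : dartMult N δ = N (boxDartEdge δ hδ) :=
  dif_pos (mem_boxDarts.1 hδ)

theorem dartMult_of_notMem (N : Sym2 (boxRegion x y z) → ℕ) {δ : HexDart}
    (hδ : δ ∉ boxDarts x y z) : dartMult N δ = 0 :=
  dif_neg fun h => hδ (mem_boxDarts.2 h)

theorem dartMult_rev (N : Sym2 (boxRegion x y z) → ℕ) (δ : HexDart) :
    dartMult N δ.rev = dartMult N δ := by
  by_cases h : δ ∈ boxDarts x y z
  · rw [dartMult_of_mem N h, dartMult_of_mem N (rev_mem_boxDarts.2 h)]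
    congr 1
    exact (boxDartEdge_eq_iff h _).2 (Or.inr rfl)
  · rw [dartMult_of_notMem N h, dartMult_of_notMem N (fun h' => h (rev_mem_boxDarts.1 h'))]

/-- Replaces the sum over edges at a vertex by one over three directions; a direction leaving the
box contributes `0`, the default value of `dartMult`. -/
theorem sum_incident_eq {N : Sym2 (boxRegion x y z) → ℕ}
    (hN : ∀ e, e ∉ (boxGraph x y z).edgeSet → N e = 0) (v : boxRegion x y z) :
    ∑ e : Sym2 (boxRegion x y z) with v ∈ e, N e = ∑ d, dartMult N (v.1, d) := by
  symm
  rw [← Finset.sum_filter_of_ne (p := fun d => (v.1, d) ∈ boxDarts x y z)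
    (fun d _ h => by by_contra h'; exact h (dartMult_of_notMem N h'))]
  refine Finset.sum_bij_ne_zero
    (fun d hd _ => boxDartEdge (v.1, d) (Finset.mem_filter.1 hd).2) ?_ ?_ ?_ ?_
  · intro d hd _
    simp [boxDartEdge]
  · intro d hd _ d' hd' _ h
    rcases (boxDartEdge_eq_iff _ _).1 h with h | h
    · exact congrArg Prod.snd h
    · exact absurd (congrArg Prod.fst h).symm (v.1.nbr_ne d')
  · intro e he h
    have he' : e ∈ (boxGraph x y z).edgeSet := by
      by_contra h'
      exact h (hN e h')
    obtain ⟨d, hd, rfl⟩ := exists_eq_boxDartEdge he' (Finset.mem_filter.1 he).2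
    exact ⟨d, Finset.mem_filter.2 ⟨Finset.mem_univ _, hd⟩, by rwa [dartMult_of_mem N hd], rfl⟩
  · intro d hd _
    rw [dartMult_of_mem]

theorem IsDoubleDimerConfig.sum_dartMult {N : Sym2 (boxRegion x y z) → ℕ}
    (hN : IsDoubleDimerConfig (boxGraph x y z) N) {v : HexVertex} (hv : v ∈ boxRegion x y z) :
    ∑ d, dartMult N (v, d) = 2 := by
  exact (sum_incident_eq hN.1 ⟨v, hv⟩).symm.trans ((isDoubleDimerConfig_iff.1 hN).2 _)

theorem map_val_map_boxPropeller (e : Sym2 (boxRegion (2 * x) (2 * y) (2 * z))) :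
    (e.map boxPropeller).map Subtype.val = (e.map Subtype.val).map HexVertex.propeller := by
  rw [Sym2.map_map, Sym2.map_map]
  rfl

theorem card_filter_pair {α : Type*} [DecidableEq α] {a b : α} (hab : a ≠ b) (P : α → Prop)
    [DecidablePred P] : (({a, b} : Finset α).filter P).card = ind (P a) + ind (P b) := by
  by_cases ha : P a <;> by_cases hb : P b <;> simp [Finset.filter_insert, Finset.filter_singleton, *]

/-- The even edges contracted onto the edge under `δ` are exactly the left edges of `δ` and of
`δ.rev`. -/
theorem squish_boxDartEdge {m : Finset (Sym2 (boxRegion (2 * x) (2 * y) (2 * z)))}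
    (hm : HexMatching (boxRegion (2 * x) (2 * y) (2 * z)) (m.map (boxEdgeEmb _ _ _)))
    (δ : HexDart) (hδ : δ ∈ boxDarts x y z) :
    squish m (boxDartEdge δ hδ) = ind (δ ∈ fineDarts x y z (m.map (boxEdgeEmb _ _ _))) +
      ind (δ.rev ∈ fineDarts x y z (m.map (boxEdgeEmb _ _ _))) := by
  have h1 : (m.filter fun e => IsEvenEdge (e.map Subtype.val) ∧
      e.map boxPropeller = boxDartEdge δ hδ).map (boxEdgeEmb _ _ _) =
      ((({δ, δ.rev} : Finset HexDart).filter
        fun δ' => δ' ∈ fineDarts x y z (m.map (boxEdgeEmb _ _ _))).image HexDart.fineEdge) := by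
    ext e
    simp only [Finset.mem_map, Finset.mem_filter, Finset.mem_image, Finset.mem_insert,
      Finset.mem_singleton, mem_fineDarts hm]
    constructor
    · rintro ⟨e, ⟨he, h2, h3⟩, rfl⟩
      have he' : (boxEdgeEmb _ _ _) e ∈ m.map (boxEdgeEmb _ _ _) := Finset.mem_map.2 ⟨e, he, rfl⟩
      obtain ⟨δ', h | h⟩ := (HexDart.mem_edgeSet_iff _).1 (hm.1 _ he').1
      · refine ⟨δ', ⟨?_, ⟨e, he, h⟩⟩, h.symm⟩
        rw [← HexDart.edge_eq_iff, ← map_val_boxDartEdge δ hδ, ← h3, map_val_map_boxPropeller]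
        change _ = (boxEdgeEmb _ _ _ e).map _
        rw [h, HexDart.map_propeller_fineEdge]
        rfl
      · exact absurd (h ▸ h2) (HexDart.not_isEvenEdge_spoke δ')
    · rintro ⟨δ', ⟨h, e, he, h'⟩, rfl⟩
      have h'' : e.map Subtype.val = δ'.fineEdge := h'
      refine ⟨e, ⟨he, h'' ▸ δ'.isEvenEdge_fineEdge, ?_⟩, h'⟩
      apply (boxEdgeEmb x y z).injective
      change (e.map boxPropeller).map Subtype.val = (boxDartEdge δ hδ).map Subtype.val
      rw [map_val_map_boxPropeller, h'', HexDart.map_propeller_fineEdge, map_val_boxDartEdge]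
      exact (HexDart.edge_eq_iff δ δ').2 h
  have h2 := congrArg Finset.card h1
  rw [Finset.card_map, Finset.card_image_of_injective _ HexDart.fineEdge_injective] at h2
  exact h2.trans (card_filter_pair δ.rev_ne.symm _)

theorem squish_eq_zero {m : Finset (Sym2 (boxRegion (2 * x) (2 * y) (2 * z)))}
    (hm : HexMatching (boxRegion (2 * x) (2 * y) (2 * z)) (m.map (boxEdgeEmb _ _ _)))
    (E : Sym2 (boxRegion x y z)) (hE : E ∉ (boxGraph x y z).edgeSet) : squish m E = 0 := by
  rw [squish, Finset.card_eq_zero, Finset.filter_eq_empty_iff]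
  rintro e he ⟨h2, rfl⟩
  apply hE
  rw [← map_val_mem_edgeSet, map_val_map_boxPropeller]
  obtain ⟨δ', h | h⟩ := (HexDart.mem_edgeSet_iff _).1 (hm.1 _ (Finset.mem_map.2 ⟨e, he, rfl⟩)).1
  · have h : e.map Subtype.val = δ'.fineEdge := h
    rw [h, HexDart.map_propeller_fineEdge]
    exact ⟨δ'.2, rfl⟩
  · exact absurd (h ▸ h2) (HexDart.not_isEvenEdge_spoke δ')

theorem dartMult_squish {m : Finset (Sym2 (boxRegion (2 * x) (2 * y) (2 * z)))}
    (hm : HexMatching (boxRegion (2 * x) (2 * y) (2 * z)) (m.map (boxEdgeEmb _ _ _)))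
    (δ : HexDart) :
    dartMult (squish m) δ = ind (δ ∈ fineDarts x y z (m.map (boxEdgeEmb _ _ _))) +
      ind (δ.rev ∈ fineDarts x y z (m.map (boxEdgeEmb _ _ _))) := by
  by_cases h : δ ∈ boxDarts x y z
  · rw [dartMult_of_mem _ h, squish_boxDartEdge hm]
  · rw [dartMult_of_notMem _ h, ind_of_not, ind_of_not]
    · exact fun h' => h (rev_mem_boxDarts.1 (Finset.mem_filter.1 h').1)
    · exact fun h' => h (Finset.mem_filter.1 h').1

/-- The squish map takes dimer configurations to double dimer configurations. -/
theorem isDoubleDimerConfig_squish {m : Finset (Sym2 (boxRegion (2 * x) (2 * y) (2 * z)))}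
    (hm : m ∈ dimerConfigs (boxGraph (2 * x) (2 * y) (2 * z))) :
    IsDoubleDimerConfig (boxGraph x y z) (squish m) := by
  have hm := (isDimerConfig_iff m).1 (Finset.mem_filter.1 hm).2
  refine isDoubleDimerConfig_iff.2 ⟨squish_eq_zero hm, fun v => ?_⟩
  rw [← sum_ind_fineDarts hm v.2]
  refine (sum_incident_eq (squish_eq_zero hm) v).trans ?_
  exact Finset.sum_congr rfl fun d _ => dartMult_squish hm _

theorem dimerWeight_eq {f : EdgeDir → ℤ → ℤ → ℂˣ} (hf : ∀ δ : HexDart, hexWeight f δ.spoke = 1)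
    {m : Finset (Sym2 (boxRegion (2 * x) (2 * y) (2 * z)))}
    (hm : HexMatching (boxRegion (2 * x) (2 * y) (2 * z)) (m.map (boxEdgeEmb _ _ _))) :
    dimerWeight (boxWeight f) m =
      ∏ δ ∈ fineDarts x y z (m.map (boxEdgeEmb _ _ _)), hexWeight f δ.fineEdge := by
  have h1 : dimerWeight (boxWeight f) m = ∏ e ∈ m.map (boxEdgeEmb _ _ _), hexWeight f e := by
    rw [Finset.prod_map]
    rfl
  rw [h1]
  conv_lhs => rw [← fineMatching_fineDarts hm]
  rw [fineMatching, Finset.prod_union, Finset.prod_image HexDart.fineEdge_injective.injOn,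
    Finset.prod_image HexDart.spoke_injective.injOn, Finset.prod_congr rfl fun δ _ => hf δ,
    Finset.prod_const_one, mul_one]
  rw [Finset.disjoint_left]
  simp only [Finset.mem_image, not_exists, not_and]
  rintro e ⟨δ, -, rfl⟩ δ' -
  exact HexDart.spoke_ne_fineEdge _ _

/-- The total weight of the dimer configurations over a given double dimer configuration. -/
theorem sum_fiber {f : EdgeDir → ℤ → ℤ → ℂˣ} (hf : ∀ δ : HexDart, hexWeight f δ.spoke = 1)
    {N : Sym2 (boxRegion x y z) → ℕ} (hN : IsDoubleDimerConfig (boxGraph x y z) N) :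
    ∑ m ∈ dimerConfigs (boxGraph (2 * x) (2 * y) (2 * z)) with squish m = N,
      dimerWeight (boxWeight f) m =
    ∑ S ∈ admissible (boxDarts x y z) (dartMult N), ∏ δ ∈ S, hexWeight f δ.fineEdge := by
  have hmem : ∀ m ∈ (dimerConfigs (boxGraph (2 * x) (2 * y) (2 * z))).filter (squish · = N),
      HexMatching (boxRegion (2 * x) (2 * y) (2 * z)) (m.map (boxEdgeEmb _ _ _)) ∧
        squish m = N := fun m hm => ⟨(isDimerConfig_iff m).1
          (Finset.mem_filter.1 (Finset.mem_filter.1 hm).1).2, (Finset.mem_filter.1 hm).2⟩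
  -- `fineMatching` is the inverse of this map: spokes are determined by the even edges.
  refine Finset.sum_bij (fun m _ => fineDarts x y z (m.map (boxEdgeEmb _ _ _))) ?_ ?_ ?_ ?_
  · intro m hm
    obtain ⟨hM, rfl⟩ := hmem m hm
    exact mem_admissible.2 ⟨Finset.filter_subset _ _, fun δ _ => (dartMult_squish hM δ).symm,
      fun δ hδ => fineDarts_left_notMem hM hδ⟩
  · intro m hm m' hm' h
    have h := congrArg (fineMatching x y z) h
    rw [fineMatching_fineDarts (hmem m hm).1, fineMatching_fineDarts (hmem m' hm').1] at h
    exact Finset.map_injective _ h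
  · intro S hS
    have hM := hexMatching_fineMatching hS (fun δ h => dartMult_of_notMem N h)
      fun v hv => hN.sum_dartMult hv
    obtain ⟨m, hm⟩ := hM.exists_map_eq
    have hSm : fineDarts x y z (m.map (boxEdgeEmb _ _ _)) = S := by
      rw [hm, fineDarts_fineMatching (mem_admissible.1 hS).1]
    rw [← hm] at hM
    refine ⟨m, ?_, hSm⟩
    rw [Finset.mem_filter, dimerConfigs, Finset.mem_filter]
    refine ⟨⟨Finset.mem_univ _, (isDimerConfig_iff m).2 hM⟩, ?_⟩
    ext E
    by_cases hE : E ∈ (boxGraph x y z).edgeSet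
    · induction E using Sym2.ind with
      | h P Q =>
        obtain ⟨d, hd, h⟩ := exists_eq_boxDartEdge hE (Sym2.mem_mk_left P Q)
        rw [h, squish_boxDartEdge hM, hSm, (mem_admissible.1 hS).2.1 _ hd, dartMult_of_mem N hd]
    · rw [squish_eq_zero hM E hE, hN.1 E hE]
  · intro m hm
    exact dimerWeight_eq hf (hmem m hm).1

end

/-! ## Sums over admissible sets of darts -/

/-- The weighted sum over the admissible sets of darts. -/
noncomputable def stateSum (wt : HexDart → ℂ) (D : Finset HexDart) (N : HexDart → ℕ) : ℂ :=
  ∑ S ∈ admissible D N, ∏ δ ∈ S, wt δ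

theorem ne_zero_of_mem_admissible {D : Finset HexDart} {N : HexDart → ℕ} {S : Finset HexDart}
    (hS : S ∈ admissible D N) {δ : HexDart} (hδ : δ ∈ S) : N δ ≠ 0 := by
  obtain ⟨h1, h2, -⟩ := mem_admissible.1 hS
  rw [← h2 δ (h1 hδ), ind_of hδ]
  omega

/-- A dart ends where its left successor begins, so the left-turn condition never links darts over
parts without a common vertex. Admissible sets for the sum are therefore unions of independent
admissible sets. -/
theorem stateSum_add (wt : HexDart → ℂ) {D : Finset HexDart} {N₁ N₂ : HexDart → ℕ}
    (hr₁ : ∀ δ, N₁ δ.rev = N₁ δ) (hr₂ : ∀ δ, N₂ δ.rev = N₂ δ)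
    (h : ∀ δ δ', N₁ δ ≠ 0 → N₂ δ' ≠ 0 → δ.1 ≠ δ'.1) :
    stateSum wt D (N₁ + N₂) = stateSum wt D N₁ * stateSum wt D N₂ := by
  have h12 : ∀ δ, N₁ δ ≠ 0 → N₂ δ = 0 := fun δ h1 => by
    by_contra h2
    exact h δ δ h1 h2 rfl
  rw [stateSum, stateSum, stateSum, Finset.sum_mul_sum, ← Finset.sum_product']
  symm
  refine Finset.sum_bij' (fun S _ => S.1 ∪ S.2)
    (fun S _ => (S.filter fun δ => N₁ δ ≠ 0, S.filter fun δ => N₂ δ ≠ 0)) ?_ ?_ ?_ ?_ ?_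
  · rintro ⟨S₁, S₂⟩ hS
    obtain ⟨hS₁, hS₂⟩ := Finset.mem_product.1 hS
    obtain ⟨a1, a2, a3⟩ := mem_admissible.1 hS₁
    obtain ⟨b1, b2, b3⟩ := mem_admissible.1 hS₂
    refine mem_admissible.2 ⟨Finset.union_subset a1 b1, ?_, ?_⟩
    · intro δ hδ
      simp only [Finset.mem_union, Pi.add_apply]
      rw [← a2 δ hδ, ← b2 δ hδ]
      by_cases h1 : N₁ δ = 0
      · have c1 : δ ∉ S₁ := fun h' => ne_zero_of_mem_admissible hS₁ h' h1
        have c2 : δ.rev ∉ S₁ := fun h' => ne_zero_of_mem_admissible hS₁ h' ((hr₁ δ).trans h1)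
        simp [c1, c2]
      · have h2 := h12 δ h1
        have c1 : δ ∉ S₂ := fun h' => ne_zero_of_mem_admissible hS₂ h' h2
        have c2 : δ.rev ∉ S₂ := fun h' => ne_zero_of_mem_admissible hS₂ h' ((hr₂ δ).trans h2)
        simp [c1, c2]
    · intro δ hδ hδ'
      rcases Finset.mem_union.1 hδ with h1 | h1 <;> rcases Finset.mem_union.1 hδ' with h2 | h2
      · exact a3 δ h1 h2
      · refine h δ.rev δ.left ?_ (ne_zero_of_mem_admissible hS₂ h2) rfl
        rw [hr₁]
        exact ne_zero_of_mem_admissible hS₁ h1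
      · refine h δ.left δ.rev (ne_zero_of_mem_admissible hS₁ h2) ?_ rfl
        rw [hr₂]
        exact ne_zero_of_mem_admissible hS₂ h1
      · exact b3 δ h1 h2
  · intro S hS
    obtain ⟨a1, a2, a3⟩ := mem_admissible.1 hS
    refine Finset.mem_product.2 ⟨mem_admissible.2 ⟨(Finset.filter_subset _ _).trans a1, ?_, ?_⟩,
      mem_admissible.2 ⟨(Finset.filter_subset _ _).trans a1, ?_, ?_⟩⟩
    · intro δ hδ
      have := a2 δ hδ
      simp only [Finset.mem_filter, hr₁, Pi.add_apply] at this ⊢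
      by_cases h1 : N₁ δ = 0
      · simp [h1]
      · rw [h12 δ h1] at this
        simpa [h1] using this
    · intro δ hδ hδ'
      exact a3 δ (Finset.mem_filter.1 hδ).1 (Finset.mem_filter.1 hδ').1
    · intro δ hδ
      have := a2 δ hδ
      simp only [Finset.mem_filter, hr₂, Pi.add_apply] at this ⊢
      by_cases h1 : N₂ δ = 0
      · simp [h1]
      · have h0 : N₁ δ = 0 := by
          by_contra h'
          exact h1 (h12 δ h')
        rw [h0] at this
        simpa [h1] using this
    · intro δ hδ hδ'
      exact a3 δ (Finset.mem_filter.1 hδ).1 (Finset.mem_filter.1 hδ').1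
  · rintro ⟨S₁, S₂⟩ hS
    obtain ⟨hS₁, hS₂⟩ := Finset.mem_product.1 hS
    have a : ∀ δ ∈ S₁, N₁ δ ≠ 0 := fun δ h' => ne_zero_of_mem_admissible hS₁ h'
    have b : ∀ δ ∈ S₂, N₂ δ ≠ 0 := fun δ h' => ne_zero_of_mem_admissible hS₂ h'
    ext δ
    · simp only [Finset.mem_filter, Finset.mem_union]
      exact ⟨fun h' => h'.1.resolve_right fun h2 => b δ h2 (h12 δ h'.2),
        fun h' => ⟨Or.inl h', a δ h'⟩⟩
    · simp only [Finset.mem_filter, Finset.mem_union]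
      exact ⟨fun h' => h'.1.resolve_left fun h2 => h'.2 (h12 δ (a δ h2)),
        fun h' => ⟨Or.inr h', b δ h'⟩⟩
  · intro S hS
    ext δ
    simp only [Finset.mem_filter, Finset.mem_union]
    constructor
    · rintro (h' | h') <;> exact h'.1
    · intro h'
      have := ne_zero_of_mem_admissible hS h'
      simp only [Pi.add_apply] at this
      by_cases h1 : N₁ δ = 0
      · exact Or.inr ⟨h', by omega⟩
      · exact Or.inl ⟨h', h1⟩
  · rintro ⟨S₁, S₂⟩ hS
    obtain ⟨hS₁, hS₂⟩ := Finset.mem_product.1 hS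
    refine (Finset.prod_union (Finset.disjoint_left.2 fun δ h1 h2 => ?_)).symm
    exact ne_zero_of_mem_admissible hS₂ h2 (h12 δ (ne_zero_of_mem_admissible hS₁ h1))

theorem stateSum_zero (wt : HexDart → ℂ) (D : Finset HexDart) {N : HexDart → ℕ}
    (hN : ∀ δ, N δ = 0) : stateSum wt D N = 1 := by
  have : admissible D N = {∅} := by
    ext S
    rw [Finset.mem_singleton]
    constructor
    · intro hS
      exact Finset.eq_empty_of_forall_notMem fun δ hδ => ne_zero_of_mem_admissible hS hδ (hN δ)
    · rintro rfl
      exact mem_admissible.2 ⟨by simp, by simp [hN], by simp⟩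
  rw [stateSum, this, Finset.sum_singleton, Finset.prod_empty]

/-- Multiplicity two forces both darts. This is admissible because they have the same direction,
while a left turn changes the direction. -/
theorem stateSum_doubled (wt : HexDart → ℂ) {D : Finset HexDart} {N : HexDart → ℕ} {δ₀ : HexDart}
    (h₀ : δ₀ ∈ D) (h₀' : δ₀.rev ∈ D) (hN : ∀ δ, N δ = if δ = δ₀ ∨ δ = δ₀.rev then 2 else 0) :
    stateSum wt D N = wt δ₀ * wt δ₀.rev := by
  have : admissible D N = {{δ₀, δ₀.rev}} := by
    ext S
    rw [Finset.mem_singleton]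
    constructor
    · intro hS
      have h1 := (mem_admissible.1 hS).2.1 δ₀ h₀
      rw [hN, if_pos (Or.inl rfl)] at h1
      have h2 := ind_le (δ₀ ∈ S)
      have h3 := ind_le (δ₀.rev ∈ S)
      have h4 : δ₀ ∈ S := ind_eq_one.1 (by omega)
      have h5 : δ₀.rev ∈ S := ind_eq_one.1 (by omega)
      ext δ
      rw [Finset.mem_insert, Finset.mem_singleton]
      constructor
      · intro h
        have := ne_zero_of_mem_admissible hS h
        by_contra h'
        rw [hN, if_neg h'] at this
        exact this rfl
      · rintro (rfl | rfl) <;> assumption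
    · rintro rfl
      refine mem_admissible.2 ⟨?_, ?_, ?_⟩
      · intro δ
        rw [Finset.mem_insert, Finset.mem_singleton]
        rintro (rfl | rfl) <;> assumption
      · intro δ _
        have h1 : δ.rev ∈ ({δ₀, δ₀.rev} : Finset HexDart) ↔ δ ∈ ({δ₀, δ₀.rev} : Finset HexDart) := by
          simp only [Finset.mem_insert, Finset.mem_singleton]
          constructor
          · rintro (h | h)
            · exact Or.inr (by rw [← h, HexDart.rev_rev])
            · exact Or.inl (by rw [← δ.rev_rev, h, HexDart.rev_rev])
          · rintro (rfl | rfl)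
            · exact Or.inr rfl
            · exact Or.inl (HexDart.rev_rev _)
        rw [h1, hN]
        by_cases h : δ = δ₀ ∨ δ = δ₀.rev
        · rw [if_pos h, ind_of (by simpa using h)]
        · rw [if_neg h, ind_of_not (by simpa using h)]
      · intro δ hδ hδ'
        rw [Finset.mem_insert, Finset.mem_singleton] at hδ hδ'
        have hd : δ.2 = δ₀.2 := by rcases hδ with rfl | rfl <;> rfl
        have hd' : δ.2.rot = δ₀.2 := by
          rcases hδ' with h | h
          · exact congrArg Prod.snd h
          · exact congrArg Prod.snd h
        exact δ.2.rot_ne (hd'.trans hd.symm)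
  rw [stateSum, this, Finset.sum_singleton, Finset.prod_pair δ₀.rev_ne.symm]

/-! ## The loops of a double dimer configuration -/

/-- Two different edges of a cycle at one of its vertices. -/
theorem SimpleGraph.Walk.IsCycle.exists_two_edges {V : Type*} {G : SimpleGraph V} {u : V} {p : G.Walk u u} (hp : p.IsCycle) {v : V}
    (hv : v ∈ p.support) :
    ∃ e₁ ∈ p.edges, ∃ e₂ ∈ p.edges, e₁ ≠ e₂ ∧ v ∈ e₁ ∧ v ∈ e₂ := by
  obtain ⟨w₁, w₂, hne, hw⟩ := Set.ncard_eq_two.1 (hp.ncard_neighborSet_toSubgraph_eq_two hv)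
  have h1 : w₁ ∈ p.toSubgraph.neighborSet v := hw ▸ Set.mem_insert _ _
  have h2 : w₂ ∈ p.toSubgraph.neighborSet v := hw ▸ Set.mem_insert_of_mem _ rfl
  refine ⟨s(v, w₁), p.mem_edges_toSubgraph.1 h1, s(v, w₂), p.mem_edges_toSubgraph.1 h2, ?_,
    by simp, by simp⟩
  intro h
  exact hne (Sym2.congr_right.1 h)

section Loops

variable {V : Type*} [Fintype V] {G : SimpleGraph V} {N : Sym2 V → ℕ}

theorem IsDoubleDimerConfig.eq_zero_of_mem (hN : IsDoubleDimerConfig G N) {v : V}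
    {e₁ e₂ e : Sym2 V} (h₁ : v ∈ e₁) (h₂ : v ∈ e₂) (h : v ∈ e) (h12 : e₁ ≠ e₂)
    (n₁ : N e₁ ≠ 0) (n₂ : N e₂ ≠ 0) (ne₁ : e ≠ e₁) (ne₂ : e ≠ e₂) : N e = 0 := by
  have hs := (isDoubleDimerConfig_iff.1 hN).2 v
  have hsub : ({e, e₁, e₂} : Finset (Sym2 V)) ⊆ Finset.univ.filter (fun e : Sym2 V => v ∈ e) := by
    intro e'
    simp only [Finset.mem_insert, Finset.mem_singleton, Finset.mem_filter, Finset.mem_univ,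
      true_and]
    rintro (rfl | rfl | rfl) <;> assumption
  have := Finset.sum_le_sum_of_subset (f := N) hsub
  rw [hs, Finset.sum_insert (by simp [ne₁, ne₂]), Finset.sum_pair h12] at this
  omega

theorem IsDoubleDimerConfig.eq_of_eq_two (hN : IsDoubleDimerConfig G N) {v : V}
    {e e' : Sym2 V} (h : v ∈ e) (h' : v ∈ e') (h2 : N e = 2) (h0 : N e' ≠ 0) : e = e' := by
  by_contra hne
  have hs := (isDoubleDimerConfig_iff.1 hN).2 v
  have hsub : ({e, e'} : Finset (Sym2 V)) ⊆ Finset.univ.filter (fun e : Sym2 V => v ∈ e) := by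
    intro e'
    simp only [Finset.mem_insert, Finset.mem_singleton, Finset.mem_filter, Finset.mem_univ,
      true_and]
    rintro (rfl | rfl) <;> assumption
  have := Finset.sum_le_sum_of_subset (f := N) hsub
  rw [hs, Finset.sum_pair hne] at this
  omega

theorem IsDoubleDimerConfig.le_two (hN : IsDoubleDimerConfig G N) (e : Sym2 V) : N e ≤ 2 := by
  induction e using Sym2.ind with
  | h v w =>
    rw [← (isDoubleDimerConfig_iff.1 hN).2 v]
    exact Finset.single_le_sum (f := N) (fun _ _ => Nat.zero_le _) (by simp)

theorem IsDoubleDimerConfig.mem_edges_of_mem_support (hN : IsDoubleDimerConfig G N) {u : V}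
    {p : G.Walk u u} (hp : p.IsCycle) (h1 : ∀ e ∈ p.edges, N e = 1) {v : V} (hv : v ∈ p.support)
    {e : Sym2 V} (hve : v ∈ e) (he : N e ≠ 0) : e ∈ p.edges := by
  obtain ⟨e₁, h₁, e₂, h₂, hne, hv₁, hv₂⟩ := hp.exists_two_edges hv
  by_contra h
  exact he (hN.eq_zero_of_mem hv₁ hv₂ hve hne (by rw [h1 e₁ h₁]; simp) (by rw [h1 e₂ h₂]; simp)
    (by rintro rfl; exact h h₁) (by rintro rfl; exact h h₂))

/-- At a vertex of a loop the two loop edges exhaust the degree, so a walk along edges of nonzero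
multiplicity cannot leave the loop. Hence loops with a common vertex coincide. -/
theorem IsDoubleDimerConfig.walk_edges_subset (hN : IsDoubleDimerConfig G N) {u : V}
    {p : G.Walk u u} (hp : p.IsCycle) (h1 : ∀ e ∈ p.edges, N e = 1) {v w : V} (q : G.Walk v w)
    (hq : ∀ e ∈ q.edges, N e ≠ 0) (hv : v ∈ p.support) : ∀ e ∈ q.edges, e ∈ p.edges := by
  induction q with
  | nil => simp
  | @cons v v' w hadj q ih =>
    have he : s(v, v') ∈ p.edges :=
      hN.mem_edges_of_mem_support hp h1 hv (by simp) (hq _ (by simp))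
    intro e he'
    rw [SimpleGraph.Walk.edges_cons, List.mem_cons] at he'
    rcases he' with rfl | he'
    · exact he
    · exact ih (fun e h => hq e (by simp [h])) (p.snd_mem_support_of_mem_edges he) e he'

theorem IsDoubleDimerConfig.closedLoop_subset (hN : IsDoubleDimerConfig G N)
    {L L' : Finset (Sym2 V)} (hL : IsClosedLoop G N L) (hL' : IsClosedLoop G N L') {v : V}
    {e e' : Sym2 V} (he : e ∈ L) (he' : e' ∈ L') (hv : v ∈ e) (hv' : v ∈ e') : L' ⊆ L := by
  obtain ⟨u, p, hp, h1, rfl⟩ := hL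
  obtain ⟨u', p', hp', h1', rfl⟩ := hL'
  rw [List.mem_toFinset] at he he'
  have hvp : v ∈ p.support := p.mem_support_of_mem_edges he hv
  have hvp' : v ∈ p'.support := p'.mem_support_of_mem_edges he' hv'
  have hrot : ∀ e, e ∈ (p'.rotate v hvp').edges ↔ e ∈ p'.edges := fun e =>
    (p'.rotate_edges v hvp').mem_iff
  intro f hf
  rw [List.mem_toFinset] at hf ⊢
  refine hN.walk_edges_subset hp h1 (p'.rotate v hvp') ?_ hvp f ((hrot f).2 hf)
  intro e he
  rw [h1' e ((hrot e).1 he)]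
  simp

theorem IsDoubleDimerConfig.closedLoop_eq (hN : IsDoubleDimerConfig G N)
    {L L' : Finset (Sym2 V)} (hL : IsClosedLoop G N L) (hL' : IsClosedLoop G N L') {v : V}
    {e e' : Sym2 V} (he : e ∈ L) (he' : e' ∈ L') (hv : v ∈ e) (hv' : v ∈ e') : L = L' :=
  (hN.closedLoop_subset hL' hL he' he hv' hv).antisymm (hN.closedLoop_subset hL hL' he he' hv hv')

/-- The graph of the edges that occur once. -/
def simpleEdgeGraph (G : SimpleGraph V) (N : Sym2 V → ℕ) : SimpleGraph V where
  Adj v w := G.Adj v w ∧ N s(v, w) = 1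
  symm := ⟨fun v w h => ⟨h.1.symm, by rw [Sym2.eq_swap]; exact h.2⟩⟩
  loopless := ⟨fun v h => G.loopless.irrefl v h.1⟩

/-- An edge of multiplicity one leaves degree one at its end, which must be a second edge of
multiplicity one. -/
theorem IsDoubleDimerConfig.isCycles (hN : IsDoubleDimerConfig G N) :
    (simpleEdgeGraph G N).IsCycles := by
  rintro v ⟨w, hw⟩
  have hw : G.Adj v w ∧ N s(v, w) = 1 := hw
  have hs := (isDoubleDimerConfig_iff.1 hN).2 v
  have hmem : s(v, w) ∈ Finset.univ.filter (fun e : Sym2 V => v ∈ e) := by simp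
  rw [← Finset.add_sum_erase _ _ hmem, hw.2] at hs
  have hs' : ∑ e ∈ (Finset.univ.filter (fun e : Sym2 V => v ∈ e)).erase s(v, w), N e = 1 := by
    omega
  obtain ⟨e, he, he0⟩ := Finset.exists_ne_zero_of_sum_ne_zero (hs'.trans_ne one_ne_zero)
  obtain ⟨hne, hve⟩ := Finset.mem_erase.1 he
  obtain ⟨w', rfl⟩ := (Finset.mem_filter.1 hve).2
  have hadj : G.Adj v w' := by
    by_contra h
    exact he0 (hN.1 _ h)
  have hle : N s(v, w') ≤ 1 := by
    rw [← hs']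
    exact Finset.single_le_sum (f := N) (fun _ _ => Nat.zero_le _) he
  have hww : w ≠ w' := by
    rintro rfl
    exact hne rfl
  rw [Set.ncard_eq_two]
  refine ⟨w, w', hww, ?_⟩
  ext w''
  constructor
  · rintro ⟨-, h⟩
    by_contra h'
    simp only [Set.mem_insert_iff, Set.mem_singleton_iff, not_or] at h'
    have := hN.eq_zero_of_mem (v := v) (e₁ := s(v, w)) (e₂ := s(v, w')) (e := s(v, w''))
      (by simp) (by simp) (by simp) (fun h => hww (Sym2.congr_right.1 h))
      (by rw [hw.2]; simp) he0 (fun h => h'.1 (Sym2.congr_right.1 h))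
      (fun h => h'.2 (Sym2.congr_right.1 h))
    omega
  · rintro (rfl | rfl)
    · exact hw
    · exact ⟨hadj, by omega⟩

theorem IsDoubleDimerConfig.exists_closedLoop (hN : IsDoubleDimerConfig G N) {e : Sym2 V}
    (he : N e = 1) : ∃ L, IsClosedLoop G N L ∧ e ∈ L := by
  induction e using Sym2.ind with
  | h v w =>
    have hadj : G.Adj v w := by
      by_contra h
      rw [hN.1 _ h] at he
      exact zero_ne_one he
    have hle : simpleEdgeGraph G N ≤ G := fun _ _ h => h.1
    obtain ⟨p, hp, -⟩ := hN.isCycles.exists_cycle_toSubgraph_verts_eq_connectedComponentSupp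
      (c := (simpleEdgeGraph G N).connectedComponentMk v) (v := v) rfl
      ⟨w, (⟨hadj, he⟩ : G.Adj v w ∧ N s(v, w) = 1)⟩
    have hp1 : ∀ e ∈ (p.mapLe hle).edges, N e = 1 := by
      intro e h
      rw [SimpleGraph.Walk.edges_mapLe_eq_edges] at h
      have := p.edges_subset_edgeSet h
      induction e using Sym2.ind with
      | h a b => exact this.2
    refine ⟨_, ⟨v, p.mapLe hle, hp.mapLe hle, hp1, rfl⟩, ?_⟩
    rw [List.mem_toFinset]
    -- The cycle is based at `v`, so it uses every edge of nonzero multiplicity there, in particular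
    -- the given one.
    exact hN.mem_edges_of_mem_support (hp.mapLe hle) hp1 (v := v) (by simp) (by simp)
      (by rw [he]; simp)

theorem doubleDimerContribution_eq {w : Sym2 V → ℂ} {Γ : SL2Connection G} [Fintype (Sym2 V)]
    [Fintype (Finset (Sym2 V))] [DecidablePred (IsClosedLoop G N)] :
    doubleDimerContribution w Γ N =
      (∏ e : Sym2 V, w e ^ N e) * ∏ L : Finset (Sym2 V) with IsClosedLoop G N L, Γ.loopTrace L := by
  rw [doubleDimerContribution]
  congr! 2
  · exact Finset.ext fun e => by simp
  · exact Finset.ext fun e => by simp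

end Loops

/-! ## Factorization over doubled edges and loops -/

section Factorization

variable {x y z : ℕ}

/-- The part of a multiset of edges that is supported on a given set. -/
noncomputable def restrictEdges {α : Type*} (N : α → ℕ) (X : Finset α) : α → ℕ :=
  fun e => ind (e ∈ X) * N e

/-- The weighted sum over admissible sets of darts over a set `X` of edges. -/
noncomputable def partialSum (wt : HexDart → ℂ) (N : Sym2 (boxRegion x y z) → ℕ)
    (X : Finset (Sym2 (boxRegion x y z))) : ℂ :=
  stateSum wt (boxDarts x y z) (dartMult (restrictEdges N X))

theorem partialSum_union (wt : HexDart → ℂ) (N : Sym2 (boxRegion x y z) → ℕ)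
    {X Y : Finset (Sym2 (boxRegion x y z))}
    (h : ∀ e ∈ X, ∀ e' ∈ Y, N e ≠ 0 → N e' ≠ 0 → ∀ v ∈ e, v ∉ e') :
    partialSum wt N (X ∪ Y) = partialSum wt N X * partialSum wt N Y := by
  rw [partialSum, partialSum, partialSum, ← stateSum_add wt (dartMult_rev _) (dartMult_rev _)]
  · congr 1
    funext δ
    rw [Pi.add_apply]
    by_cases hδ : δ ∈ boxDarts x y z
    · rw [dartMult_of_mem _ hδ, dartMult_of_mem _ hδ, dartMult_of_mem _ hδ]
      simp only [restrictEdges, Finset.mem_union]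
      by_cases h1 : boxDartEdge δ hδ ∈ X <;> by_cases h2 : boxDartEdge δ hδ ∈ Y
      · by_cases h0 : N (boxDartEdge δ hδ) = 0
        · simp [h0]
        · exact absurd (Sym2.mem_mk_left _ _) (h _ h1 _ h2 h0 h0 ⟨δ.1, (mem_boxDarts.1 hδ).1⟩
            (Sym2.mem_mk_left _ _))
      · simp [h1, h2]
      · simp [h1, h2]
      · simp [h1, h2]
    · simp [dartMult_of_notMem _ hδ]
  · intro δ δ' h1 h2 heq
    have hδ : δ ∈ boxDarts x y z := by
      by_contra h'
      exact h1 (dartMult_of_notMem _ h')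
    have hδ' : δ' ∈ boxDarts x y z := by
      by_contra h'
      exact h2 (dartMult_of_notMem _ h')
    rw [dartMult_of_mem _ hδ, restrictEdges, mul_ne_zero_iff, ne_eq, ind_eq_zero, not_not] at h1
    rw [dartMult_of_mem _ hδ', restrictEdges, mul_ne_zero_iff, ne_eq, ind_eq_zero, not_not] at h2
    refine h _ h1.1 _ h2.1 h1.2 h2.2 ⟨δ.1, (mem_boxDarts.1 hδ).1⟩ (Sym2.mem_mk_left _ _) ?_
    simp only [heq]
    exact Sym2.mem_mk_left _ _

theorem partialSum_biUnion (wt : HexDart → ℂ) (N : Sym2 (boxRegion x y z) → ℕ)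
    {ι : Type*} (s : Finset ι) (P : ι → Finset (Sym2 (boxRegion x y z)))
    (h : ∀ i ∈ s, ∀ j ∈ s, i ≠ j → ∀ e ∈ P i, ∀ e' ∈ P j, N e ≠ 0 → N e' ≠ 0 → ∀ v ∈ e, v ∉ e') :
    partialSum wt N (s.biUnion P) = ∏ i ∈ s, partialSum wt N (P i) := by
  induction s using Finset.induction_on with
  | empty =>
    rw [Finset.biUnion_empty, Finset.prod_empty]
    refine stateSum_zero _ _ fun δ => ?_
    by_cases hδ : δ ∈ boxDarts x y z
    · simp [dartMult_of_mem _ hδ, restrictEdges]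
    · exact dartMult_of_notMem _ hδ
  | insert i s hi ih =>
    rw [Finset.biUnion_insert, Finset.prod_insert hi, partialSum_union, ih]
    · intro j hj k hk
      exact h j (Finset.mem_insert_of_mem hj) k (Finset.mem_insert_of_mem hk)
    · intro e he e' he'
      obtain ⟨j, hj, he'⟩ := Finset.mem_biUnion.1 he'
      exact h i (Finset.mem_insert_self _ _) j (Finset.mem_insert_of_mem hj)
        (by rintro rfl; exact hi hj) e he e' he'

theorem partialSum_singleton {wt : HexDart → ℂ} {N : Sym2 (boxRegion x y z) → ℕ} {δ : HexDart}
    (hδ : δ ∈ boxDarts x y z) (h2 : N (boxDartEdge δ hδ) = 2) :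
    partialSum wt N {boxDartEdge δ hδ} = wt δ * wt δ.rev := by
  refine stateSum_doubled wt hδ (rev_mem_boxDarts.2 hδ) fun δ' => ?_
  by_cases hδ' : δ' ∈ boxDarts x y z
  · rw [dartMult_of_mem _ hδ', restrictEdges, Finset.mem_singleton, boxDartEdge_eq_iff]
    split_ifs with h
    · rw [(boxDartEdge_eq_iff hδ hδ').2 h, h2, ind_of h]
    · rw [ind_of_not h, zero_mul]
  · rw [dartMult_of_notMem _ hδ', if_neg]
    rintro (rfl | rfl)
    · exact hδ' hδ
    · exact hδ' (rev_mem_boxDarts.2 hδ)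

/-- The weighted sum over the dimer configurations over `N` is the contribution of `N`, if this
holds for single doubled edges and for single loops. -/
theorem stateSum_eq_contribution {wt : HexDart → ℂ} {w : Sym2 (boxRegion x y z) → ℂ}
    {Γ : SL2Connection (boxGraph x y z)} {N : Sym2 (boxRegion x y z) → ℕ}
    (hN : IsDoubleDimerConfig (boxGraph x y z) N)
    (hd : ∀ δ (hδ : δ ∈ boxDarts x y z), wt δ * wt δ.rev = w (boxDartEdge δ hδ) ^ 2)
    (hl : ∀ L, IsClosedLoop (boxGraph x y z) N L →
      partialSum wt N L = (∏ e ∈ L, w e) * Γ.loopTrace L) :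
    stateSum wt (boxDarts x y z) (dartMult N) = doubleDimerContribution w Γ N := by
  -- `X₁` is the disjoint union of the loops and `X₂` consists of the doubled edges; no two of these
  -- pieces share a vertex.
  obtain ⟨X₁, hX₁⟩ : ∃ X, X = Finset.univ.filter fun e => N e = 1 := ⟨_, rfl⟩
  obtain ⟨X₂, hX₂⟩ : ∃ X, X = Finset.univ.filter fun e => N e = 2 := ⟨_, rfl⟩
  obtain ⟨Λ, hΛ⟩ : ∃ Λ, Λ = Finset.univ.filter (IsClosedLoop (boxGraph x y z) N) := ⟨_, rfl⟩
  have hmemΛ : ∀ L, L ∈ Λ ↔ IsClosedLoop (boxGraph x y z) N L := by simp [hΛ]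
  have hloop1 : ∀ L ∈ Λ, ∀ e ∈ L, N e = 1 := by
    intro L hL e he
    obtain ⟨v, p, -, h1, rfl⟩ := (hmemΛ L).1 hL
    exact h1 e (by simpa using he)
  have hunion : Λ.biUnion id = X₁ := by
    ext e
    simp only [hX₁, Finset.mem_biUnion, id, Finset.mem_filter, Finset.mem_univ, true_and]
    constructor
    · rintro ⟨L, hL, he⟩
      exact hloop1 L hL e he
    · intro he
      obtain ⟨L, hL, he⟩ := hN.exists_closedLoop he
      exact ⟨L, (hmemΛ L).2 hL, he⟩
  have hdisj : ∀ L ∈ Λ, ∀ L' ∈ Λ, L ≠ L' → ∀ e ∈ L, ∀ e' ∈ L', ∀ v ∈ e, v ∉ e' := by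
    intro L hL L' hL' hne e he e' he' v hv hv'
    exact hne (hN.closedLoop_eq ((hmemΛ L).1 hL) ((hmemΛ L').1 hL') he he' hv hv')
  have h0 : stateSum wt (boxDarts x y z) (dartMult N) = partialSum wt N (X₁ ∪ X₂) := by
    rw [partialSum]
    congr 2
    funext e
    have := hN.le_two e
    simp only [restrictEdges, Finset.mem_union, hX₁, hX₂, Finset.mem_filter, Finset.mem_univ,
      true_and]
    by_cases h1 : N e = 1
    · rw [ind_of (Or.inl h1), one_mul]
    · by_cases h2 : N e = 2
      · rw [ind_of (Or.inr h2), one_mul]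
      · rw [ind_of_not (by simp [h1, h2]), zero_mul]
        omega
  have h1 : partialSum wt N X₁ = (∏ e ∈ X₁, w e) * ∏ L ∈ Λ, Γ.loopTrace L := by
    rw [← hunion, partialSum_biUnion, Finset.prod_biUnion, ← Finset.prod_mul_distrib]
    · exact Finset.prod_congr rfl fun L hL => hl L ((hmemΛ L).1 hL)
    · intro L hL L' hL' hne
      refine Finset.disjoint_left.2 fun e he he' => ?_
      induction e using Sym2.ind with
      | h a b =>
        exact hdisj L hL L' hL' hne _ he _ he' a (by simp) (by simp)
    · intro L hL L' hL' hne e he e' he' _ _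
      exact hdisj L hL L' hL' hne e he e' he'
  have h2 : partialSum wt N X₂ = ∏ e ∈ X₂, w e ^ 2 := by
    have hb : X₂.biUnion (fun e => {e}) = X₂ := Finset.biUnion_singleton_eq_self
    conv_lhs => rw [← hb]
    rw [partialSum_biUnion]
    · refine Finset.prod_congr rfl fun e he => ?_
      have he2 : N e = 2 := by
        rw [hX₂] at he
        exact (Finset.mem_filter.1 he).2
      have hE : e ∈ (boxGraph x y z).edgeSet := by
        by_contra h
        rw [hN.1 e h] at he2
        omega
      induction e using Sym2.ind with
      | h a b =>
        obtain ⟨d, hδ, h⟩ := exists_eq_boxDartEdge hE (Sym2.mem_mk_left a b)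
        rw [h] at he2 ⊢
        rw [partialSum_singleton hδ he2, hd]
    · intro e he e' he' hne f hf f' hf' _ hf0 v hv hv'
      rw [Finset.mem_singleton] at hf hf'
      subst hf hf'
      rw [hX₂] at he
      exact hne (hN.eq_of_eq_two hv hv' (Finset.mem_filter.1 he).2 hf0)
  rw [h0, partialSum_union, h1, h2, doubleDimerContribution_eq]
  · have h3 : ∏ e, w e ^ N e = (∏ e ∈ X₁, w e) * ∏ e ∈ X₂, w e ^ 2 := by
      rw [hX₁, hX₂, Finset.prod_filter, Finset.prod_filter, ← Finset.prod_mul_distrib]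
      refine Finset.prod_congr rfl fun e _ => ?_
      have hle := hN.le_two e
      have : N e = 0 ∨ N e = 1 ∨ N e = 2 := by omega
      rcases this with h | h | h <;> simp [h]
    rw [h3, hΛ]
    ring
  · intro e he e' he' h1 h2 v hv hv'
    rw [hX₁] at he
    rw [hX₂] at he'
    have he := (Finset.mem_filter.1 he).2
    have he' := (Finset.mem_filter.1 he').2
    rw [hN.eq_of_eq_two hv' hv he' h1] at he'
    omega

end Factorization

/-! ## Transfer matrices along a cycle -/

/-- The product `M (n - 1) * ⋯ * M 0`. -/
def orderedProd {R : Type*} [Monoid R] (M : ℕ → R) : ℕ → R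
  | 0 => 1
  | n + 1 => M n * orderedProd M n

theorem orderedProd_succ' {R : Type*} [Monoid R] (M : ℕ → R) (n : ℕ) :
    orderedProd M (n + 1) = orderedProd (fun i => M (i + 1)) n * M 0 := by
  induction n with
  | zero => simp [orderedProd]
  | succ n ih => rw [orderedProd, ih, orderedProd, mul_assoc]

/-- The arbitrary function `g` of the last state is what the induction needs: removing the last step
turns `g` into a row of the last matrix. -/
theorem sum_prod_eq_orderedProd {ι : Type*} [Fintype ι] [DecidableEq ι] (M : ℕ → Matrix ι ι ℂ)
    (b : ι) (n : ℕ) (g : ι → ℂ) :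
    ∑ σ : Fin (n + 1) → ι, (if σ 0 = b then 1 else 0) *
      (∏ i : Fin n, M i (σ i.succ) (σ i.castSucc)) * g (σ (Fin.last n)) =
    ∑ a, g a * orderedProd M n a b := by
  induction n generalizing g with
  | zero =>
    rw [← (Equiv.funUnique (Fin 1) ι).symm.sum_comp]
    simp [orderedProd, Matrix.one_apply, mul_comm]
  | succ n ih =>
    rw [← (Fin.snocEquiv fun _ : Fin (n + 1 + 1) => ι).sum_comp, Fintype.sum_prod_type]
    refine Finset.sum_congr rfl fun s _ => ?_
    have h := ih (fun a => M n s a)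
    rw [orderedProd, Matrix.mul_apply, ← h, Finset.mul_sum]
    refine Finset.sum_congr rfl fun σ _ => ?_
    have e0 : (Fin.snocEquiv fun _ : Fin (n + 1 + 1) => ι) (s, σ) 0 = σ 0 := by
      change Fin.snoc (α := fun _ => ι) σ s 0 = σ 0
      rw [← Fin.castSucc_zero]
      exact Fin.snoc_castSucc (α := fun _ => ι) s σ 0
    have e1 : ∀ i : Fin (n + 1), (Fin.snocEquiv fun _ : Fin (n + 1 + 1) => ι) (s, σ) i.castSucc =
        σ i := fun i => Fin.snoc_castSucc (α := fun _ => ι) s σ i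
    have e2 : (Fin.snocEquiv fun _ : Fin (n + 1 + 1) => ι) (s, σ) (Fin.last (n + 1)) = s :=
      Fin.snoc_last (α := fun _ => ι) s σ
    rw [Fin.prod_univ_castSucc, e0, e2, e1, Fin.succ_last, e2]
    simp only [← Fin.castSucc_succ, e1]
    simp only [Fin.val_castSucc, Fin.val_last]
    ring

/-- The trace of a product of matrices as a sum over cyclic sequences of states. -/
theorem trace_orderedProd {ι : Type*} [Fintype ι] [DecidableEq ι] (M : ℕ → Matrix ι ι ℂ) (k : ℕ) :
    (orderedProd M (k + 1)).trace =
      ∑ σ : Fin (k + 1) → ι, ∏ i : Fin (k + 1), M i (σ (i + 1)) (σ i) := by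
  have h : ∀ σ : Fin (k + 1) → ι, ∏ i : Fin (k + 1), M i (σ (i + 1)) (σ i) =
      ∑ b, (if σ 0 = b then 1 else 0) * (∏ i : Fin k, M i (σ i.succ) (σ i.castSucc)) *
        M k b (σ (Fin.last k)) := by
    intro σ
    rw [Fin.prod_univ_castSucc, Fin.last_add_one]
    simp [Fin.coeSucc_eq_succ]
  rw [Finset.sum_congr rfl fun σ _ => h σ, Finset.sum_comm, Matrix.trace]
  refine Finset.sum_congr rfl fun b _ => ?_
  rw [sum_prod_eq_orderedProd M b k fun a => M k b a, Matrix.diag_apply, orderedProd,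
    Matrix.mul_apply]

/-! ### Left and right states along a loop -/

/-- A closed path of at least three steps in the honeycomb graph without repeated vertices. -/
structure IsHexCycle {k : ℕ} (δ : Fin (k + 1) → HexDart) : Prop where
  next : ∀ i, (δ (i + 1)).1 = (δ i).1.nbr (δ i).2
  inj : Function.Injective fun i => (δ i).1
  two : ∀ i : Fin (k + 1), i + 1 + 1 ≠ i

/-- The transfer matrix of the turn between steps of directions `d` and `d'`. -/
noncomputable def turnMatrix (d d' : EdgeDir) : Matrix (Fin 2) (Fin 2) ℂ :=
  if d' = d.rot then turnL else turnR

/-- A dart (for state `0`) or its reverse (for state `1`). -/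
def stateDart (δ : HexDart) (s : Fin 2) : HexDart := if s = 0 then δ else δ.rev

@[simp] theorem stateDart_zero (δ : HexDart) : stateDart δ 0 = δ := rfl
@[simp] theorem stateDart_one (δ : HexDart) : stateDart δ 1 = δ.rev := rfl

section

variable {k : ℕ} {δ : Fin (k + 1) → HexDart}

theorem IsHexCycle.rev_fst (hδ : IsHexCycle δ) (i : Fin (k + 1)) : (δ i).rev.1 = (δ (i + 1)).1 :=
  (hδ.next i).symm

theorem IsHexCycle.dir_ne (hδ : IsHexCycle δ) (i : Fin (k + 1)) : (δ (i + 1)).2 ≠ (δ i).2 := by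
  intro h
  apply hδ.two i
  apply hδ.inj
  change (δ (i + 1 + 1)).1 = (δ i).1
  rw [hδ.next, hδ.next, h, HexVertex.nbr_nbr]

theorem IsHexCycle.dir_eq (hδ : IsHexCycle δ) {i : Fin (k + 1)} (h : (δ (i + 1)).2 ≠ (δ i).2.rot) :
    (δ (i + 1)).2.rot = (δ i).2 := by
  have h1 := hδ.dir_ne i
  revert h h1
  generalize (δ (i + 1)).2 = d'
  generalize (δ i).2 = d
  cases d <;> cases d' <;> simp [EdgeDir.rot]

/-- Distinct vertices separate the darts from each other; a dart equal to the reverse of another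
would close the path after two steps, which `two` excludes. -/
theorem IsHexCycle.stateDart_injective (hδ : IsHexCycle δ) {i j : Fin (k + 1)} {s t : Fin 2}
    (h : stateDart (δ i) s = stateDart (δ j) t) : i = j ∧ s = t := by
  have key : ∀ i j, δ i ≠ (δ j).rev := by
    intro i j h
    have h1 : i = j + 1 := hδ.inj (by
      change (δ i).1 = (δ (j + 1)).1
      rw [h, hδ.rev_fst])
    have h2 : (δ i).rev = δ j := by rw [h, HexDart.rev_rev]
    have h3 : i + 1 = j := hδ.inj (by
      change (δ (i + 1)).1 = (δ j).1
      rw [← hδ.rev_fst, h2])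
    exact hδ.two j (by rw [← h1, h3])
  have key2 : ∀ i j, δ i = δ j → i = j := fun i j h => hδ.inj (congrArg Prod.fst h)
  fin_cases s <;> fin_cases t
  · exact ⟨key2 i j h, rfl⟩
  · exact absurd h (key i j)
  · exact absurd h.symm (key j i)
  · refine ⟨key2 i j ?_, rfl⟩
    rw [← (δ i).rev_rev, ← (δ j).rev_rev]
    exact congrArg HexDart.rev h

/-- The darts selected by a sequence of states. -/
noncomputable def stateDarts (δ : Fin (k + 1) → HexDart) (σ : Fin (k + 1) → Fin 2) :
    Finset HexDart :=
  Finset.univ.image fun i => stateDart (δ i) (σ i)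

theorem IsHexCycle.stateDart_mem (hδ : IsHexCycle δ) {σ : Fin (k + 1) → Fin 2} {i : Fin (k + 1)}
    {s : Fin 2} : stateDart (δ i) s ∈ stateDarts δ σ ↔ σ i = s := by
  simp only [stateDarts, Finset.mem_image, Finset.mem_univ, true_and]
  constructor
  · rintro ⟨j, h⟩
    obtain ⟨rfl, rfl⟩ := hδ.stateDart_injective h
    rfl
  · rintro rfl
    exact ⟨i, rfl⟩

/-- `turnL` and `turnR` are zero-one matrices whose single zero sits at `(0,0)`, respectively
`(1,1)`: the state pair forbidden at such a turn. -/
theorem prod_turnMatrix_eq (δ : Fin (k + 1) → HexDart) (σ : Fin (k + 1) → Fin 2) :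
    ∏ i, turnMatrix (δ i).2 (δ (i + 1)).2 (σ (i + 1)) (σ i) =
      if ∀ i, (if (δ (i + 1)).2 = (δ i).2.rot then ¬ (σ i = 0 ∧ σ (i + 1) = 0)
        else ¬ (σ i = 1 ∧ σ (i + 1) = 1)) then 1 else 0 := by
  have h1 : ∀ i, turnMatrix (δ i).2 (δ (i + 1)).2 (σ (i + 1)) (σ i) =
      if (if (δ (i + 1)).2 = (δ i).2.rot then ¬ (σ i = 0 ∧ σ (i + 1) = 0)
        else ¬ (σ i = 1 ∧ σ (i + 1) = 1)) then 1 else 0 := by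
    intro i
    rw [turnMatrix]
    generalize σ i = s
    generalize σ (i + 1) = t
    split_ifs with h2 h3 h3 <;> fin_cases s <;> fin_cases t <;> simp [turnL, turnR] at h3 ⊢
  rw [Finset.prod_congr rfl fun i _ => h1 i]
  split_ifs with h
  · exact Finset.prod_eq_one fun i _ => if_pos (h i)
  · obtain ⟨i, hi⟩ := not_forall.1 h
    exact Finset.prod_eq_zero (Finset.mem_univ i) (if_neg hi)

/-- At a left turn the two forward darts follow each other by a left turn; at a right turn the two
reversed darts do. Mixed states never conflict, since they would require `d.rot = d`. -/
theorem IsHexCycle.stateDarts_left (hδ : IsHexCycle δ) (σ : Fin (k + 1) → Fin 2) :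
    (∀ δ' ∈ stateDarts δ σ, δ'.left ∉ stateDarts δ σ) ↔
      ∀ i, (if (δ (i + 1)).2 = (δ i).2.rot then ¬ (σ i = 0 ∧ σ (i + 1) = 0)
        else ¬ (σ i = 1 ∧ σ (i + 1) = 1)) := by
  constructor
  · intro h i
    split_ifs with hd
    · rintro ⟨h0, h1⟩
      have hl : (δ i).left = δ (i + 1) := Prod.ext (hδ.next i).symm hd.symm
      refine h (δ i) ((hδ.stateDart_mem (s := 0)).2 h0) ?_
      rw [hl]
      exact (hδ.stateDart_mem (s := 0)).2 h1
    · rintro ⟨h0, h1⟩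
      have hl : (δ (i + 1)).rev.left = (δ i).rev := by
        rw [HexDart.left_rev, hδ.dir_eq hd, hδ.next]
        rfl
      refine h (δ (i + 1)).rev ((hδ.stateDart_mem (s := 1)).2 h1) ?_
      rw [hl]
      exact (hδ.stateDart_mem (s := 1)).2 h0
  · intro h δ' h1 h2
    simp only [stateDarts, Finset.mem_image, Finset.mem_univ, true_and] at h1 h2
    obtain ⟨i, rfl⟩ := h1
    obtain ⟨j, hj⟩ := h2
    have hi : σ i = 0 ∨ σ i = 1 := by omega
    have hj' : σ j = 0 ∨ σ j = 1 := by omega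
    have f := congrArg Prod.fst hj
    have g := congrArg Prod.snd hj
    rcases hi with hi | hi <;> rcases hj' with hj' | hj' <;>
      simp only [hi, hj', stateDart_zero, stateDart_one, HexDart.left_fst, HexDart.left_snd,
        HexDart.rev_fst, HexDart.rev_snd, HexVertex.nbr_nbr] at f g
    · rw [← hδ.next] at f
      have hji := hδ.inj f
      subst hji
      have := h i
      rw [if_pos g] at this
      exact this ⟨hi, hj'⟩
    · rw [← hδ.next, ← hδ.next] at f
      have hji : j = i := add_right_cancel (hδ.inj f)
      subst hji
      exact (δ j).2.rot_ne g.symm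
    · have hji := hδ.inj f
      subst hji
      exact (δ j).2.rot_ne g.symm
    · rw [← hδ.next] at f
      have hji := hδ.inj f
      subst hji
      have := h j
      rw [if_neg] at this
      · exact this ⟨hj', hi⟩
      · intro h'
        rw [h'] at g
        exact (δ j).2.rot_rot_ne g.symm

/-- The sum over the admissible sets of darts over a cycle as a sum over sequences of states. -/
theorem IsHexCycle.stateSum_eq (hδ : IsHexCycle δ) (wt : HexDart → ℂ) {D : Finset HexDart}
    {N : HexDart → ℕ} (hD : ∀ i, δ i ∈ D ∧ (δ i).rev ∈ D)
    (hN : ∀ i, N (δ i) = 1 ∧ N (δ i).rev = 1)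
    (hN' : ∀ δ', N δ' ≠ 0 → ∃ i, δ' = δ i ∨ δ' = (δ i).rev) :
    stateSum wt D N = ∑ σ : Fin (k + 1) → Fin 2,
      ∏ i, turnMatrix (δ i).2 (δ (i + 1)).2 (σ (i + 1)) (σ i) * wt (stateDart (δ i) (σ i)) := by
  simp only [Finset.prod_mul_distrib, prod_turnMatrix_eq, ← hδ.stateDarts_left, ite_mul, one_mul,
    zero_mul]
  rw [← Finset.sum_filter, stateSum]
  symm
  refine Finset.sum_bij (fun σ _ => stateDarts δ σ) ?_ ?_ ?_ ?_
  · intro σ hσ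
    refine mem_admissible.2 ⟨?_, ?_, (Finset.mem_filter.1 hσ).2⟩
    · intro δ' h
      simp only [stateDarts, Finset.mem_image, Finset.mem_univ, true_and] at h
      obtain ⟨i, rfl⟩ := h
      have hi : σ i = 0 ∨ σ i = 1 := by omega
      rcases hi with hi | hi <;> rw [hi]
      · exact (hD i).1
      · exact (hD i).2
    · intro δ' hδ'
      have hcase : ∀ i, ind (δ i ∈ stateDarts δ σ) + ind ((δ i).rev ∈ stateDarts δ σ) = 1 := by
        intro i
        have a0 : δ i ∈ stateDarts δ σ ↔ σ i = 0 := hδ.stateDart_mem (s := 0)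
        have a1 : (δ i).rev ∈ stateDarts δ σ ↔ σ i = 1 := hδ.stateDart_mem (s := 1)
        rw [a0, a1]
        have hi : σ i = 0 ∨ σ i = 1 := by omega
        rcases hi with hi | hi <;> simp [hi]
      by_cases h0 : N δ' = 0
      · have a0 : δ' ∉ stateDarts δ σ := by
          intro h
          simp only [stateDarts, Finset.mem_image, Finset.mem_univ, true_and] at h
          obtain ⟨i, rfl⟩ := h
          have hi : σ i = 0 ∨ σ i = 1 := by omega
          rcases hi with hi | hi <;> rw [hi] at h0
          · exact one_ne_zero ((hN i).1.symm.trans h0)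
          · exact one_ne_zero ((hN i).2.symm.trans h0)
        have a1 : δ'.rev ∉ stateDarts δ σ := by
          intro h
          simp only [stateDarts, Finset.mem_image, Finset.mem_univ, true_and] at h
          obtain ⟨i, h⟩ := h
          have h' := congrArg HexDart.rev h
          rw [HexDart.rev_rev] at h'
          subst h'
          have hi : σ i = 0 ∨ σ i = 1 := by omega
          rcases hi with hi | hi <;> rw [hi] at h0
          · exact one_ne_zero ((hN i).2.symm.trans h0)
          · rw [stateDart_one, HexDart.rev_rev] at h0
            exact one_ne_zero ((hN i).1.symm.trans h0)
        rw [h0, ind_of_not a0, ind_of_not a1]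
      · obtain ⟨i, rfl | rfl⟩ := hN' δ' h0
        · rw [hcase, (hN i).1]
        · rw [HexDart.rev_rev, add_comm, hcase, (hN i).2]
  · intro σ _ τ _ h
    funext i
    have : stateDart (δ i) (σ i) ∈ stateDarts δ σ := hδ.stateDart_mem.2 rfl
    rw [h] at this
    exact (hδ.stateDart_mem.1 this).symm
  · intro S hS
    obtain ⟨a1, a2, a3⟩ := mem_admissible.1 hS
    have hS' : stateDarts δ (fun i => if δ i ∈ S then 0 else 1) = S := by
      ext δ'
      have hrev : ∀ i, (δ i).rev ∈ S ↔ δ i ∉ S := by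
        intro i
        have := a2 _ (hD i).1
        rw [(hN i).1] at this
        by_cases h : δ i ∈ S
        · rw [ind_of h] at this
          have : (δ i).rev ∉ S := ind_eq_zero.1 (by omega)
          simp [h, this]
        · rw [ind_of_not h] at this
          have : (δ i).rev ∈ S := ind_eq_one.1 (by omega)
          simp [h, this]
      constructor
      · intro h
        simp only [stateDarts, Finset.mem_image, Finset.mem_univ, true_and] at h
        obtain ⟨i, rfl⟩ := h
        split_ifs with h
        · exact h
        · exact (hrev i).2 h
      · intro h
        obtain ⟨i, rfl | rfl⟩ := hN' δ' (ne_zero_of_mem_admissible hS h)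
        · exact (hδ.stateDart_mem (s := 0)).2 (if_pos h)
        · exact (hδ.stateDart_mem (s := 1)).2 (if_neg ((hrev i).1 h))
    refine ⟨fun i => if δ i ∈ S then 0 else 1, ?_, hS'⟩
    rw [Finset.mem_filter, hS']
    exact ⟨Finset.mem_univ _, a3⟩
  · intro σ _
    rw [stateDarts, Finset.prod_image]
    intro i _ j _ h
    exact (hδ.stateDart_injective h).1

end

/-! ## The sign of a loop -/

namespace HexVertex

/-- The parity of the colour of a vertex. -/
def color : HexVertex → ZMod 2
  | .black _ _ => 0
  | .white _ _ => 1

theorem color_nbr (v : HexVertex) (d : EdgeDir) : (v.nbr d).color = v.color + 1 := by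
  cases v <;> cases d <;> simp only [nbr, color] <;> decide

/-- The sign of the colour of a vertex. -/
def colorSign : HexVertex → ℤ
  | .black _ _ => 1
  | .white _ _ => -1

theorem colorSign_nbr (v : HexVertex) (d : EdgeDir) : (v.nbr d).colorSign = -v.colorSign := by
  cases v <;> cases d <;> simp [nbr, colorSign]

/-- The hexagon of which a vertex is an end of the bottom edge. -/
def base : HexVertex → ℤ × ℤ
  | .black u v => (u, v)
  | .white u v => (u, v)

theorem base_nbr_horizontal (v : HexVertex) : (v.nbr .horizontal).base = v.base := by
  cases v <;> rfl

end HexVertex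

namespace HexDart

/-- The hexagon on the left of a dart. -/
def leftFace : HexDart → ℤ × ℤ
  | (.black u v, .horizontal) => (u, v)
  | (.black u v, .nwse) => (u + 1, v)
  | (.black u v, .nesw) => (u + 1, v + 1)
  | (.white u v, .horizontal) => (u + 1, v + 1)
  | (.white u v, .nwse) => (u, v + 1)
  | (.white u v, .nesw) => (u, v)

theorem leftFace_left (δ : HexDart) : δ.left.leftFace = δ.leftFace := by
  rcases δ with ⟨⟨u, v⟩ | ⟨u, v⟩, _ | _ | _⟩ <;>
    simp [left, leftFace, HexVertex.nbr, EdgeDir.rot]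

end HexDart

/-- A function on the hexagons with values in `ZMod 2` that jumps by `ℓ` across the edges: the sum
of `ℓ` over the horizontal edges below. -/
noncomputable def crossingNumber (X : ℤ) (ℓ : HexDart → ZMod 2) (f : ℤ × ℤ) : ZMod 2 :=
  ∑ j ∈ Finset.range (X - f.1).toNat, ℓ (.black (f.1 + j) (f.2 + j), .horizontal)

section

variable {X : ℤ} {ℓ : HexDart → ZMod 2}

theorem crossingNumber_of_le {f : ℤ × ℤ} (h : X ≤ f.1) : crossingNumber X ℓ f = 0 := by
  rw [crossingNumber, Int.toNat_of_nonpos (by omega)]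
  simp

theorem crossingNumber_horizontal (hX : ∀ u v d, X ≤ u → ℓ (.black u v, d) = 0) (u v : ℤ) :
    crossingNumber X ℓ (u, v) =
      ℓ (.black u v, .horizontal) + crossingNumber X ℓ (u + 1, v + 1) := by
  by_cases h : X ≤ u
  · rw [crossingNumber_of_le h, crossingNumber_of_le (f := (u + 1, v + 1)) (by simp; omega),
      hX u v _ h, add_zero]
  · have h1 : (X - u).toNat = (X - (u + 1)).toNat + 1 := by omega
    simp only [crossingNumber]
    rw [h1, Finset.sum_range_succ']
    rw [add_comm]
    congr 1
    · simp
    · refine Finset.sum_congr rfl fun j _ => ?_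
      congr 3 <;> push_cast <;> ring

/-- The crossing number is built from horizontal edges alone. That it also jumps correctly across
the slanted edges follows from the even degree at the vertices, by induction from the region `X ≤
u`, where everything vanishes. -/
theorem crossingNumber_zigzag (hX : ∀ u v d, X ≤ u → ℓ (.black u v, d) = 0)
    (hr : ∀ δ : HexDart, ℓ δ.rev = ℓ δ) (hs : ∀ v, ∑ d, ℓ (v, d) = 0) (n : ℕ) :
    ∀ u v, X ≤ u + n → crossingNumber X ℓ (u, v) + crossingNumber X ℓ (u + 1, v) =
        ℓ (.black u v, .nwse) ∧
      crossingNumber X ℓ (u + 1, v) + crossingNumber X ℓ (u + 1, v + 1) =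
        ℓ (.black u v, .nesw) := by
  induction n with
  | zero =>
    intro u v h
    simp only [Nat.cast_zero, add_zero] at h
    rw [crossingNumber_of_le h, crossingNumber_of_le (f := (u + 1, v)) (by simp; omega),
      crossingNumber_of_le (f := (u + 1, v + 1)) (by simp; omega), hX u v _ h, hX u v _ h]
    simp
  | succ n ih =>
    intro u v h
    push_cast at h
    have h1 := (ih (u + 1) (v + 1) (by omega)).1
    have h2 := crossingNumber_horizontal hX (u + 1) v
    have h3 := crossingNumber_horizontal hX u v
    have h4 := hs (.white (u + 1) v)
    have h5 := hs (.black u v)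
    have r1 := hr (.black u v, .nesw)
    have r2 := hr (.black (u + 1) (v + 1), .nwse)
    have r3 := hr (.black (u + 1) v, .horizontal)
    rw [EdgeDir.sum_eq] at h4 h5
    simp only [HexDart.rev, HexVertex.nbr, add_sub_cancel_right] at r1 r2 r3
    rw [r1, r2, r3] at h4
    generalize crossingNumber X ℓ (u, v) = a1 at *
    generalize crossingNumber X ℓ (u + 1, v) = a2 at *
    generalize crossingNumber X ℓ (u + 1, v + 1) = a3 at *
    generalize crossingNumber X ℓ (u + 1 + 1, v + 1) = a4 at *
    generalize ℓ (.black u v, .horizontal) = b1 at *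
    generalize ℓ (.black u v, .nwse) = b2 at *
    generalize ℓ (.black u v, .nesw) = b3 at *
    generalize ℓ (.black (u + 1) (v + 1), .nwse) = b4 at *
    generalize ℓ (.black (u + 1) v, .horizontal) = b5 at *
    clear r1 r2 r3 ih
    -- Compare the hexagons `(u+1,v)` and `(u+1,v+1)` by going around `white (u+1) v` through
    -- `(u+2,v+1)`; the values of `ℓ` at this vertex sum to zero. Going around `black u v` then
    -- gives the other edge.
    have key : a2 + a3 = b3 := by
      subst h2 h1
      have two : ∀ t : ZMod 2, t + t = 0 := by decide
      linear_combination h4 - two b3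
    refine ⟨?_, key⟩
    have two : ∀ t : ZMod 2, t + t = 0 := by decide
    subst h3
    linear_combination h5 + key - two b2

/-- The uniform jump rule: the left hexagons of `(v, d)` and `(v, d.rot.rot)` are separated by the
edge `(v, d.rot.rot)`. -/
theorem crossingNumber_leftFace (hX : ∀ u v d, X ≤ u → ℓ (.black u v, d) = 0)
    (hr : ∀ δ : HexDart, ℓ δ.rev = ℓ δ) (hs : ∀ v, ∑ d, ℓ (v, d) = 0) (v : HexVertex) (d : EdgeDir) :
    crossingNumber X ℓ (HexDart.leftFace (v, d.rot.rot)) =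
      crossingNumber X ℓ (HexDart.leftFace (v, d)) + ℓ (v, d.rot.rot) := by
  have two : ∀ t : ZMod 2, t + t = 0 := by decide
  have hz : ∀ u v, crossingNumber X ℓ (u, v) + crossingNumber X ℓ (u + 1, v) =
        ℓ (.black u v, .nwse) ∧
      crossingNumber X ℓ (u + 1, v) + crossingNumber X ℓ (u + 1, v + 1) =
        ℓ (.black u v, .nesw) := fun u v =>
    crossingNumber_zigzag hX hr hs (X - u).toNat u v (by omega)
  have hh := crossingNumber_horizontal hX
  rcases v with ⟨u, v⟩ | ⟨u, v⟩ <;> cases d <;> simp only [HexDart.leftFace, EdgeDir.rot]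
  · linear_combination (hz u v).1 - two (crossingNumber X ℓ (u, v))
  · linear_combination (hz u v).2 - two (crossingNumber X ℓ (u + 1, v))
  · linear_combination hh u v
  · have := hr (.black u (v + 1), .nwse)
    simp only [HexDart.rev, HexVertex.nbr, add_sub_cancel_right] at this
    rw [this]
    linear_combination (hz u (v + 1)).1 - two (crossingNumber X ℓ (u + 1, v + 1))
  · have := hr (.black (u - 1) v, .nesw)
    simp only [HexDart.rev, HexVertex.nbr, sub_add_cancel] at this
    rw [this]
    have := (hz (u - 1) v).2
    rw [sub_add_cancel] at this
    linear_combination this - two (crossingNumber X ℓ (u, v + 1))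
  · have := hr (.black u v, .horizontal)
    simp only [HexDart.rev, HexVertex.nbr] at this
    rw [this]
    linear_combination - hh u v - two (ℓ (.black u v, .horizontal))

theorem crossingNumber_base (hX : ∀ u v d, X ≤ u → ℓ (.black u v, d) = 0) {v : HexVertex}
    (hv : ℓ (v, .horizontal) = 0) :
    crossingNumber X ℓ v.base = crossingNumber X ℓ (HexDart.leftFace (v, .nesw)) := by
  rcases v with ⟨u, v⟩ | ⟨u, v⟩
  · simp only [HexVertex.base, HexDart.leftFace]
    rw [crossingNumber_horizontal hX, hv, zero_add]
  · rfl

end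

/-! ### Parity of the right turns that avoid horizontal edges -/

section

variable {k : ℕ} {δ : Fin (k + 1) → HexDart}

/-- The indicator function of the edges of a cycle. -/
noncomputable def cycleInd (δ : Fin (k + 1) → HexDart) (δ' : HexDart) : ZMod 2 :=
  if ∃ i, δ' = δ i ∨ δ' = (δ i).rev then 1 else 0

theorem cycleInd_rev (δ : Fin (k + 1) → HexDart) (δ' : HexDart) :
    cycleInd δ δ'.rev = cycleInd δ δ' := by
  have : (∃ i, δ'.rev = δ i ∨ δ'.rev = (δ i).rev) ↔ ∃ i, δ' = δ i ∨ δ' = (δ i).rev := by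
    refine exists_congr fun i => ?_
    constructor
    · rintro (h | h)
      · exact Or.inr (by rw [← h, HexDart.rev_rev])
      · exact Or.inl (by rw [← δ'.rev_rev, h, HexDart.rev_rev])
    · rintro (rfl | rfl)
      · exact Or.inr rfl
      · exact Or.inl (HexDart.rev_rev _)
  simp only [cycleInd, this]

theorem IsHexCycle.cycleInd_eq (hδ : IsHexCycle δ) (i : Fin (k + 1)) (d : EdgeDir) :
    cycleInd δ ((δ (i + 1)).1, d) = if d = (δ i).2 ∨ d = (δ (i + 1)).2 then 1 else 0 := by
  rw [cycleInd]
  congr 1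
  rw [eq_iff_iff]
  constructor
  · rintro ⟨j, h | h⟩
    · have h1 : i + 1 = j := hδ.inj (congrArg Prod.fst h :)
      rw [h1]
      exact Or.inr (congrArg Prod.snd h)
    · have h1 := congrArg Prod.fst h
      rw [hδ.rev_fst] at h1
      have h1 := add_right_cancel (hδ.inj h1)
      rw [h1]
      exact Or.inl (congrArg Prod.snd h)
  · rintro (rfl | rfl)
    · exact ⟨i, Or.inr (Prod.ext (hδ.rev_fst i).symm rfl)⟩
    · exact ⟨i + 1, Or.inl rfl⟩

theorem IsHexCycle.cycleInd_eq_zero (hδ : IsHexCycle δ) {v : HexVertex} (hv : ∀ i, (δ i).1 ≠ v)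
    (d : EdgeDir) : cycleInd δ (v, d) = 0 := by
  refine if_neg ?_
  rintro ⟨i, h | h⟩
  · exact hv i (congrArg Prod.fst h).symm
  · exact hv (i + 1) ((hδ.rev_fst i).symm.trans (congrArg Prod.fst h).symm)

theorem IsHexCycle.sum_cycleInd (hδ : IsHexCycle δ) (v : HexVertex) :
    ∑ d, cycleInd δ (v, d) = 0 := by
  by_cases hv : ∃ i, (δ i).1 = v
  · obtain ⟨i, rfl⟩ := hv
    have := hδ.cycleInd_eq (i - 1)
    have hne := hδ.dir_ne (i - 1)
    rw [sub_add_cancel] at this hne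
    simp only [this, EdgeDir.sum_eq]
    revert hne
    generalize (δ i).2 = d'
    generalize (δ (i - 1)).2 = d
    cases d <;> cases d' <;> simp <;> decide
  · rw [not_exists] at hv
    exact Finset.sum_eq_zero fun d _ => hδ.cycleInd_eq_zero hv d

/-- At a left turn the hexagon on the left stays the same. At a right turn the old and the new one
are joined around the vertex by crossing both loop edges, and the two jumps cancel. -/
theorem IsHexCycle.leftFace_const (hδ : IsHexCycle δ) {X : ℤ}
    (hX : ∀ u v d, X ≤ u → cycleInd δ (.black u v, d) = 0) (i : Fin (k + 1)) :
    crossingNumber X (cycleInd δ) (δ (i + 1)).leftFace =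
      crossingNumber X (cycleInd δ) (δ i).leftFace := by
  by_cases h : (δ (i + 1)).2 = (δ i).2.rot
  · have hl : (δ i).left = δ (i + 1) := Prod.ext (hδ.next i).symm h.symm
    rw [← hl, HexDart.leftFace_left]
  · have h' := hδ.dir_eq h
    have hc := crossingNumber_leftFace hX (cycleInd_rev δ) hδ.sum_cycleInd (δ (i + 1)).1
    have hl : (δ i).left = ((δ (i + 1)).1, (δ i).2.rot) := Prod.ext (hδ.next i).symm rfl
    have h1 := hc (δ i).2.rot
    have h2 := hc (δ i).2
    rw [EdgeDir.rot_rot_rot, ← hl, HexDart.leftFace_left, hδ.cycleInd_eq,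
      if_pos (Or.inl rfl)] at h1
    have h3 : (δ i).2.rot.rot = (δ (i + 1)).2 := by rw [← h', EdgeDir.rot_rot_rot]
    rw [h3, h1, hδ.cycleInd_eq, if_pos (Or.inr rfl)] at h2
    rw [show δ (i + 1) = ((δ (i + 1)).1, (δ (i + 1)).2) from rfl, h2, add_assoc]
    have : (1 + 1 : ZMod 2) = 0 := by decide
    rw [this, add_zero]

theorem IsHexCycle.leftFace_eq (hδ : IsHexCycle δ) {X : ℤ}
    (hX : ∀ u v d, X ≤ u → cycleInd δ (.black u v, d) = 0) (i : Fin (k + 1)) :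
    crossingNumber X (cycleInd δ) (δ i).leftFace =
      crossingNumber X (cycleInd δ) (δ 0).leftFace := by
  induction i using Fin.induction with
  | zero => rfl
  | succ i ih => rw [← Fin.coeSucc_eq_succ, hδ.leftFace_const hX, ih]

/-- The indicator function of a proposition, with values in `ZMod 2`. -/
noncomputable def indTwo (P : Prop) : ZMod 2 := if P then 1 else 0

/-- The first factor selects the vertices without horizontal loop edge. There the hexagons above and
below the missing horizontal edge lie on the same side of the loop: on the left if the turn is to
the right, on the right if it is to the left. The second factor tests whether `base` has the
crossing number of the left side. -/
theorem IsHexCycle.indTwo_right_turn (hδ : IsHexCycle δ) {X : ℤ}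
    (hX : ∀ u v d, X ≤ u → cycleInd δ (.black u v, d) = 0) (i : Fin (k + 1)) :
    indTwo ((δ i).2 = .nwse ∧ (δ (i + 1)).2 = .nesw) =
      (1 + (indTwo ((δ i).2 = .horizontal) + indTwo ((δ (i + 1)).2 = .horizontal))) *
        (crossingNumber X (cycleInd δ) (δ (i + 1)).1.base +
          (crossingNumber X (cycleInd δ) (δ 0).leftFace + 1)) := by
  have two : ∀ t : ZMod 2, t + t = 0 := by decide
  have hne := hδ.dir_ne i
  have hε := hδ.leftFace_eq hX (i + 1)
  have hi := hδ.cycleInd_eq i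
  have hc := crossingNumber_leftFace hX (cycleInd_rev δ) hδ.sum_cycleInd (δ (i + 1)).1 .nwse
  have hb : cycleInd δ ((δ (i + 1)).1, .horizontal) = 0 → _ := crossingNumber_base hX
  rw [show δ (i + 1) = ((δ (i + 1)).1, (δ (i + 1)).2) from rfl] at hε
  simp only [hi, EdgeDir.rot] at hb hc
  generalize crossingNumber X (cycleInd δ) (δ 0).leftFace = ε at *
  generalize (δ (i + 1)).1 = v at *
  generalize (δ (i + 1)).2 = d' at *
  generalize (δ i).2 = d at *
  have e2 : (1 + 1 : ZMod 2) = 0 := two 1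
  cases d <;> cases d' <;> simp [indTwo, e2] at hne hb hε hc ⊢
  · rw [hb, hε]
    linear_combination - two ε
  · rw [hb, hc, hε]
    linear_combination - two ε - two 1

theorem sum_fin_add_one {M : Type*} [AddCommMonoid M] (f : Fin (k + 1) → M) :
    ∑ i, f (i + 1) = ∑ i, f i :=
  Equiv.sum_comp (Equiv.addRight (1 : Fin (k + 1))) f

/-- The honeycomb graph is bipartite: sum the colour change around the loop. -/
theorem IsHexCycle.length_even (hδ : IsHexCycle δ) : ((k + 1 : ℕ) : ZMod 2) = 0 := by
  have h := sum_fin_add_one fun i => (δ i).1.color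
  simp only [hδ.next, HexVertex.color_nbr, Finset.sum_add_distrib] at h
  simpa using h

/-- A bipartite double counting: away from a set of vertices, a function that is constant along the
edges of a multigraph that is regular of degree two has even sum. -/
theorem sum_eq_zero_of_regular {A : Finset HexVertex} {μ : HexDart → ℕ} {b : HexVertex → ZMod 2}
    (hμr : ∀ δ, μ δ.rev = μ δ) (hμs : ∀ v ∈ A, ∑ d, μ (v, d) = 2)
    (hμA : ∀ v ∈ A, ∀ d, μ (v, d) ≠ 0 → v.nbr d ∈ A)
    (hb : ∀ v ∈ A, ∀ d, μ (v, d) ≠ 0 → b (v.nbr d) = b v) : ∑ v ∈ A, b v = 0 := by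
  obtain ⟨F, hF⟩ : ∃ F : HexDart → ℤ, F = fun δ => δ.1.colorSign * (b δ.1).val * μ δ := ⟨_, rfl⟩
  have h1 : ∑ δ ∈ (A ×ˢ Finset.univ).filter (fun δ : HexDart => μ δ ≠ 0), F δ = 0 := by
    refine Finset.sum_involution (fun δ _ => δ.rev) ?_ ?_ ?_ ?_
    · intro δ hδ
      obtain ⟨hδA, hδ⟩ := Finset.mem_filter.1 hδ
      have hA := (Finset.mem_product.1 hδA).1
      simp only [hF, hμr, HexDart.rev_fst, HexVertex.colorSign_nbr, hb δ.1 hA δ.2 hδ]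
      ring
    · intro δ _ _
      exact δ.rev_ne
    · intro δ hδ
      obtain ⟨hδA, hδ⟩ := Finset.mem_filter.1 hδ
      have hA := (Finset.mem_product.1 hδA).1
      exact Finset.mem_filter.2 ⟨Finset.mem_product.2 ⟨hμA δ.1 hA δ.2 hδ, Finset.mem_univ _⟩,
        by rwa [hμr]⟩
    · intro δ _
      exact δ.rev_rev
  rw [Finset.sum_filter_of_ne, Finset.sum_product] at h1
  · have h2 : ∀ v ∈ A, ∑ d, F (v, d) = 2 * (v.colorSign * (b v).val) := by
      intro v hv
      simp only [hF, ← Finset.mul_sum]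
      rw [← Nat.cast_sum, hμs v hv]
      push_cast
      ring
    rw [Finset.sum_congr rfl h2, ← Finset.mul_sum] at h1
    -- The factor two is cancelled over `ℤ`; only then is the equation reduced modulo two, where the
    -- colour signs disappear.
    have h3 : ∑ v ∈ A, v.colorSign * ((b v).val : ℤ) = 0 := by omega
    have h4 := congrArg (Int.cast : ℤ → ZMod 2) h3
    push_cast at h4
    rw [← h4]
    refine Finset.sum_congr rfl fun v _ => ?_
    rw [ZMod.natCast_zmod_val]
    have : (v.colorSign : ZMod 2) = 1 := by
      cases v <;> simp only [HexVertex.colorSign] <;> decide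
    rw [this, one_mul]
  · intro δ _ h h0
    apply h
    simp [hF, h0]

/-- In a loop of a double dimer configuration of a region whose columns consist of whole horizontal
edges or of no horizontal edges at all, the number of right turns without horizontal steps is
even. -/
theorem IsHexCycle.sum_right_turn (hδ : IsHexCycle δ) {B : Finset HexVertex} {μ : HexDart → ℕ}
    (hμr : ∀ δ, μ δ.rev = μ δ) (hμB : ∀ δ, μ δ ≠ 0 → δ.1 ∈ B)
    (hμs : ∀ v ∈ B, ∑ d, μ (v, d) = 2) (hμ1 : ∀ i, μ (δ i) = 1)
    {X : ℤ} (hX : ∀ u v, X ≤ u → .black u v ∉ B)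
    (hB : ∀ v ∈ B, v.nbr .horizontal ∉ B → ∀ w ∈ B, w.nbr .horizontal ∈ B →
      w.base.1 - w.base.2 ≠ v.base.1 - v.base.2) :
    ∑ i, indTwo ((δ i).2 = .nwse ∧ (δ (i + 1)).2 = .nesw) = 0 := by
  have two : ∀ t : ZMod 2, t + t = 0 := by decide
  have hδB : ∀ i, (δ i).1 ∈ B := fun i => hμB _ (by rw [hμ1]; simp)
  have hX' : ∀ u v d, X ≤ u → cycleInd δ (.black u v, d) = 0 := by
    intro u v d h
    refine hδ.cycleInd_eq_zero (fun i hi => ?_) d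
    exact hX u v h (hi ▸ hδB i)
  rw [Finset.sum_congr rfl fun i _ => hδ.indTwo_right_turn hX' i]
  obtain ⟨P, hP⟩ : ∃ P, P = crossingNumber X (cycleInd δ) := ⟨_, rfl⟩
  rw [← hP]
  generalize P (δ 0).leftFace = ε
  -- The part with the constant `ε + 1` vanishes: the length is even, and every horizontal step is
  -- counted at both of its ends.
  rw [Finset.sum_congr rfl fun i _ => mul_add _ _ _, Finset.sum_add_distrib, ← Finset.sum_mul,
    Finset.sum_add_distrib, Finset.sum_add_distrib,
    sum_fin_add_one fun i => indTwo ((δ i).2 = .horizontal), two, add_zero]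
  have hn := hδ.length_even
  simp only [Finset.sum_const, Finset.card_univ, Fintype.card_fin, nsmul_eq_mul, hn, zero_mul,
    mul_one]
  have hadd : ∀ i, indTwo ((δ i).2 = .horizontal) + indTwo ((δ (i + 1)).2 = .horizontal) =
      cycleInd δ ((δ (i + 1)).1, .horizontal) := by
    intro i
    rw [hδ.cycleInd_eq]
    have := hδ.dir_ne i
    revert this
    generalize (δ (i + 1)).2 = d'
    generalize (δ i).2 = d
    cases d <;> cases d' <;> simp [indTwo]
  obtain ⟨g, hg⟩ : ∃ g : HexVertex → ZMod 2,
      g = fun v => (1 + cycleInd δ (v, .horizontal)) * P v.base := ⟨_, rfl⟩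
  have hsum : ∑ i, (1 + (indTwo ((δ i).2 = .horizontal) + indTwo ((δ (i + 1)).2 = .horizontal))) *
      P (δ (i + 1)).1.base = ∑ i, g (δ i).1 := by
    rw [← sum_fin_add_one fun i => g (δ i).1]
    exact Finset.sum_congr rfl fun i _ => by rw [hadd, hg]
  have hmem : ∀ v, v ∈ Finset.univ.image (fun i => (δ i).1) ↔ ∃ i, (δ i).1 = v := by simp
  have hCB : Finset.univ.image (fun i => (δ i).1) ⊆ B := by
    intro v hv
    obtain ⟨i, rfl⟩ := (hmem v).1 hv
    exact hδB i
  -- The two ends of a horizontal edge have the same value of `g`, so they cancel in pairs.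
  have hB0 : ∑ v ∈ B, g v = 0 := by
    refine Finset.sum_involution
      (fun v _ => if v.nbr .horizontal ∈ B then v.nbr .horizontal else v) ?_ ?_ ?_ ?_
    · intro v _
      split_ifs with h
      · have h1 : g (v.nbr .horizontal) = g v := by
          simp only [hg, HexVertex.base_nbr_horizontal]
          congr 2
          exact cycleInd_rev δ (v, .horizontal)
        rw [h1, two]
      · exact two _
    · intro v hv hgv
      split_ifs with h
      · exact v.nbr_ne _
      -- In this column no horizontal edge has both ends in `B`, so the loop has none there, and the
      -- crossing number of `base` is zero.
      · exfalso
        apply hgv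
        have : P v.base = 0 := by
          rw [hP, crossingNumber]
          refine Finset.sum_eq_zero fun j _ => ?_
          by_contra h'
          have h'' := h'
          rw [cycleInd, ite_eq_right_iff, Classical.not_imp] at h''
          obtain ⟨⟨i, hi⟩, -⟩ := h''
          have hends : ∀ i, (δ i).1.nbr (δ i).2 ∈ B := fun i => hδ.next i ▸ hδB _
          have hw : .black (v.base.1 + j) (v.base.2 + j) ∈ B ∧
              HexVertex.nbr (.black (v.base.1 + j) (v.base.2 + j)) .horizontal ∈ B := by
            rcases hi with hi | hi
            · have h1 := hδB i
              have h2 := hends i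
              rw [← hi] at h1 h2
              exact ⟨h1, h2⟩
            · have hi := congrArg HexDart.rev hi
              rw [HexDart.rev_rev] at hi
              have h1 := hδB i
              have h2 := hends i
              rw [← hi] at h1 h2
              exact ⟨by simpa [HexVertex.nbr_nbr] using h2, h1⟩
          refine hB v hv h _ hw.1 hw.2 ?_
          simp [HexVertex.base]
        simp [hg, this]
    · intro v hv
      split_ifs with h
      · exact h
      · exact hv
    · intro v hv
      by_cases h : v.nbr .horizontal ∈ B
      · rw [if_pos h, HexVertex.nbr_nbr, if_pos hv]
      · rw [if_neg h, if_neg h]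
  -- Off the loop the configuration is still of degree two, and `sum_eq_zero_of_regular` applies.
  have hrest : ∑ v ∈ B \ Finset.univ.image (fun i => (δ i).1), g v = 0 := by
    have hoff : ∀ v ∈ B \ Finset.univ.image (fun i => (δ i).1), ∀ d, cycleInd δ (v, d) = 0 := by
      intro v hv
      refine hδ.cycleInd_eq_zero fun i hi => (Finset.mem_sdiff.1 hv).2 ((hmem v).2 ⟨i, hi⟩)
    have hnbr : ∀ v ∈ B \ Finset.univ.image (fun i => (δ i).1), ∀ d, μ (v, d) ≠ 0 →
        v.nbr d ∈ B \ Finset.univ.image (fun i => (δ i).1) := by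
      intro v hv d hd
      refine Finset.mem_sdiff.2 ⟨hμB (HexDart.rev (v, d)) (by rwa [hμr]), fun h => ?_⟩
      obtain ⟨i, hi⟩ := (hmem _).1 h
      have hoff' := hoff v hv d
      rw [← cycleInd_rev] at hoff'
      have hs := hμs _ (hδB i)
      have h1 := hμ1 i
      have h2 : μ ((δ i).1, (δ (i - 1)).2) = 1 := by
        have h3 := hδ.rev_fst (i - 1)
        rw [sub_add_cancel] at h3
        refine Eq.trans ?_ (hμ1 (i - 1))
        rw [← hμr (δ (i - 1))]
        exact congrArg μ (Prod.ext h3.symm rfl)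
      have h4 : μ ((δ i).1, d) ≠ 0 := by
        rw [hi]
        have := hμr (v, d)
        rw [HexDart.rev] at this
        rwa [this]
      have h5 : cycleInd δ ((δ i).1, d) = 0 := by
        rw [hi]
        exact hoff'
      have h6 := hδ.cycleInd_eq (i - 1) d
      have h7 := hδ.dir_ne (i - 1)
      rw [sub_add_cancel] at h6 h7
      rw [h5] at h6
      have h8 : ¬ (d = (δ (i - 1)).2 ∨ d = (δ i).2) := by
        intro h
        rw [if_pos h] at h6
        exact zero_ne_one h6
      have h1 : μ ((δ i).1, (δ i).2) = 1 := h1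
      rw [EdgeDir.sum_eq] at hs
      revert h1 h2 h4 h7 h8
      generalize (δ i).2 = d₁
      generalize (δ (i - 1)).2 = d₂
      -- The two loop edges already use up degree two, so a third edge of nonzero multiplicity at a
      -- loop vertex is impossible.
      cases d <;> cases d₁ <;> cases d₂ <;> simp <;> omega
    have hgP : ∀ v ∈ B \ Finset.univ.image (fun i => (δ i).1), g v = P v.base := by
      intro v hv
      simp [hg, hoff v hv]
    rw [Finset.sum_congr rfl hgP]
    refine sum_eq_zero_of_regular hμr (fun v hv => hμs v (Finset.mem_sdiff.1 hv).1) hnbr ?_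
    intro v hv d hd
    have hconst : ∀ v ∈ B \ Finset.univ.image (fun i => (δ i).1), ∀ d,
        P v.base = P (HexDart.leftFace (v, d)) := by
      intro v hv d
      have hc := crossingNumber_leftFace hX' (cycleInd_rev δ) hδ.sum_cycleInd v
      have hb := crossingNumber_base hX' (hoff v hv .horizontal)
      have c1 := hc .nesw
      have c2 := hc .horizontal
      simp only [EdgeDir.rot, hoff v hv, add_zero] at c1 c2
      rw [hP]
      cases d
      · rw [hb, c1]
      · rw [hb, c2, c1]
      · exact hb
    -- All hexagons around a vertex off the loop have equal crossing number, and adjacent vertices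
    -- share the hexagon on the left of the dart between them.
    rw [hconst _ (hnbr v hv d hd) d.rot, hconst v hv d, ← HexDart.leftFace_left (v, d)]
    rfl
  rw [hsum, add_zero, ← Finset.sum_image (f := g) (s := Finset.univ) (g := fun i => (δ i).1)
    (fun i _ j _ h => hδ.inj h)]
  have := Finset.sum_sdiff (f := g) hCB
  rw [hrest, zero_add] at this
  rw [this, hB0]

end

/-! ## Gauge transformation to transfer matrices -/

theorem coe_matAlpha (a : ℂˣ) : (matAlpha a : Matrix (Fin 2) (Fin 2) ℂ) =
    !![Complex.I * a, 0; 0, -Complex.I * (a : ℂ)⁻¹] := by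
  ext i j
  fin_cases i <;> fin_cases j <;> simp [matAlpha, matA, matJ]

theorem coe_matBeta (b : ℂˣ) : (matBeta b : Matrix (Fin 2) (Fin 2) ℂ) =
    !![Complex.I * b, -Complex.I * (b + (b : ℂ)⁻¹); 0, -Complex.I * (b : ℂ)⁻¹] := by
  ext i j
  fin_cases i <;> fin_cases j <;> simp [matBeta, matB, matJ, turnL, turnR]
  ring

theorem coe_matGamma (c : ℂˣ) : (matGamma c : Matrix (Fin 2) (Fin 2) ℂ) =
    !![-Complex.I * (c : ℂ)⁻¹, 0; -Complex.I * (c + (c : ℂ)⁻¹), Complex.I * c] := by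
  ext i j
  fin_cases i <;> fin_cases j <;> simp [matGamma, matC, matJ, turnL, turnR]

/-- The matrix of the connection on a dart. -/
noncomputable def dartMatrix (a b c : ℂˣ) : HexDart → Matrix.SpecialLinearGroup (Fin 2) ℂ
  | (.black _ _, .horizontal) => (matGamma c)⁻¹
  | (.black _ _, .nwse) => matBeta b
  | (.black _ _, .nesw) => (matAlpha a)⁻¹
  | (.white _ _, .horizontal) => matGamma c
  | (.white _ _, .nwse) => (matBeta b)⁻¹
  | (.white _ _, .nesw) => matAlpha a

theorem edgeDir_horizontal (u v : ℤ) : edgeDir u v u v = .horizontal := by simp [edgeDir]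

theorem edgeDir_nwse (u v : ℤ) : edgeDir u v u (v - 1) = .nwse := by simp [edgeDir]

theorem edgeDir_nesw (u v : ℤ) : edgeDir u v (u + 1) v = .nesw := by simp [edgeDir]

theorem stepMatrix_nbr (a b c : ℂˣ) (δ : HexDart) :
    stepMatrix a b c δ.1 (δ.1.nbr δ.2) = dartMatrix a b c δ := by
  rcases δ with ⟨⟨u, v⟩ | ⟨u, v⟩, _ | _ | _⟩
  · simp [HexVertex.nbr, stepMatrix, dartMatrix, edgeDir_horizontal]
  · simp [HexVertex.nbr, stepMatrix, dartMatrix, edgeDir_nwse]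
  · simp [HexVertex.nbr, stepMatrix, dartMatrix, edgeDir_nesw]
  · simp [HexVertex.nbr, stepMatrix, dartMatrix, edgeDir_horizontal]
  · have := edgeDir_nwse u (v + 1)
    rw [add_sub_cancel_right] at this
    simp [HexVertex.nbr, stepMatrix, dartMatrix, this]
  · have := edgeDir_nesw (u - 1) v
    rw [sub_add_cancel] at this
    simp [HexVertex.nbr, stepMatrix, dartMatrix, this]

/-- The ratio of the weight of the fine edge on the left of a dart to the weight of the edge under
it. -/
def leftRatio (a b c : ℂˣ) : HexDart → ℂˣ
  | (.black _ _, .horizontal) => c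
  | (.black _ _, .nwse) => b
  | (.black _ _, .nesw) => a
  | (.white _ _, .horizontal) => c⁻¹
  | (.white _ _, .nwse) => b⁻¹
  | (.white _ _, .nesw) => a⁻¹

theorem leftRatio_rev (a b c : ℂˣ) (δ : HexDart) :
    leftRatio a b c δ.rev = (leftRatio a b c δ)⁻¹ := by
  rcases δ with ⟨⟨u, v⟩ | ⟨u, v⟩, _ | _ | _⟩ <;> simp [HexDart.rev, HexVertex.nbr, leftRatio]

/-- The diagonal matrix of the ratios of the weights of the fine edges on the left and on the right
of a dart to the weight of the edge under it. -/
noncomputable def sideMatrix (a b c : ℂˣ) (δ : HexDart) : Matrix (Fin 2) (Fin 2) ℂ :=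
  !![(leftRatio a b c δ : ℂ), 0; 0, (leftRatio a b c δ : ℂ)⁻¹]

/-- The part of the gauge transformation that depends on the direction only. -/
noncomputable def dirGauge : HexDart → Matrix (Fin 2) (Fin 2) ℂ
  | (.black _ _, .horizontal) => !![-Complex.I, Complex.I; -Complex.I, 0]
  | (.black _ _, .nwse) => !![0, Complex.I; -Complex.I, Complex.I]
  | (.black _ _, .nesw) => !![Complex.I, 0; 0, Complex.I]
  | (.white _ _, .horizontal) => !![-1, 1; -1, 0]
  | (.white _ _, .nwse) => !![0, 1; -1, 1]
  | (.white _ _, .nesw) => !![1, 0; 0, 1]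

/-- A finite check over six kinds of darts and two turns each; `hd` excludes backtracking. The signs
remain because the gauge depends only on the dart. The connection appears with inverted parameters,
which `trace_holonomy_inv` later undoes. -/
theorem dirGauge_mul (a b c : ℂˣ) (δ : HexDart) {d : EdgeDir} (hd : d ≠ δ.2) :
    dirGauge (δ.1.nbr δ.2, d) * (dartMatrix a⁻¹ b⁻¹ c⁻¹ δ : Matrix (Fin 2) (Fin 2) ℂ) =
      ((if δ.2 = .nwse ∧ d = .nesw then -1 else 1) * (if δ.2 = .horizontal then -1 else 1) : ℂ) •
        (turnMatrix δ.2 d * sideMatrix a b c δ * dirGauge δ) := by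
  rcases δ with ⟨⟨u, v⟩ | ⟨u, v⟩, _ | _ | _⟩ <;> cases d <;>
    first
    | exact absurd rfl hd
    | (ext i j
       fin_cases i <;> fin_cases j <;>
        simp [dirGauge, dartMatrix, turnMatrix, sideMatrix, leftRatio, HexVertex.nbr, EdgeDir.rot,
          turnL, turnR, coe_matAlpha, coe_matBeta, coe_matGamma, Matrix.mul_apply,
          Matrix.SpecialLinearGroup.coe_inv, Matrix.adjugate_fin_two] <;>
        ring_nf <;> simp only [Complex.I_sq] <;> ring_nf)

/-! ## The trace of the monodromy as a state sum -/

theorem gauge_orderedProd {Y M T : ℕ → Matrix (Fin 2) (Fin 2) ℂ} {ε : ℕ → ℂ}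
    (h : ∀ i, Y (i + 1) * M i = ε i • (T i * Y i)) (n : ℕ) :
    Y n * orderedProd M n = (∏ j ∈ Finset.range n, ε j) • (orderedProd T n * Y 0) := by
  induction n with
  | zero => simp [orderedProd]
  | succ n ih =>
    rw [orderedProd, ← mul_assoc, h, Matrix.smul_mul, mul_assoc, ih,
      Finset.prod_range_succ, Matrix.mul_smul, smul_smul, orderedProd, mul_assoc, mul_comm (ε _)]

theorem trace_orderedProd_of_gauge {Y M T : ℕ → Matrix (Fin 2) (Fin 2) ℂ} {ε : ℕ → ℂ}
    (h : ∀ i, Y (i + 1) * M i = ε i • (T i * Y i)) (hY : IsUnit (Y 0).det) {n : ℕ}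
    (hn : Y n = Y 0) (hε : ∏ j ∈ Finset.range n, ε j = 1) :
    (orderedProd M n).trace = (orderedProd T n).trace := by
  have h1 := gauge_orderedProd h n
  rw [hε, one_smul, hn] at h1
  have h3 : orderedProd M n = (Y 0)⁻¹ * (orderedProd T n * Y 0) := by
    rw [← h1, Matrix.nonsing_inv_mul_cancel_left _ _ hY]
  rw [h3, Matrix.trace_mul_comm, mul_assoc, Matrix.mul_nonsing_inv _ hY, mul_one]

theorem Fin.ofNat_add_one (k n : ℕ) : Fin.ofNat (k + 1) (n + 1) = Fin.ofNat (k + 1) n + 1 := by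
  ext
  simp [Fin.val_add]

theorem prod_sign_eq_one {ι : Type*} (S : Finset ι) (P : ι → Prop)
    (h : ∑ i ∈ S, indTwo (P i) = 0) : ∏ i ∈ S, (if P i then -1 else 1 : ℂ) = 1 := by
  have key : ∀ T : Finset ι, (∑ i ∈ T, indTwo (P i) = 0 ∧ ∏ i ∈ T, (if P i then -1 else 1 : ℂ) = 1) ∨
      (∑ i ∈ T, indTwo (P i) = 1 ∧ ∏ i ∈ T, (if P i then -1 else 1 : ℂ) = -1) := by
    intro T
    induction T using Finset.induction_on with
    | empty => simp
    | insert i T hi ih =>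
      rw [Finset.sum_insert hi, Finset.prod_insert hi]
      rw [indTwo]
      rcases ih with ⟨h1, h2⟩ | ⟨h1, h2⟩ <;> rw [h1, h2] <;> by_cases hP : P i <;> simp [hP]
      rfl
  rcases key S with h1 | h1
  · exact h1.2
  · rw [h1.1] at h
    exact absurd h one_ne_zero

/-- The sign of a vertex, which changes along the horizontal edges only. -/
def HexVertex.sign : HexVertex → ℂˣ
  | .black u v => (-1) ^ (u - v)
  | .white u v => -(-1) ^ (u - v)

theorem HexVertex.sign_nbr (v : HexVertex) (d : EdgeDir) :
    (v.nbr d).sign = (if d = .horizontal then -1 else 1) * v.sign := by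
  rcases v with ⟨u, v⟩ | ⟨u, v⟩ <;> cases d <;> simp [HexVertex.nbr, HexVertex.sign]
  · rw [← sub_add, zpow_add]; simp
  · rw [add_sub_right_comm, zpow_add]; simp
  · rw [← sub_sub, zpow_sub]; simp
  · rw [sub_right_comm, zpow_sub]; simp

section

variable {k : ℕ} {δ : Fin (k + 1) → HexDart}

/-- `HexVertex.sign` is a potential that changes sign exactly along horizontal steps, and it returns
to its value after a closed loop. -/
theorem IsHexCycle.prod_horizontal (hδ : IsHexCycle δ) :
    ∏ i, (if (δ i).2 = .horizontal then -1 else 1 : ℂ) = 1 := by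
  have h : ∏ i, (δ (i + 1)).1.sign =
      (∏ i, if (δ i).2 = .horizontal then -1 else 1) * ∏ i, (δ i).1.sign := by
    rw [← Finset.prod_mul_distrib]
    exact Finset.prod_congr rfl fun i _ => by rw [hδ.next, HexVertex.sign_nbr]
  have h' : ∏ i, (δ (i + 1)).1.sign = ∏ i, (δ i).1.sign :=
    Equiv.prod_comp (Equiv.addRight (1 : Fin (k + 1))) fun i => (δ i).1.sign
  rw [h', eq_comm, mul_eq_right] at h
  have h := congrArg (Units.coeHom ℂ) h
  rw [map_prod, map_one] at h
  exact (Finset.prod_congr rfl fun i _ => by split_ifs <;> simp).trans h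

theorem isUnit_det_dirGauge (δ : HexDart) : IsUnit (dirGauge δ).det := by
  rw [isUnit_iff_ne_zero]
  rcases δ with ⟨⟨u, v⟩ | ⟨u, v⟩, _ | _ | _⟩ <;> simp [dirGauge, Matrix.det_fin_two]

/-- The trace of the monodromy in terms of transfer matrices. -/
theorem IsHexCycle.trace_eq (hδ : IsHexCycle δ) (a b c : ℂˣ)
    (h0 : ∑ i, indTwo ((δ i).2 = .nwse ∧ (δ (i + 1)).2 = .nesw) = 0) :
    (orderedProd (fun n => (dartMatrix a⁻¹ b⁻¹ c⁻¹ (δ (Fin.ofNat (k + 1) n)) :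
      Matrix (Fin 2) (Fin 2) ℂ)) (k + 1)).trace =
      ∑ σ : Fin (k + 1) → Fin 2, ∏ i, turnMatrix (δ i).2 (δ (i + 1)).2 (σ (i + 1)) (σ i) *
        sideMatrix a b c (δ i) (σ i) (σ i) := by
  have hv : ∀ i : Fin (k + 1), Fin.ofNat (k + 1) i = i := fun i => Fin.ofNat_val_eq_self i
  rw [trace_orderedProd_of_gauge (Y := fun n => dirGauge (δ (Fin.ofNat (k + 1) n)))
    (T := fun n => turnMatrix (δ (Fin.ofNat (k + 1) n)).2 (δ (Fin.ofNat (k + 1) n + 1)).2 *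
      sideMatrix a b c (δ (Fin.ofNat (k + 1) n)))
    (ε := fun n => (if (δ (Fin.ofNat (k + 1) n)).2 = .nwse ∧
        (δ (Fin.ofNat (k + 1) n + 1)).2 = .nesw then -1 else 1) *
      (if (δ (Fin.ofNat (k + 1) n)).2 = .horizontal then -1 else 1)), trace_orderedProd]
  · refine Finset.sum_congr rfl fun σ _ => Finset.prod_congr rfl fun i _ => ?_
    rw [hv, Matrix.mul_apply, Fin.sum_univ_two]
    generalize σ i = s
    fin_cases s <;> simp [sideMatrix]
  · intro n
    have := dirGauge_mul a b c (δ (Fin.ofNat (k + 1) n)) (hδ.dir_ne _)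
    rw [← hδ.next] at this
    rw [Fin.ofNat_add_one]
    exact this
  · exact isUnit_det_dirGauge _
  · simp
  · rw [Finset.prod_range]
    simp only [hv]
    rw [Finset.prod_mul_distrib]
    refine (congrArg₂ (· * ·) ?_ hδ.prod_horizontal).trans (one_mul 1)
    convert prod_sign_eq_one _ _ h0

end

/-! ## Cycles of the honeycomb graph -/

theorem SimpleGraph.Walk.edges_eq_map_range {V : Type*} {G : SimpleGraph V} {u v : V}
    (p : G.Walk u v) :
    p.edges = (List.range p.length).map fun i => s(p.getVert i, p.getVert (i + 1)) := by
  induction p with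
  | nil => simp
  | cons h p ih => simp [List.range_succ_eq_map, ih, Function.comp_def]

theorem SL2Connection.holonomy_eq {V : Type*} {G : SimpleGraph V} (Γ : SL2Connection G) {u v : V}
    (p : G.Walk u v) :
    Γ.holonomy p = orderedProd (fun i => Γ.toFun (p.getVert i) (p.getVert (i + 1))) p.length := by
  induction p with
  | nil => simp [holonomy, orderedProd]
  | cons h p ih => simp [holonomy, ih, orderedProd_succ']

theorem coe_orderedProd (M : ℕ → Matrix.SpecialLinearGroup (Fin 2) ℂ) (n : ℕ) :
    ((orderedProd M n : Matrix.SpecialLinearGroup (Fin 2) ℂ) : Matrix (Fin 2) (Fin 2) ℂ) =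
      orderedProd (fun i => (M i : Matrix (Fin 2) (Fin 2) ℂ)) n := by
  induction n with
  | zero => simp [orderedProd]
  | succ n ih => simp [orderedProd, ih]

theorem orderedProd_congr {R : Type*} [Monoid R] {M M' : ℕ → R} {n : ℕ}
    (h : ∀ i < n, M i = M' i) : orderedProd M n = orderedProd M' n := by
  induction n with
  | zero => rfl
  | succ n ih => rw [orderedProd, orderedProd, h n n.lt_succ_self, ih fun i hi => h i (hi.trans n.lt_succ_self)]

section

variable {x y z : ℕ}

theorem SimpleGraph.Walk.IsCycle.exists_isHexCycle {v : boxRegion x y z}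
    {p : (boxGraph x y z).Walk v v} (hp : p.IsCycle) :
    ∃ (k : ℕ) (δ : Fin (k + 1) → HexDart), p.length = k + 1 ∧ IsHexCycle δ ∧
      ∀ i : Fin (k + 1), (δ i).1 = (p.getVert i).1 ∧
        (δ i).1.nbr (δ i).2 = (p.getVert (i + 1)).1 := by
  have h3 := hp.three_le_length
  obtain ⟨k, hk⟩ := Nat.exists_eq_add_of_le' (show 1 ≤ p.length by omega)
  have hadj : ∀ i : Fin (k + 1), ∃ d, (p.getVert (i + 1)).1 = (p.getVert i).1.nbr d := fun i =>
    p.adj_getVert_succ (by omega)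
  choose d hd using hadj
  -- Addition in `Fin (k + 1)` wraps around; at the last index this is the closedness of the walk.
  have hnext : ∀ i : Fin (k + 1), p.getVert (i + 1 : Fin (k + 1)) = p.getVert (i + 1) := by
    intro i
    rw [Fin.val_add_one]
    split_ifs with h
    · subst h
      rw [Fin.val_last, ← hk, p.getVert_length, p.getVert_zero]
    · rfl
  refine ⟨k, fun i => ((p.getVert i).1, d i), hk, ⟨fun i => ?_, fun i j h => ?_, fun i h => ?_⟩,
    fun i => ⟨rfl, (hd i).symm⟩⟩
  · simp only [hnext, hd]
  · exact Fin.ext (hp.getVert_injOn' (by simp; omega) (by simp; omega) (Subtype.ext h))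
  · have := congrArg Fin.val h
    simp only [Fin.val_add_one, Fin.ext_iff, Fin.val_last] at this
    split_ifs at this <;> omega

/-- A horizontal edge is cut by the boundary only in the two extreme columns of the box, and there
every horizontal edge is cut. -/
theorem boxRegion_missing_horizontal {v : HexVertex} (hv : v ∈ boxRegion x y z)
    (hv' : v.nbr .horizontal ∉ boxRegion x y z) {w : HexVertex} (hw : w ∈ boxRegion x y z)
    (hw' : w.nbr .horizontal ∈ boxRegion x y z) : w.base.1 - w.base.2 ≠ v.base.1 - v.base.2 := by
  rcases v with ⟨u, v⟩ | ⟨u, v⟩ <;> rcases w with ⟨u', v'⟩ | ⟨u', v'⟩ <;>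
    simp only [boxRegion, HexVertex.faces, HexVertex.nbr, Finset.mem_insert, Finset.mem_singleton,
      forall_eq_or_imp, forall_eq, Set.mem_ofPred_eq, HexVertex.base] at hv hv' hw hw' ⊢ <;>
    omega

theorem IsHexCycle.sum_right_turn_of_config {N : Sym2 (boxRegion x y z) → ℕ}
    (hN : IsDoubleDimerConfig (boxGraph x y z) N) {k : ℕ} {δ : Fin (k + 1) → HexDart}
    (hδ : IsHexCycle δ) (h1 : ∀ i, dartMult N (δ i) = 1) :
    ∑ i, indTwo ((δ i).2 = .nwse ∧ (δ (i + 1)).2 = .nesw) = 0 := by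
  refine hδ.sum_right_turn (B := (boxRegion_finite x y z).toFinset) (μ := dartMult N)
    (dartMult_rev N) ?_ ?_ h1 (X := x + 1) ?_ ?_
  · intro δ h
    rw [Set.Finite.mem_toFinset]
    by_contra h'
    exact h (dartMult_of_notMem N fun h2 => h' (mem_boxDarts.1 h2).1)
  · intro v hv
    exact hN.sum_dartMult ((Set.Finite.mem_toFinset _).1 hv)
  · intro u v hu hmem
    rw [Set.Finite.mem_toFinset] at hmem
    have := hmem (u, v) (by simp [HexVertex.faces])
    simp only at this
    omega
  · simp only [Set.Finite.mem_toFinset]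
    exact fun v hv hv' w hw hw' => boxRegion_missing_horizontal hv hv' hw hw'

theorem trace_holonomy_eq {v : boxRegion x y z} (p : (boxGraph x y z).Walk v v) (a b c : ℂˣ)
    {k : ℕ} {δ : Fin (k + 1) → HexDart} (hk : p.length = k + 1)
    (hp : ∀ i : Fin (k + 1), (δ i).1 = (p.getVert i).1 ∧
      (δ i).1.nbr (δ i).2 = (p.getVert (i + 1)).1) :
    ((abcConnection x y z a b c).holonomy p : Matrix (Fin 2) (Fin 2) ℂ).trace =
      (orderedProd (fun n => (dartMatrix a b c (δ (Fin.ofNat (k + 1) n)) :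
        Matrix (Fin 2) (Fin 2) ℂ)) (k + 1)).trace := by
  rw [SL2Connection.holonomy_eq, ← coe_orderedProd, hk]
  refine congrArg (fun M : Matrix.SpecialLinearGroup (Fin 2) ℂ =>
    (M : Matrix (Fin 2) (Fin 2) ℂ).trace) (orderedProd_congr fun i hi => ?_)
  have h := hp ⟨i, hi⟩
  have hi' : Fin.ofNat (k + 1) i = ⟨i, hi⟩ := Fin.ofNat_val_eq_self ⟨i, hi⟩
  rw [hi', ← stepMatrix_nbr, h.2, h.1]
  rfl

/-- The weighted sum over the admissible sets of darts over a loop. -/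
theorem partialSum_loop {N : Sym2 (boxRegion x y z) → ℕ}
    (hN : IsDoubleDimerConfig (boxGraph x y z) N) {v : boxRegion x y z}
    {p : (boxGraph x y z).Walk v v} (hp : p.IsCycle) (h1 : ∀ e ∈ p.edges, N e = 1) {a b c : ℂˣ}
    {wt : HexDart → ℂ} {w : Sym2 (boxRegion x y z) → ℂ}
    (hwt : ∀ δ hδ, wt δ = leftRatio a b c δ * w (boxDartEdge δ hδ))
    {L : Finset (Sym2 (boxRegion x y z))} (hL : ∀ e, e ∈ L ↔ e ∈ p.edges) :
    partialSum wt N L = (∏ e ∈ L, w e) *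
      ((abcConnection x y z a⁻¹ b⁻¹ c⁻¹).holonomy p : Matrix (Fin 2) (Fin 2) ℂ).trace := by
  obtain ⟨k, δ, hk, hδ, hδp⟩ := hp.exists_isHexCycle
  have hD : ∀ i, δ i ∈ boxDarts x y z := fun i => by
    rw [mem_boxDarts, (hδp i).2, (hδp i).1]
    exact ⟨(p.getVert i).2, (p.getVert (i + 1)).2⟩
  have hE : ∀ i, boxDartEdge (δ i) (hD i) = s(p.getVert i, p.getVert (i + 1)) := fun i => by
    apply (boxEdgeEmb x y z).injective
    change s((δ i).1, (δ i).1.nbr (δ i).2) = s((p.getVert i).1, (p.getVert (i + 1)).1)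
    rw [(hδp i).2, (hδp i).1]
  have hmem : ∀ e, e ∈ L ↔ ∃ i, boxDartEdge (δ i) (hD i) = e := fun e => by
    simp only [hL, p.edges_eq_map_range, List.mem_map, List.mem_range, hk, hE]
    exact ⟨fun ⟨i, hi, h⟩ => ⟨⟨i, hi⟩, h⟩, fun ⟨i, h⟩ => ⟨i, i.2, h⟩⟩
  have hN1 : ∀ i, N (boxDartEdge (δ i) (hD i)) = 1 := fun i =>
    h1 _ ((hL _).1 ((hmem _).2 ⟨i, rfl⟩))
  have hprod : ∏ e ∈ L, w e = ∏ i, w (boxDartEdge (δ i) (hD i)) := by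
    have : L = Finset.univ.image fun i => boxDartEdge (δ i) (hD i) := by
      ext e
      simp [hmem]
    rw [this, Finset.prod_image]
    intro i _ j _ h
    rcases (boxDartEdge_eq_iff _ _).1 h with h | h
    · exact (hδ.stateDart_injective (s := 0) (t := 0) h).1
    · exact (hδ.stateDart_injective (s := 0) (t := 1) h).1
  have h2 : ∀ i, dartMult (restrictEdges N L) (δ i) = 1 := fun i => by
    rw [dartMult_of_mem _ (hD i), restrictEdges, hN1, ind_of ((hmem _).2 ⟨i, rfl⟩)]
  rw [partialSum, hδ.stateSum_eq wt (fun i => ⟨hD i, rev_mem_boxDarts.2 (hD i)⟩)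
    (fun i => ⟨h2 i, (dartMult_rev _ _).trans (h2 i)⟩), trace_holonomy_eq p _ _ _ hk hδp,
    hδ.trace_eq a b c (hδ.sum_right_turn_of_config hN fun i => by rw [dartMult_of_mem _ (hD i), hN1]),
    hprod, Finset.mul_sum]
  · refine Finset.sum_congr rfl fun σ _ => ?_
    rw [← Finset.prod_mul_distrib]
    refine Finset.prod_congr rfl fun i _ => ?_
    have h3 : ∀ s, wt (stateDart (δ i) s) =
        w (boxDartEdge (δ i) (hD i)) * sideMatrix a b c (δ i) s s := by
      intro s
      fin_cases s
      · change wt (δ i) = _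
        rw [hwt _ (hD i), mul_comm]
        rfl
      · change wt (δ i).rev = _
        rw [hwt _ (rev_mem_boxDarts.2 (hD i)), (boxDartEdge_eq_iff (hD i) _).2 (Or.inr rfl),
          leftRatio_rev, mul_comm]
        simp [sideMatrix]
    rw [h3]
    ring
  · intro δ' h
    have hδ' : δ' ∈ boxDarts x y z := by
      by_contra h'
      exact h (dartMult_of_notMem _ h')
    rw [dartMult_of_mem _ hδ', restrictEdges, mul_ne_zero_iff, ne_eq, ind_eq_zero, not_not] at h
    obtain ⟨i, hi⟩ := (hmem _).1 h.1
    exact ⟨i, (boxDartEdge_eq_iff (hD i) hδ').1 hi.symm⟩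

end

/-! ## The weights of the edges over an edge -/

theorem hexWeight_black (f : EdgeDir → ℤ → ℤ → ℂˣ) (u v : ℤ) (d : EdgeDir) :
    hexWeight f s(.black u v, (HexVertex.black u v).nbr d) = f d u v := by
  change pairWeight f _ _ = _
  cases d
  · simp [pairWeight, HexVertex.nbr, edgeDir_horizontal]
  · simp [pairWeight, HexVertex.nbr, edgeDir_nwse]
  · simp [pairWeight, HexVertex.nbr, edgeDir_nesw]

theorem hexWeight_of_eq (f : EdgeDir → ℤ → ℤ → ℂˣ) {e : Sym2 HexVertex} {u v : ℤ} {d : EdgeDir}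
    (h : e = s(.black u v, (HexVertex.black u v).nbr d)) : hexWeight f e = f d u v := by
  rw [h, hexWeight_black]

theorem not_odd_two_mul (n : ℤ) : ¬ Odd (2 * n) := by simp

theorem not_even_two_mul_add_one (n : ℤ) : ¬ Even (2 * n + 1) := by simp [parity_simps]

theorem hexWeight_spoke (p r s t : ℂˣ) (k₁ k₂ k₃ : ℤ → ℂˣ) (δ : HexDart) :
    hexWeight (periodicWeight p r s t k₁ k₂ k₃) δ.spoke = 1 := by
  rcases δ with ⟨⟨U, V⟩ | ⟨U, V⟩, _ | _ | _⟩
  · rw [hexWeight_of_eq _ (u := 2 * U) (v := 2 * V) (d := .nesw)]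
    · simp only [periodicWeight, even_two_mul, not_odd_two_mul,
        and_true, and_false, if_false, Units.val_one]
    · simp [HexDart.spoke, HexDart.leaf, HexVertex.fine, HexVertex.nbr]
  · rw [hexWeight_of_eq _ (u := 2 * U + 1) (v := 2 * V) (d := .horizontal)]
    · simp only [periodicWeight, even_two_mul, odd_two_mul_add_one, not_odd_two_mul,
        not_even_two_mul_add_one, and_true, and_false, if_false, Units.val_one]
    · simp [HexDart.spoke, HexDart.leaf, HexVertex.fine, HexVertex.nbr]
  · rw [hexWeight_of_eq _ (u := 2 * U + 1) (v := 2 * V + 1) (d := .nwse)]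
    · simp only [periodicWeight, odd_two_mul_add_one, not_even_two_mul_add_one, and_false,
        if_false, Units.val_one]
    · simp [HexDart.spoke, HexDart.leaf, HexVertex.fine, HexVertex.nbr]
  · rw [hexWeight_of_eq _ (u := 2 * U) (v := 2 * V + 1) (d := .nesw)]
    · simp only [periodicWeight, odd_two_mul_add_one, not_odd_two_mul,
        not_even_two_mul_add_one, and_true, and_false, if_false, Units.val_one]
    · simp [HexDart.spoke, HexDart.leaf, HexVertex.fine, HexVertex.nbr]
  · rw [hexWeight_of_eq _ (u := 2 * U) (v := 2 * V + 1) (d := .horizontal)]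
    · simp only [periodicWeight, even_two_mul, odd_two_mul_add_one, not_odd_two_mul,
        not_even_two_mul_add_one, and_true, and_false, if_false, Units.val_one]
    · simp [HexDart.spoke, HexDart.leaf, HexVertex.fine, HexVertex.nbr]
  · rw [hexWeight_of_eq _ (u := 2 * U) (v := 2 * V + 1) (d := .nwse)]
    · simp only [periodicWeight, even_two_mul, not_odd_two_mul,
        not_even_two_mul_add_one, and_false, if_false, Units.val_one]
    · simp [HexDart.spoke, HexDart.leaf, HexVertex.fine, HexVertex.nbr]

/-- Exponents `n + 1` and `n` of `g²` are `2n + 1` shifted by one either way in powers of `g`, so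
the two fine edges over an edge have `g` and `g⁻¹` times the geometric mean. -/
theorem hexWeight_fineEdge (p r s t a b c : ℂˣ) (hr : a ^ 2 = r) (hs : b ^ 2 = s) (ht : c ^ 2 = t)
    (k₁ k₂ k₃ : ℤ → ℂˣ) (δ : HexDart) :
    hexWeight (periodicWeight p r s t k₁ k₂ k₃) δ.fineEdge =
      leftRatio a b c δ * hexWeight (squishedWeight p a b c k₁ k₂ k₃) δ.edge := by
  have h2 : ∀ n : ℤ, (2 * n + 1) / 2 = n := by omega
  have h3 : ∀ n : ℤ, 2 * n / 2 = n := by omega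
  have hu : ∀ (g : ℂˣ) (n : ℤ), (g ^ 2) ^ (n + 1) = g * g ^ (2 * n + 1) := by
    intro g n
    rw [← zpow_natCast, ← zpow_mul, ← zpow_one_add]
    congr 1
    push_cast
    ring
  have hl : ∀ (g : ℂˣ) (n : ℤ), (g ^ 2) ^ n = g⁻¹ * g ^ (2 * n + 1) := by
    intro g n
    rw [← zpow_natCast, ← zpow_mul, eq_inv_mul_iff_mul_eq, ← zpow_one_add]
    congr 1
    push_cast
    ring
  subst hr hs ht
  rcases δ with ⟨⟨U, V⟩ | ⟨U, V⟩, _ | _ | _⟩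
  · rw [hexWeight_of_eq _ (u := 2 * U) (v := 2 * V) (d := .horizontal),
      hexWeight_of_eq _ (u := U) (v := V) (d := .horizontal)]
    · simp only [periodicWeight, squishedWeight, leftRatio, even_two_mul, not_odd_two_mul,
        and_true, and_false, if_true, if_false, h3,
        hu, hl, ← Units.val_mul]
      congr 1
      ac_rfl
    · rfl
    · simp [HexDart.fineEdge, HexDart.left, HexDart.leaf, HexVertex.fine, HexVertex.nbr, EdgeDir.rot]
  · rw [hexWeight_of_eq _ (u := 2 * U + 1) (v := 2 * V) (d := .nwse),
      hexWeight_of_eq _ (u := U) (v := V) (d := .nwse)]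
    · simp only [periodicWeight, squishedWeight, leftRatio, even_two_mul, odd_two_mul_add_one,
        not_even_two_mul_add_one, and_true, if_true, if_false, h2, h3,
        hu, hl, ← Units.val_mul]
      congr 1
      ac_rfl
    · rfl
    · simp [HexDart.fineEdge, HexDart.left, HexDart.leaf, HexVertex.fine, HexVertex.nbr, EdgeDir.rot]
      ring_nf
  · rw [hexWeight_of_eq _ (u := 2 * U + 1) (v := 2 * V + 1) (d := .nesw),
      hexWeight_of_eq _ (u := U) (v := V) (d := .nesw)]
    · simp only [periodicWeight, squishedWeight, leftRatio, odd_two_mul_add_one,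
        not_even_two_mul_add_one, and_true, and_false, if_true, if_false, h2, hu, hl, ← Units.val_mul]
      congr 1
      ac_rfl
    · rfl
    · simp [HexDart.fineEdge, HexDart.left, HexDart.leaf, HexVertex.fine, HexVertex.nbr, EdgeDir.rot]
      ring_nf
  · rw [hexWeight_of_eq _ (u := 2 * U + 1) (v := 2 * V + 1) (d := .horizontal),
      hexWeight_of_eq _ (u := U) (v := V) (d := .horizontal)]
    · simp only [periodicWeight, squishedWeight, leftRatio, odd_two_mul_add_one,
        not_even_two_mul_add_one, and_true, and_false, if_true, if_false, h2, hu, hl, ← Units.val_mul]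
      congr 1
      ac_rfl
    · simp [HexDart.edge, HexVertex.nbr]
    · rw [Sym2.eq_swap]
      simp [HexDart.fineEdge, HexDart.left, HexDart.leaf, HexVertex.fine, HexVertex.nbr, EdgeDir.rot]
  · rw [hexWeight_of_eq _ (u := 2 * U) (v := 2 * (V + 1)) (d := .nwse),
      hexWeight_of_eq _ (u := U) (v := V + 1) (d := .nwse)]
    · simp only [periodicWeight, squishedWeight, leftRatio, even_two_mul, not_odd_two_mul,
        and_true, if_true, if_false, h3,
        hu, hl, ← Units.val_mul]
      congr 1
      ac_rfl
    · simp [HexDart.edge, HexVertex.nbr]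
    · rw [Sym2.eq_swap]
      simp [HexDart.fineEdge, HexDart.left, HexDart.leaf, HexVertex.fine, HexVertex.nbr, EdgeDir.rot]
      ring_nf
  · rw [hexWeight_of_eq _ (u := 2 * (U - 1) + 1) (v := 2 * V) (d := .nesw),
      hexWeight_of_eq _ (u := U - 1) (v := V) (d := .nesw)]
    · simp only [periodicWeight, squishedWeight, leftRatio, even_two_mul, odd_two_mul_add_one,
        not_odd_two_mul, and_true, and_false, if_true, if_false, h2, h3,
        hu, hl, ← Units.val_mul]
      congr 1
      ac_rfl
    · simp [HexDart.edge, HexVertex.nbr]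
    · rw [Sym2.eq_swap]
      simp [HexDart.fineEdge, HexDart.left, HexDart.leaf, HexVertex.fine, HexVertex.nbr, EdgeDir.rot]
      ring_nf

/-! ## Independence of the sign of the exponents of the connection -/

theorem holonomy_gauge {V : Type*} {G : SimpleGraph V} {Γ Γ' : SL2Connection G}
    {X : V → Matrix (Fin 2) (Fin 2) ℂ}
    (h : ∀ u v, G.Adj u v → (Γ'.toFun u v : Matrix (Fin 2) (Fin 2) ℂ) * X u =
      X v * (Γ.toFun u v : Matrix (Fin 2) (Fin 2) ℂ)) {u v : V} (p : G.Walk u v) :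
    (Γ'.holonomy p : Matrix (Fin 2) (Fin 2) ℂ) * X u =
      X v * (Γ.holonomy p : Matrix (Fin 2) (Fin 2) ℂ) := by
  induction p with
  | nil => simp [SL2Connection.holonomy]
  | cons hadj p ih =>
    rw [SL2Connection.holonomy, SL2Connection.holonomy, Matrix.SpecialLinearGroup.coe_mul,
      Matrix.SpecialLinearGroup.coe_mul, mul_assoc, h _ _ hadj, ← mul_assoc, ih, mul_assoc]

theorem trace_holonomy_gauge {V : Type*} {G : SimpleGraph V} {Γ Γ' : SL2Connection G}
    {X : V → Matrix (Fin 2) (Fin 2) ℂ} (hX : ∀ v, (X v).det ≠ 0)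
    (h : ∀ u v, G.Adj u v → (Γ'.toFun u v : Matrix (Fin 2) (Fin 2) ℂ) * X u =
      X v * (Γ.toFun u v : Matrix (Fin 2) (Fin 2) ℂ)) {v : V} (p : G.Walk v v) :
    (Γ'.holonomy p : Matrix (Fin 2) (Fin 2) ℂ).trace =
      (Γ.holonomy p : Matrix (Fin 2) (Fin 2) ℂ).trace := by
  have hu : IsUnit (X v).det := isUnit_iff_ne_zero.2 (hX v)
  have h1 : (Γ'.holonomy p : Matrix (Fin 2) (Fin 2) ℂ) =
      X v * (Γ.holonomy p : Matrix (Fin 2) (Fin 2) ℂ) * (X v)⁻¹ := by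
    rw [← holonomy_gauge h, Matrix.mul_nonsing_inv_cancel_right _ _ hu]
  rw [h1, Matrix.trace_mul_comm, ← mul_assoc, Matrix.nonsing_inv_mul _ hu, one_mul]

/-- The gauge transformation between the two connections. -/
noncomputable def inversionGauge (a b c : ℂ) : HexVertex → Matrix (Fin 2) (Fin 2) ℂ
  | .white _ _ => !![a ^ 2 * (b ^ 2 + 1) * (c ^ 2 + 1), -((a ^ 2 * c ^ 2 - 1) * (b ^ 2 + 1));
      (a ^ 2 * b ^ 2 - 1) * (c ^ 2 + 1), (b ^ 2 + 1) * (c ^ 2 + 1)]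
  | .black _ _ => !![(b ^ 2 + 1) * (c ^ 2 + 1), (a ^ 2 * c ^ 2 - 1) * (b ^ 2 + 1);
      -((a ^ 2 * b ^ 2 - 1) * (c ^ 2 + 1)), a ^ 2 * (b ^ 2 + 1) * (c ^ 2 + 1)]

theorem det_inversionGauge (a b c : ℂ) (v : HexVertex) : (inversionGauge a b c v).det =
    (a ^ 2 + 1) * (b ^ 2 + 1) * (c ^ 2 + 1) * (1 + a ^ 2 * b ^ 2 * c ^ 2) := by
  cases v <;> simp only [inversionGauge, Matrix.det_fin_two_of] <;> ring

/-- A gauge that depends on the colour only intertwines the two connections. It is invertible unless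
its determinant, computed above, vanishes. -/
theorem dartMatrix_inversionGauge (a b c : ℂˣ) (δ : HexDart) :
    (dartMatrix a⁻¹ b⁻¹ c⁻¹ δ : Matrix (Fin 2) (Fin 2) ℂ) * inversionGauge a b c δ.1 =
      inversionGauge a b c (δ.1.nbr δ.2) * (dartMatrix a b c δ : Matrix (Fin 2) (Fin 2) ℂ) := by
  have ha := a.ne_zero
  have hb := b.ne_zero
  have hc := c.ne_zero
  rcases δ with ⟨⟨u, v⟩ | ⟨u, v⟩, _ | _ | _⟩ <;>
  · ext i j
    fin_cases i <;> fin_cases j <;>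
      simp [dartMatrix, inversionGauge, HexVertex.nbr, coe_matAlpha, coe_matBeta, coe_matGamma,
        Matrix.mul_apply, Matrix.SpecialLinearGroup.coe_inv, Matrix.adjugate_fin_two] <;>
      field_simp <;> ring

theorem continuous_stepMatrix {T : Type*} [TopologicalSpace T] {a b c : T → ℂˣ}
    (ha : Continuous a) (hb : Continuous b) (hc : Continuous c) (P Q : HexVertex) :
    Continuous fun t => (stepMatrix (a t) (b t) (c t) P Q : Matrix (Fin 2) (Fin 2) ℂ) := by
  have hv : ∀ g : T → ℂˣ, Continuous g → (Continuous fun t => (g t : ℂ)) ∧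
      Continuous fun t => (g t : ℂ)⁻¹ := fun g hg =>
    have h := Units.continuous_val.comp hg
    ⟨h, h.inv₀ fun t => (g t).ne_zero⟩
  have hα : Continuous fun t => (matAlpha (a t) : Matrix (Fin 2) (Fin 2) ℂ) := by
    have := hv a ha
    refine continuous_matrix fun i j => ?_
    fin_cases i <;> fin_cases j <;> simp [coe_matAlpha] <;>
      fun_prop (disch := simp)
  have hβ : Continuous fun t => (matBeta (b t) : Matrix (Fin 2) (Fin 2) ℂ) := by
    have := hv b hb
    refine continuous_matrix fun i j => ?_
    fin_cases i <;> fin_cases j <;> simp [coe_matBeta] <;>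
      fun_prop (disch := simp)
  have hγ : Continuous fun t => (matGamma (c t) : Matrix (Fin 2) (Fin 2) ℂ) := by
    have := hv c hc
    refine continuous_matrix fun i j => ?_
    fin_cases i <;> fin_cases j <;> simp [coe_matGamma] <;>
      fun_prop (disch := simp)
  rcases P with ⟨u, v⟩ | ⟨u, v⟩ <;> rcases Q with ⟨u', v'⟩ | ⟨u', v'⟩
  · exact continuous_const
  · simp only [stepMatrix]
    cases edgeDir u v u' v'
    · exact hγ.matrix_adjugate
    · exact hβ
    · exact hα.matrix_adjugate
  · simp only [stepMatrix]
    cases edgeDir u' v' u v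
    · exact hγ
    · exact hβ.matrix_adjugate
    · exact hα
  · exact continuous_const

section

variable {x y z : ℕ}

theorem continuous_trace_holonomy {T : Type*} [TopologicalSpace T] {a b c : T → ℂˣ}
    (ha : Continuous a) (hb : Continuous b) (hc : Continuous c) {u : boxRegion x y z}
    (p : (boxGraph x y z).Walk u u) :
    Continuous fun t => ((abcConnection x y z (a t) (b t) (c t)).holonomy p :
      Matrix (Fin 2) (Fin 2) ℂ).trace := by
  have key : ∀ {u v : boxRegion x y z} (p : (boxGraph x y z).Walk u v),
      Continuous fun t => ((abcConnection x y z (a t) (b t) (c t)).holonomy p :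
        Matrix (Fin 2) (Fin 2) ℂ) := by
    intro u v p
    induction p with
    | nil => exact continuous_const
    | cons h p ih =>
      simp only [SL2Connection.holonomy, Matrix.SpecialLinearGroup.coe_mul]
      exact ih.matrix_mul (continuous_stepMatrix ha hb hc _ _)
  exact (key p).matrix_trace

theorem trace_holonomy_inv_of_ne {a b c : ℂˣ}
    (h : ((a : ℂ) ^ 2 + 1) * ((b : ℂ) ^ 2 + 1) * ((c : ℂ) ^ 2 + 1) *
      (1 + (a : ℂ) ^ 2 * (b : ℂ) ^ 2 * (c : ℂ) ^ 2) ≠ 0) {v : boxRegion x y z}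
    (p : (boxGraph x y z).Walk v v) :
    ((abcConnection x y z a⁻¹ b⁻¹ c⁻¹).holonomy p : Matrix (Fin 2) (Fin 2) ℂ).trace =
      ((abcConnection x y z a b c).holonomy p : Matrix (Fin 2) (Fin 2) ℂ).trace := by
  refine trace_holonomy_gauge (X := fun v => inversionGauge a b c v.1) (fun v => ?_) ?_ p
  · rwa [det_inversionGauge]
  · rintro ⟨u, hu⟩ ⟨v, hv⟩ ⟨d, hd⟩
    obtain rfl : v = u.nbr d := hd
    have := dartMatrix_inversionGauge a b c (u, d)
    rwa [← stepMatrix_nbr, ← stepMatrix_nbr] at this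

theorem subsingleton_exp_pow (w : ℂ) {n : ℕ} (hn : n ≠ 0) :
    {t : ℝ | w * (Real.exp t : ℂ) ^ n + 1 = 0}.Subsingleton := by
  intro t ht t' ht'
  simp only [Set.mem_ofPred_eq] at ht ht'
  have hw : w ≠ 0 := by
    rintro rfl
    simp at ht
  have h : (Real.exp t : ℂ) ^ n = (Real.exp t' : ℂ) ^ n :=
    mul_left_cancel₀ hw (add_right_cancel (ht.trans ht'.symm))
  rw [← Complex.ofReal_pow, ← Complex.ofReal_pow, Complex.ofReal_inj] at h
  exact Real.exp_injective
    ((pow_left_inj₀ (Real.exp_pos t).le (Real.exp_pos t').le hn).1 h)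

/-- Each of the four factors vanishes for at most one real `t`, because it has the form `w *
exp(t)^n + 1` with `n` equal to `2` or `6`. -/
theorem dense_exp_ne (a b c : ℂ) :
    Dense {t : ℝ | ((a * Real.exp t) ^ 2 + 1) * ((b * Real.exp t) ^ 2 + 1) *
      ((c * Real.exp t) ^ 2 + 1) *
      (1 + (a * Real.exp t) ^ 2 * (b * Real.exp t) ^ 2 * (c * Real.exp t) ^ 2) ≠ 0} := by
  have hf (w : ℂ) {n : ℕ} (hn : n ≠ 0) :
      {t : ℝ | w * (Real.exp t : ℂ) ^ n + 1 = 0}.Countable :=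
    (subsingleton_exp_pow w hn).countable
  refine (((((hf (a ^ 2) two_ne_zero).union (hf (b ^ 2) two_ne_zero)).union
    (hf (c ^ 2) two_ne_zero)).union
    (hf (a ^ 2 * b ^ 2 * c ^ 2) (n := 6) (by norm_num))).dense_compl ℝ).mono ?_
  intro t ht h
  apply ht
  simp only [mul_eq_zero] at h
  rcases h with ((h | h) | h) | h
  · exact Or.inl (Or.inl (Or.inl (show a ^ 2 * (Real.exp t : ℂ) ^ 2 + 1 = 0 by rw [← h]; ring)))
  · exact Or.inl (Or.inl (Or.inr (show b ^ 2 * (Real.exp t : ℂ) ^ 2 + 1 = 0 by rw [← h]; ring)))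
  · exact Or.inl (Or.inr (show c ^ 2 * (Real.exp t : ℂ) ^ 2 + 1 = 0 by rw [← h]; ring))
  · exact Or.inr (show a ^ 2 * b ^ 2 * c ^ 2 * (Real.exp t : ℂ) ^ 6 + 1 = 0 by rw [← h]; ring)

/-- Inverting `a`, `b`, `c` does not change the trace of the monodromy. -/
theorem trace_holonomy_inv (a b c : ℂˣ) {v : boxRegion x y z} (p : (boxGraph x y z).Walk v v) :
    ((abcConnection x y z a⁻¹ b⁻¹ c⁻¹).holonomy p : Matrix (Fin 2) (Fin 2) ℂ).trace =
      ((abcConnection x y z a b c).holonomy p : Matrix (Fin 2) (Fin 2) ℂ).trace := by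
  obtain ⟨g, hg⟩ : ∃ g : ℝ → ℂˣ, ∀ t, (g t : ℂ) = Real.exp t :=
    ⟨fun t => Units.mk0 (Real.exp t : ℂ) (by exact_mod_cast (Real.exp_pos t).ne'), fun t => rfl⟩
  have hgc : Continuous g := by
    rw [Units.continuous_iff]
    constructor
    · simp only [Function.comp_def, hg]
      fun_prop
    · simp only [Units.val_inv_eq_inv_val, hg]
      refine Continuous.inv₀ (by fun_prop) fun t => ?_
      exact_mod_cast (Real.exp_pos t).ne'
  have hc : ∀ s : ℂˣ, Continuous fun t => s * g t := fun s => continuous_const.mul hgc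
  obtain ⟨f, hf⟩ : ∃ f : ℂˣ → ℂˣ → ℂˣ → ℂ, ∀ a b c, f a b c =
      ((abcConnection x y z a b c).holonomy p : Matrix (Fin 2) (Fin 2) ℂ).trace :=
    ⟨_, fun _ _ _ => rfl⟩
  -- Scaling all parameters by `exp t` avoids the degenerate ones on a dense set of `t`; both sides
  -- are continuous, and `t = 0` is the claim.
  have h : (fun t => f (a * g t)⁻¹ (b * g t)⁻¹ (c * g t)⁻¹) =
      fun t => f (a * g t) (b * g t) (c * g t) := by
    simp only [hf]
    exact Continuous.ext_on (dense_exp_ne a b c)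
      (continuous_trace_holonomy (hc a).inv (hc b).inv (hc c).inv p)
      (continuous_trace_holonomy (hc a) (hc b) (hc c) p) fun t ht => by
        refine trace_holonomy_inv_of_ne ?_ p
        simp only [Units.val_mul, hg]
        exact ht
  have hg0 : ∀ s : ℂˣ, s * g 0 = s := fun s => Units.ext (by rw [Units.val_mul, hg]; simp)
  have h0 : f (a * g 0)⁻¹ (b * g 0)⁻¹ (c * g 0)⁻¹ = f (a * g 0) (b * g 0) (c * g 0) :=
    congrFun h 0
  rw [hg0 a, hg0 b, hg0 c, hf, hf] at h0
  exact h0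

end

/-! ## The squish map is measure preserving -/

/-- Works with the very cycle chosen in `loopTrace`. As the state sum is computed for any cycle with
the given edges, independence of the base point and direction is never needed. -/
theorem SL2Connection.exists_loopTrace_eq {V : Type*} {G : SimpleGraph V} {N : Sym2 V → ℕ}
    {L : Finset (Sym2 V)} (hL : IsClosedLoop G N L) (Γ : SL2Connection G) :
    ∃ (v : V) (p : G.Walk v v), p.IsCycle ∧ (∀ e ∈ p.edges, N e = 1) ∧
      (∀ e, e ∈ L ↔ e ∈ p.edges) ∧
        Γ.loopTrace L = (Γ.holonomy p : Matrix (Fin 2) (Fin 2) ℂ).trace := by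
  obtain ⟨v, p, hp, h1, hpL⟩ := hL
  have h : ∃ (v : V) (p : G.Walk v v), p.IsCycle ∧ p.edges.toFinset = L := ⟨v, p, hp, hpL⟩
  have hs := h.choose_spec.choose_spec
  have hmem : ∀ e, e ∈ L ↔ e ∈ h.choose_spec.choose.edges := fun e => by
    rw [← List.mem_toFinset, hs.2]
  refine ⟨_, h.choose_spec.choose, hs.1, fun e he => h1 e ?_, hmem, ?_⟩
  · rw [← List.mem_toFinset, hpL, hmem]
    exact he
  · rw [SL2Connection.loopTrace, dif_pos h]

theorem isMeasurePreservingMap_of_fiber {A B : Type*} {X : Finset A} {Y : Set B} {f : A → B}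
    [∀ N, DecidablePred fun m => f m = N] {μ : A → ℂ} {ν : B → ℂ} (hf : ∀ m ∈ X, f m ∈ Y)
    (h : ∀ N ∈ Y, ∑ m ∈ X with f m = N, μ m = ν N) : IsMeasurePreservingMap X Y f μ ν := by
  refine ⟨hf, fun S hS => ?_⟩
  rw [← Finset.sum_congr rfl fun N hN => h N (hS N hN)]
  refine ((Finset.sum_fiberwise_of_maps_to (g := f)
    fun m hm => (Finset.mem_filter.1 hm).2) _).symm.trans ?_
  refine Finset.sum_congr rfl fun N hN => Finset.sum_congr ?_ fun _ _ => rfl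
  ext m
  simp only [Finset.mem_filter, and_assoc]
  exact ⟨fun ⟨h1, _, h2⟩ => ⟨h1, h2⟩, fun ⟨h1, h2⟩ => ⟨h1, h2 ▸ hN, h2⟩⟩

section

variable {x y z : ℕ}

/-- The total weight of the dimer configurations over a double dimer configuration. -/
theorem sum_fiber_eq_contribution (p r s t a b c : ℂˣ) (hr : a ^ 2 = r) (hs : b ^ 2 = s)
    (ht : c ^ 2 = t) (k₁ k₂ k₃ : ℤ → ℂˣ) {Γ : SL2Connection (boxGraph x y z)}
    (hΓ : Γ = abcConnection x y z a b c ∨ Γ = abcConnection x y z a⁻¹ b⁻¹ c⁻¹)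
    {N : Sym2 (boxRegion x y z) → ℕ} (hN : IsDoubleDimerConfig (boxGraph x y z) N) :
    ∑ m ∈ dimerConfigs (boxGraph (2 * x) (2 * y) (2 * z)) with squish m = N,
      dimerWeight (boxWeight (periodicWeight p r s t k₁ k₂ k₃)) m =
    doubleDimerContribution (boxWeight (squishedWeight p a b c k₁ k₂ k₃)) Γ N := by
  have hw : ∀ (δ : HexDart) (hδ : δ ∈ boxDarts x y z),
      hexWeight (periodicWeight p r s t k₁ k₂ k₃) δ.fineEdge = leftRatio a b c δ *
        boxWeight (squishedWeight p a b c k₁ k₂ k₃) (boxDartEdge δ hδ) := fun δ hδ =>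
    hexWeight_fineEdge p r s t a b c hr hs ht k₁ k₂ k₃ δ
  rw [sum_fiber (hexWeight_spoke p r s t k₁ k₂ k₃) hN]
  refine stateSum_eq_contribution hN (wt := fun δ =>
    hexWeight (periodicWeight p r s t k₁ k₂ k₃) δ.fineEdge) (fun δ hδ => ?_) fun L hL => ?_
  · rw [hw δ hδ, hw δ.rev (rev_mem_boxDarts.2 hδ), (boxDartEdge_eq_iff hδ _).2 (Or.inr rfl),
      leftRatio_rev, Units.val_inv_eq_inv_val]
    have := (leftRatio a b c δ).ne_zero
    field_simp
  · obtain ⟨v, p, hp, h1, hpL, h⟩ := Γ.exists_loopTrace_eq hL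
    rw [h, partialSum_loop hN hp h1 hw hpL]
    -- The loop computation produces the inverted parameters; the other connection has the same
    -- traces.
    rcases hΓ with rfl | rfl
    · rw [trace_holonomy_inv]
    · rfl

end

/-! ## Gauge equivalence with the monochromatic weights -/

theorem exists_add_one_eq {A : Type*} [AddCommGroup A] (g : ℤ → A) :
    ∃ G : ℤ → A, ∀ n, G (n + 1) = g n + G n := by
  refine ⟨fun n => ∑ i ∈ Finset.range n.toNat, g i -
    ∑ i ∈ Finset.range (-n).toNat, g (-(i + 1 : ℕ)), fun n => ?_⟩
  rcases n with n | n
  · have h1 : (-(Int.ofNat n + 1)).toNat = 0 := by simp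
    have h2 : (-(Int.ofNat n)).toNat = 0 := by simp
    have h3 : (Int.ofNat n + 1).toNat = n + 1 := by simp
    have h4 : (Int.ofNat n).toNat = n := by simp
    simp only [h1, h2, h3, h4, Finset.sum_range_succ]
    simp [add_comm]
  · have h1 : (-(Int.negSucc n + 1)).toNat = n := by omega
    have h2 : (-(Int.negSucc n)).toNat = n + 1 := by omega
    have h3 : (Int.negSucc n + 1).toNat = 0 := by omega
    have h4 : (Int.negSucc n).toNat = 0 := by omega
    simp only [h1, h2, h3, h4, Finset.sum_range_succ]
    simp [Int.negSucc_eq]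

/-- The squished weights and the monochromatic weights, written additively, differ by a gauge
transformation. -/
theorem exists_gauge {A : Type*} [AddCommGroup A] (p a b c : A) (k₁ k₂ k₃ : ℤ → A) (o : ℤ → ℤ) :
    ∃ φ ψ : ℤ → ℤ → A,
      (∀ u v : ℤ, k₃ (u - v) + (2 * (-v) + 1) • c + (-v) • p =
        (-v + o (u - v)) • ((3 : ℤ) • p + (2 : ℤ) • a + (2 : ℤ) • b + (2 : ℤ) • c) +
          (φ u v + ψ u v)) ∧
      (∀ u v : ℤ, k₂ v + (2 * u + 1) • b + u • p = φ u v + ψ u (v - 1)) ∧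
      ∀ u v : ℤ, k₁ u + (2 * v + 1) • a + v • p = φ u v + ψ (u + 1) v := by
  -- The third equation defines `φ` from `ψ`; the other two then prescribe the increments of `ψ`
  -- along `(1,0)` and `(1,1)`. The discrete primitives `K₁`, `K₂` absorb the strip constants. The
  -- function `θ` of the column `u - v` does not affect the increments along `(1,1)`, so it is free
  -- to absorb `k₃` and the offset `o`.
  obtain ⟨K₁, h₁⟩ := exists_add_one_eq k₁
  obtain ⟨K₂, h₂⟩ := exists_add_one_eq k₂
  obtain ⟨θ, hθ⟩ := exists_add_one_eq fun j =>
    o j • ((3 : ℤ) • p + (2 : ℤ) • a + (2 : ℤ) • b + (2 : ℤ) • c) + a + (2 * j + 1) • b - c - k₃ j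
  obtain ⟨ψ, hψ⟩ : ∃ ψ : ℤ → ℤ → A, ∀ u v, ψ u v = θ (u - v) + K₁ u - K₂ (v + 1) +
      (v + 1) ^ 2 • a - u ^ 2 • b - ((u - v - 1) * v) • p := ⟨_, fun _ _ => rfl⟩
  refine ⟨fun u v => k₁ u + (2 * v + 1) • a + v • p - ψ (u + 1) v, ψ, fun u v => ?_,
    fun u v => ?_, fun u v => ?_⟩
  · have e : u + 1 - v = u - v + 1 := by ring
    beta_reduce
    rw [hψ, hψ, h₁, e, hθ]
    module
  · have e : u + 1 - v = u - v + 1 := by ring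
    have e' : u - (v - 1) = u - v + 1 := by ring
    beta_reduce
    rw [hψ, hψ, h₁, e, e', h₂, sub_add_cancel]
    module
  · beta_reduce
    abel

theorem exists_gauge_squishedWeight (p a b c : ℂˣ) (k₁ k₂ k₃ : ℤ → ℂˣ) (o : ℤ → ℤ) :
    ∃ g : HexVertex → ℂˣ, ∀ δ : HexDart,
      hexWeight (squishedWeight p a b c k₁ k₂ k₃) δ.edge =
        hexWeight (monochromaticWeight (p ^ 3 * a ^ 2 * b ^ 2 * c ^ 2) o) δ.edge *
          (g δ.1 * g (δ.1.nbr δ.2) : ℂˣ) := by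
  obtain ⟨φ, ψ, h1, h2, h3⟩ := exists_gauge (A := Additive ℂˣ) (.ofMul p) (.ofMul a) (.ofMul b)
    (.ofMul c) (fun n => .ofMul (k₁ n)) (fun n => .ofMul (k₂ n)) (fun n => .ofMul (k₃ n)) o
  let g : HexVertex → ℂˣ := fun
    | .black u v => (φ u v).toMul
    | .white u v => (ψ u v).toMul
  have key : ∀ u v d, squishedWeight p a b c k₁ k₂ k₃ d u v =
      monochromaticWeight (p ^ 3 * a ^ 2 * b ^ 2 * c ^ 2) o d u v *
        (g (.black u v) * g ((HexVertex.black u v).nbr d)) := by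
    intro u v d
    cases d
    · exact congrArg Additive.toMul (h1 u v)
    · exact (congrArg Additive.toMul (h2 u v)).trans (one_mul _).symm
    · exact (congrArg Additive.toMul (h3 u v)).trans (one_mul _).symm
  have key' : ∀ u v d, hexWeight (squishedWeight p a b c k₁ k₂ k₃) (HexDart.edge (.black u v, d)) =
      hexWeight (monochromaticWeight (p ^ 3 * a ^ 2 * b ^ 2 * c ^ 2) o)
        (HexDart.edge (.black u v, d)) *
          (g (.black u v) * g ((HexVertex.black u v).nbr d) : ℂˣ) := by
    intro u v d
    rw [HexDart.edge, hexWeight_black, hexWeight_black, key, Units.val_mul]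
  refine ⟨g, fun ⟨v, d⟩ => ?_⟩
  rcases v with ⟨u, v⟩ | ⟨u, v⟩
  · exact key' u v d
  · obtain ⟨u', v', h⟩ : ∃ u' v', (HexVertex.white u v).nbr d = .black u' v' := by
      cases d <;> exact ⟨_, _, rfl⟩
    have h4 := key' u' v' d
    rw [← h, HexVertex.nbr_nbr] at h4
    rw [← HexDart.edge_rev]
    refine h4.trans ?_
    rw [mul_comm (g ((HexVertex.white u v).nbr d)) (g (.white u v))]
    rfl

/-- Regrouping the gauge factors by vertices, each `g v` occurs to the power of the degree of `v`,
which is two. -/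
theorem prod_gauge_pow {V : Type*} [Fintype V] {G : SimpleGraph V} {N : Sym2 V → ℕ}
    (hN : IsDoubleDimerConfig G N) {w w' : Sym2 V → ℂ} {g : V → ℂ}
    (h : ∀ u v, G.Adj u v → w s(u, v) = w' s(u, v) * (g u * g v)) :
    ∏ e : Sym2 V, w e ^ N e = (∏ v, g v) ^ 2 * ∏ e : Sym2 V, w' e ^ N e := by
  have h1 : ∀ e, w e ^ N e = (∏ v, (if v ∈ e then g v ^ N e else 1)) * w' e ^ N e := by
    intro e
    by_cases he : e ∈ G.edgeSet
    · induction e using Sym2.ind with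
      | h u v =>
        have huv : G.Adj u v := he
        rw [h u v huv, ← Finset.prod_filter]
        have : (Finset.univ.filter fun v' => v' ∈ s(u, v)) = {u, v} := by
          ext
          simp
        rw [this, Finset.prod_pair huv.ne, mul_pow, mul_pow]
        ring
    · simp [hN.1 e he]
  have h2 : ∀ v, ∏ e : Sym2 V, (if v ∈ e then g v ^ N e else 1) = g v ^ 2 := by
    intro v
    rw [← Finset.prod_filter, Finset.prod_pow_eq_pow_sum, (isDoubleDimerConfig_iff.1 hN).2]
  rw [Finset.prod_congr rfl fun e _ => h1 e, Finset.prod_mul_distrib, Finset.prod_comm,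
    Finset.prod_congr rfl fun v _ => h2 v, Finset.prod_pow]

/-- The contributions for the squished weights and for the monochromatic weights are
proportional. -/
theorem exists_contribution_eq (x y z : ℕ) (p a b c : ℂˣ) (k₁ k₂ k₃ : ℤ → ℂˣ) (o : ℤ → ℤ) :
    ∃ κ : ℂˣ, ∀ (Γ : SL2Connection (boxGraph x y z)) (N : Sym2 (boxRegion x y z) → ℕ),
      IsDoubleDimerConfig (boxGraph x y z) N →
      doubleDimerContribution (boxWeight (squishedWeight p a b c k₁ k₂ k₃)) Γ N =
        κ * doubleDimerContribution
          (boxWeight (monochromaticWeight (p ^ 3 * a ^ 2 * b ^ 2 * c ^ 2) o)) Γ N := by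
  obtain ⟨g, hg⟩ := exists_gauge_squishedWeight p a b c k₁ k₂ k₃ o
  refine ⟨(∏ v : boxRegion x y z, g v.1) ^ 2, fun Γ N hN => ?_⟩
  rw [doubleDimerContribution_eq, doubleDimerContribution_eq, prod_gauge_pow hN
    (w' := boxWeight (monochromaticWeight (p ^ 3 * a ^ 2 * b ^ 2 * c ^ 2) o))
    (g := fun v => (g v.1 : ℂ)), mul_assoc]
  · simp
  · rintro ⟨u, hu⟩ ⟨v, hv⟩ ⟨d, hd⟩
    obtain rfl : v = u.nbr d := hd
    have := hg (u, d)
    rwa [Units.val_mul] at this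

/-! ### The theorem -/

theorem mainTheorem1 (x y z : ℕ) (p q r s t a b c : ℂˣ) (hq : p ^ 3 = q)
    (hr : a ^ 2 = r) (hs : b ^ 2 = s) (ht : c ^ 2 = t) (k₁ k₂ k₃ : ℤ → ℂˣ)
    (Γ : SL2Connection (boxGraph x y z))
    (hΓ : Γ = abcConnection x y z a b c ∨ Γ = abcConnection x y z a⁻¹ b⁻¹ c⁻¹) :
    IsMeasurePreservingMap
        (dimerConfigs (boxGraph (2 * x) (2 * y) (2 * z)))
        {N | IsDoubleDimerConfig (boxGraph x y z) N}
        squish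
        (dimerWeight (boxWeight (periodicWeight p r s t k₁ k₂ k₃)))
        (doubleDimerContribution (boxWeight (squishedWeight p a b c k₁ k₂ k₃)) Γ) ∧
      ∀ o : ℤ → ℤ, ∃ κ : ℂˣ,
        IsMeasurePreservingMap
          (dimerConfigs (boxGraph (2 * x) (2 * y) (2 * z)))
          {N | IsDoubleDimerConfig (boxGraph x y z) N}
          squish
          (dimerWeight (boxWeight (periodicWeight p r s t k₁ k₂ k₃)))
          (fun N => κ * doubleDimerContribution
            (boxWeight (monochromaticWeight (q * r * s * t) o)) Γ N) := by
  have h : ∀ N, IsDoubleDimerConfig (boxGraph x y z) N → _ := fun N hN =>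
    sum_fiber_eq_contribution p r s t a b c hr hs ht k₁ k₂ k₃ hΓ hN
  refine ⟨isMeasurePreservingMap_of_fiber (fun m hm => isDoubleDimerConfig_squish hm) h,
    fun o => ?_⟩
  obtain ⟨κ, hκ⟩ := exists_contribution_eq x y z p a b c k₁ k₂ k₃ o
  refine ⟨κ, isMeasurePreservingMap_of_fiber (fun m hm => isDoubleDimerConfig_squish hm)
    fun N hN => (h N hN).trans ?_⟩
  subst hq hr hs ht
  exact hκ Γ N hN
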